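/- Notation. $\mathbb D\subset\mathbb C$ is the open unit disc and $w\bullet z=\sum_{j=1}^n w_jz_j$ for $w,z\in\mathbb C^n$; for a holomorphic function $G$, $G'(p)=(\partial G/\partial z_1(p),\dots,\partial G/\partial z_n(p))$. Let $D\subset\mathbb C^n$ be a domain. A *complex geodesic* of $D$ is a holomorphic map $f:\mathbb D\to D$ for which there is a holomorphic $G:D\to\mathbb D$ with $G(f(\lambda))=\lambda$ for all $\lambda\in\mathbb D$; every such $G$ is called a *left inverse* of $f$. A left inverse $G$ is called *Lempert* if for each $\lambda\in\mathbb D$ the fibre $G^{-1}(\lambda)$ is the intersection of $D$ with a complex affine hyperplane. Let $p(s,t)=\operatorname{artanh}\left|\frac{t-s}{1-\bar s t}\right|$ be the Poincaré distance of $\mathbb D$. The Kobayashi pseudodistance $k_D$ is the largest pseudodistance on $D$ that does not exceed the Lempert function $l_D(w,z)=\inf\{p(s,t):\ \varphi:\mathbb D\to D\text{ holomorphic},\ \varphi(s)=w,\ \varphi(t)=z\}$, and $k_D^*=\tanh k_D$. For $q\in D$ and $0<R<1$ the Kobayashi ball is $B_{k_D^*}(q,R)=\{z\in D: k_D^*(q,z)<R\}$.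 We say that *the supporting hyperplanes of the Kobayashi balls centred at $q$ are unique* if for every $0<R<1$ each boundary point of $B_{k_D^*}(q,R)$ lies on at most one supporting real affine hyperplane of $B_{k_D^*}(q,R)$. A *strongly convex* domain is a bounded domain with a $C^2$ defining function, with non-vanishing gradient on the boundary, whose real Hessian is positive definite on the real tangent space at each boundary point. **Theorem 2.1.** Let $D\subset\mathbb C^n$ be a bounded convex domain, let $f:\mathbb D\to D$ be a complex geodesic and let $G$ be any left inverse of $f$. Then: 1. For each $z\in D$ there is exactly one $\lambda=:H(z)\in\mathbb D$ such that $(z-f(\lambda))\bullet G'(f(\lambda))=0$. 2. The function $H:D\to\mathbb D$ is holomorphic, it is a Lempert left inverse of $f$, and $H'(f(\lambda))=G'(f(\lambda))$ for all $\lambda\in\mathbb D$. 3. If $G$ is a Lempert left inverse, then $H\equiv G$ on $D$. 4. If the supporting hyperplanes of the Kobayashi balls centred at $f(0)$ are unique, then $f$ has only one Lempert left inverse. If $D$ is strongly convex, then the supporting hyperplanes of the Kobayashi balls centred at $f(0)$ are unique (so that $f$ has only one Lempert left inverse). -/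

import Mathlib

open Metric Set

noncomputable section

/-- A domain of `ℂⁿ`, as a set: open and connected (in particular non-empty). -/
def IsDomainIn {n : ℕ} (D : Set (EuclideanSpace ℂ (Fin n))) : Prop :=
  IsOpen D ∧ IsConnected D

/-- `G : D → 𝔻` is holomorphic and `G (f lam) = lam` on the unit disc `𝔻 = ball 0 1`.
(Functions on `D` and on `𝔻` are total functions of which only the values on `D`, `𝔻` matter.) -/
structure IsGeodesicLeftInverse {n : ℕ} (D : Set (EuclideanSpace ℂ (Fin n)))
    (f : ℂ → EuclideanSpace ℂ (Fin n)) (G : EuclideanSpace ℂ (Fin n) → ℂ) : Prop where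
  holo : DifferentiableOn ℂ G D
  mapsTo : MapsTo G D (ball 0 1)
  left_inv : ∀ lam ∈ ball (0 : ℂ) 1, G (f lam) = lam

/-- A complex geodesic of `D`: a holomorphic map `𝔻 → D` that has a holomorphic left inverse
`D → 𝔻`. -/
structure IsComplexGeodesic {n : ℕ} (D : Set (EuclideanSpace ℂ (Fin n)))
    (f : ℂ → EuclideanSpace ℂ (Fin n)) : Prop where
  holo : DifferentiableOn ℂ f (ball 0 1)
  mapsTo : MapsTo f (ball 0 1) D
  exists_left_inverse : ∃ G : EuclideanSpace ℂ (Fin n) → ℂ, IsGeodesicLeftInverse D f G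

/-- A Lempert left inverse: a left inverse, each of whose fibres over `𝔻` is the intersection of
`D` with a complex affine hyperplane `{z | a z = c}`, `a ≠ 0`. -/
structure IsLempertLeftInverse {n : ℕ} (D : Set (EuclideanSpace ℂ (Fin n)))
    (f : ℂ → EuclideanSpace ℂ (Fin n)) (G : EuclideanSpace ℂ (Fin n) → ℂ) : Prop
    extends IsGeodesicLeftInverse D f G where
  fibre_eq : ∀ lam ∈ ball (0 : ℂ) 1, ∃ (a : EuclideanSpace ℂ (Fin n) →L[ℂ] ℂ) (c : ℂ),
    a ≠ 0 ∧ {z ∈ D | G z = lam} = {z | a z = c} ∩ D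

/-- The Poincaré distance of the unit disc,
`artanh |(z - w) / (1 - conj w * z)|`. -/
def poincareDist (w z : ℂ) : ℝ :=
  Real.artanh ‖(z - w) / (1 - (starRingEnd ℂ) w * z)‖

/-- The Lempert function of `D`: the infimum of `poincareDist s t` over all holomorphic
`φ : 𝔻 → D` with `φ s = w` and `φ t = z`. (For `w`, `z` in a domain such `φ` exist.) -/
def lempertFunction {n : ℕ} (D : Set (EuclideanSpace ℂ (Fin n)))
    (w z : EuclideanSpace ℂ (Fin n)) : ℝ :=
  sInf {r : ℝ | ∃ (φ : ℂ → EuclideanSpace ℂ (Fin n)) (s t : ℂ),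
    DifferentiableOn ℂ φ (ball 0 1) ∧ MapsTo φ (ball 0 1) D ∧
    s ∈ ball (0 : ℂ) 1 ∧ t ∈ ball (0 : ℂ) 1 ∧ φ s = w ∧ φ t = z ∧ r = poincareDist s t}

/-- The Kobayashi (pseudo)distance of `D`: the largest pseudodistance below the Lempert function,
that is, the infimum of the lengths of finite chains in `D` from `w` to `z`. -/
def kobayashiDist {n : ℕ} (D : Set (EuclideanSpace ℂ (Fin n)))
    (w z : EuclideanSpace ℂ (Fin n)) : ℝ :=
  sInf {r : ℝ | ∃ (N : ℕ) (c : ℕ → EuclideanSpace ℂ (Fin n)),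
    c 0 = w ∧ c N = z ∧ (∀ j ≤ N, c j ∈ D) ∧
    r = ∑ j ∈ Finset.range N, lempertFunction D (c j) (c (j + 1))}

/-- The Kobayashi ball `{z ∈ D | tanh (k_D(p, z)) < R}`. -/
def kobayashiBall {n : ℕ} (D : Set (EuclideanSpace ℂ (Fin n)))
    (p : EuclideanSpace ℂ (Fin n)) (R : ℝ) : Set (EuclideanSpace ℂ (Fin n)) :=
  {z ∈ D | Real.tanh (kobayashiDist D p z) < R}

/-- `S` is a supporting (real affine) hyperplane of `B` at `q`: it passes through `q`, and `B` lies
in one of the two closed half-spaces bounded by it. -/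
def IsSupportingHyperplane {n : ℕ} (B : Set (EuclideanSpace ℂ (Fin n)))
    (q : EuclideanSpace ℂ (Fin n)) (S : Set (EuclideanSpace ℂ (Fin n))) : Prop :=
  ∃ a : EuclideanSpace ℂ (Fin n) →L[ℝ] ℝ,
    a ≠ 0 ∧ S = {z | a z = a q} ∧ ∀ z ∈ B, a z ≤ a q

/-- Each Kobayashi ball of `D` centred at `p` with radius in `(0, 1)` has at most one supporting
hyperplane at each of its boundary points. -/
def UniqueSupportingHyperplanes {n : ℕ} (D : Set (EuclideanSpace ℂ (Fin n)))
    (p : EuclideanSpace ℂ (Fin n)) : Prop :=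
  ∀ R : ℝ, 0 < R → R < 1 → ∀ q ∈ frontier (kobayashiBall D p R),
    ∀ S T : Set (EuclideanSpace ℂ (Fin n)),
      IsSupportingHyperplane (kobayashiBall D p R) q S →
      IsSupportingHyperplane (kobayashiBall D p R) q T → S = T

/-- A strongly convex domain: a bounded domain with a `C²` defining function `r` (with non-zero
gradient on the boundary) whose real Hessian is positive definite on the real tangent space at
each boundary point. -/
def IsStronglyConvexDomain {n : ℕ} (D : Set (EuclideanSpace ℂ (Fin n))) : Prop :=
  IsDomainIn D ∧ Bornology.IsBounded D ∧
    ∃ r : EuclideanSpace ℂ (Fin n) → ℝ, ContDiff ℝ 2 r ∧ D = {z | r z < 0} ∧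
      ∀ q ∈ frontier D, fderiv ℝ r q ≠ 0 ∧
        ∀ v : EuclideanSpace ℂ (Fin n), v ≠ 0 → fderiv ℝ r q v = 0 →
          0 < fderiv ℝ (fderiv ℝ r) q v v

end

/-! Write h(λ) = G'(f(λ)) and, for z in D, ψ_z(λ) = h(λ)(z - f(λ)). By convexity the maps λ ↦ G(f(λ)
+ t(z - f(λ))), 0 ≤ t ≤ 1, are holomorphic self-maps of the disc that leave the identity at t = 0
with velocity ψ_z. Schwarz–Pick then says that ψ_z does not dilate the hyperbolic metric, i.e.
`hypDiv` ≤ 0 (`isDualPair_of_leftInverse`). Since D is open and bounded, z can be pushed a fixed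
proportion further away from every f(λ), which improves this to `hypDiv` ≤ -s < 0
(`IsDualPair.exists_hypDiv_le`). Such a field points inward on large circles, so it has a zero, and
never two (`exists_zero_of_hypDiv_le`, `eq_of_hypDiv_neg`). The zero is simple, so the implicit
function theorem makes it a holomorphic function H of z, and differentiating its equation along f
gives H' = G'. Only the properties collected in `IsDualPair` enter. A Lempert left inverse G is
constant near f(G(z)) on a hyperplane through z and f(G(z)), so G(z) is the zero of ψ_z and G = H.

A left inverse H yields the supporting functional Re(conj λ · H'(f(λ))) of a Kobayashi ball at f(λ).
If supporting hyperplanes are unique, the normalisation H'(f(λ)) f'(λ) = 1 determines H' along f,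
hence a Lempert H.

In the strongly convex case let a support the ball of radius R about p at q. Some disc φ in D has
φ(0) = p and φ(R) = q, and it maximises a(ψ(R)) among discs ψ from p. Hahn–Banach in the space of
continuous loops separates the loops in D from the boundary values of discs that start at p and
satisfy a(ψ(R)) ≥ a(q). A Cauchy transform of the separating functional is, up to scale, a dual
family h along φ with Re h(R) proportional to a (`exists_isDualPair`). When the boundary has unique
normals and exposed points, φ has only one dual family, because its boundary values are forced by
the normals (`IsDualPair.eqOn`). So a is unique up to a positive factor.

The same duality, applied to a disc that reaches q from p at the smallest possible parameter
(`exists_extremal_disc`), gives that disc a left inverse. This is Lempert's theorem; it lets single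
discs describe the Kobayashi balls (`exists_disc_of_mem_kobayashiBall`). -/

open Filter Topology ComplexConjugate

/-! ### Disc automorphisms -/

/-- The automorphism `lam ↦ (lam + a) / (1 + conj a * lam)` of the unit disc. -/
noncomputable def discAut (a lam : ℂ) : ℂ := (lam + a) / (1 + conj a * lam)

theorem one_add_conj_mul_ne_zero {a l : ℂ} (ha : ‖a‖ < 1) (hl : ‖l‖ < 1) :
    1 + conj a * l ≠ 0 := by
  intro h
  have h1 : conj a * l = -1 := by linear_combination h
  have h2 : ‖conj a * l‖ = 1 := by rw [h1]; simp
  rw [norm_mul, RCLike.norm_conj] at h2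
  nlinarith [norm_nonneg a, norm_nonneg l]

theorem one_sub_conj_mul_ne_zero {a l : ℂ} (ha : ‖a‖ < 1) (hl : ‖l‖ < 1) :
    1 - conj a * l ≠ 0 := by
  have := one_add_conj_mul_ne_zero (a := -a) (l := l) (by simpa using ha) hl
  simpa [sub_eq_add_neg] using this

theorem discAut_zero (a : ℂ) : discAut a 0 = a := by simp [discAut]

theorem normSq_one_add_sub (a l : ℂ) :
    Complex.normSq (1 + conj a * l) - Complex.normSq (l + a) =
      (1 - Complex.normSq a) * (1 - Complex.normSq l) := by
  simp [Complex.normSq_apply]; ring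

theorem one_sub_normSq_discAut {a l : ℂ} (ha : ‖a‖ < 1) (hl : ‖l‖ < 1) :
    (1 - Complex.normSq (discAut a l)) * Complex.normSq (1 + conj a * l) =
      (1 - Complex.normSq a) * (1 - Complex.normSq l) := by
  have h := one_add_conj_mul_ne_zero ha hl
  have h' : Complex.normSq (1 + conj a * l) ≠ 0 := by simpa using h
  rw [← normSq_one_add_sub, discAut, Complex.normSq_div, sub_mul, div_mul_cancel₀ _ h', one_mul]

theorem norm_lt_one_iff_normSq {a : ℂ} : ‖a‖ < 1 ↔ Complex.normSq a < 1 := by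
  rw [Complex.normSq_eq_norm_sq]
  constructor <;> intro h <;> nlinarith [norm_nonneg a]

theorem norm_discAut_lt_one {a l : ℂ} (ha : ‖a‖ < 1) (hl : ‖l‖ < 1) : ‖discAut a l‖ < 1 := by
  have h := one_sub_normSq_discAut ha hl
  have h1 : 0 < Complex.normSq (1 + conj a * l) :=
    Complex.normSq_pos.2 (one_add_conj_mul_ne_zero ha hl)
  rw [norm_lt_one_iff_normSq] at *
  have h2 : 0 < (1 - Complex.normSq a) * (1 - Complex.normSq l) :=
    mul_pos (by linarith) (by linarith)
  rw [← h] at h2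
  have := (pos_iff_pos_of_mul_pos h2).2 h1
  linarith

theorem discAut_mapsTo {a : ℂ} (ha : a ∈ ball (0 : ℂ) 1) :
    MapsTo (discAut a) (ball 0 1) (ball 0 1) := by
  intro l hl
  simp only [mem_ball_zero_iff] at *
  exact norm_discAut_lt_one ha hl

theorem hasDerivAt_discAut {a l : ℂ} (ha : ‖a‖ < 1) (hl : ‖l‖ < 1) :
    HasDerivAt (discAut a) ((1 - conj a * a) / (1 + conj a * l) ^ 2) l := by
  have h := one_add_conj_mul_ne_zero ha hl
  have h1 : HasDerivAt (fun x : ℂ => x + a) 1 l := (hasDerivAt_id l).add_const a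
  have h2 : HasDerivAt (fun x : ℂ => 1 + conj a * x) (conj a) l := by
    simpa using ((hasDerivAt_id l).const_mul (conj a)).const_add 1
  refine (h1.div h2 h).congr_deriv ?_
  congr 1
  ring

theorem differentiableOn_discAut {a : ℂ} (ha : a ∈ ball (0 : ℂ) 1) :
    DifferentiableOn ℂ (discAut a) (ball 0 1) := fun l hl =>
  (hasDerivAt_discAut (by simpa using ha)
    (by simpa using hl)).differentiableAt.differentiableWithinAt

theorem discAut_neg_discAut {a l : ℂ} (ha : ‖a‖ < 1) (hl : ‖l‖ < 1) :
    discAut (-a) (discAut a l) = l := by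
  have h := one_add_conj_mul_ne_zero ha hl
  have h2 := one_add_conj_mul_ne_zero (a := -a) (by simpa using ha) (norm_discAut_lt_one ha hl)
  have h3 := one_sub_conj_mul_ne_zero ha ha
  unfold discAut at *
  rw [div_eq_iff h2]
  simp only [map_neg]
  have h' : 1 + l * conj a ≠ 0 := by rwa [mul_comm]
  field_simp
  ring

theorem discAut_discAut_neg {a l : ℂ} (ha : ‖a‖ < 1) (hl : ‖l‖ < 1) :
    discAut a (discAut (-a) l) = l := by
  have := discAut_neg_discAut (a := -a) (l := l) (by simpa using ha) hl
  simpa using this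

theorem discAut_neg_self (a : ℂ) : discAut (-a) a = 0 := by simp [discAut]

/-! ### The hyperbolic divergence of a holomorphic vector field on the disc -/

/-- The infinitesimal rate at which the flow of the vector field `psi` dilates the hyperbolic
metric of the unit disc at `mu`. -/
noncomputable def hypDiv (psi : ℂ → ℂ) (mu : ℂ) : ℝ :=
  (deriv psi mu).re + 2 * (conj mu * psi mu).re / (1 - ‖mu‖ ^ 2)

/-- In the radial direction e the function Re(conj e · psi(xe)) / (1 - x²) has derivative `hypDiv
psi` / (1 - x²), which is at most -s / (1 - x²) ≤ -(s/2) / (1 - x). Integrating from 0 to |l| gives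
the logarithm. -/
theorem re_conj_mul_le_of_hypDiv_le {psi : ℂ → ℂ} (hpsi : DifferentiableOn ℂ psi (ball 0 1))
    {s : ℝ} (hs : 0 ≤ s) (hd : ∀ mu ∈ ball (0 : ℂ) 1, hypDiv psi mu ≤ -s) {l : ℂ}
    (hl : l ∈ ball (0 : ℂ) 1) :
    (conj l * psi l).re ≤ (1 - ‖l‖ ^ 2) *
      ((conj l * psi 0).re + s / 2 * ‖l‖ * Real.log (1 - ‖l‖)) := by
  rcases eq_or_ne l 0 with rfl | hl0
  · simp
  have hl1 : ‖l‖ < 1 := by simpa using hl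
  have hlpos : 0 < ‖l‖ := norm_pos_iff.2 hl0
  set e : ℂ := l / ‖l‖ with he
  have hle : (‖l‖ : ℂ) * e = l := by
    rw [he, mul_div_cancel₀]
    exact_mod_cast hlpos.ne'
  have hene : ‖e‖ = 1 := by simp [he, hl0]
  have hxe : ∀ x ∈ Icc (0 : ℝ) ‖l‖, (x : ℂ) * e ∈ ball (0 : ℂ) 1 := by
    intro x hx
    simp only [mem_ball_zero_iff, norm_mul, hene, Complex.norm_real, Real.norm_eq_abs,
      abs_of_nonneg hx.1]
    linarith [hx.2]
  let F : ℝ → ℝ := fun x => (conj e * psi (x * e)).re / (1 - x ^ 2) - s / 2 * Real.log (1 - x)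
  have hF : ∀ x ∈ Icc (0 : ℝ) ‖l‖, HasDerivAt F
      ((deriv psi (x * e)).re / (1 - x ^ 2) + (conj e * psi (x * e)).re * (2 * x) / (1 - x ^ 2) ^ 2
        + s / 2 / (1 - x)) x := by
    intro x hx
    have hx1 : x < 1 := by linarith [hx.2]
    have h1 : (1 : ℝ) - x ≠ 0 := by linarith
    have h2 : (1 : ℝ) - x ^ 2 ≠ 0 := by nlinarith [hx.1]
    have d0 : HasDerivAt psi (deriv psi (x * e)) ((x : ℂ) * e) :=
      (hpsi.differentiableAt (isOpen_ball.mem_nhds (hxe x hx))).hasDerivAt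
    have d1 : HasDerivAt (fun y : ℂ => conj e * psi (y * e)) (deriv psi (x * e)) (x : ℂ) := by
      have := (d0.comp (x : ℂ) ((hasDerivAt_id (x : ℂ)).mul_const e)).const_mul (conj e)
      refine this.congr_deriv ?_
      have : conj e * e = 1 := by
        rw [mul_comm, Complex.mul_conj, Complex.normSq_eq_norm_sq, hene]; simp
      linear_combination (deriv psi (x * e)) * this
    have d2 := d1.real_of_complex
    have d3 : HasDerivAt (fun y : ℝ => 1 - y ^ 2) (-(2 * x)) x := by
      simpa using ((hasDerivAt_id x).pow 2).const_sub 1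
    have d4 : HasDerivAt (fun y : ℝ => Real.log (1 - y)) (-1 / (1 - x)) x := by
      simpa using ((hasDerivAt_id x).const_sub 1).log h1
    refine ((d2.div d3 h2).sub (d4.const_mul (s / 2))).congr_deriv ?_
    field_simp
    ring
  have hanti : AntitoneOn F (Icc 0 ‖l‖) := by
    refine antitoneOn_of_deriv_nonpos (convex_Icc _ _)
      (fun x hx => (hF x hx).continuousAt.continuousWithinAt)
      (fun x hx => (hF x (interior_subset hx)).differentiableAt.differentiableWithinAt) ?_
    intro x hx
    have hx := interior_subset hx
    rw [(hF x hx).deriv]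
    have hx1 : x < 1 := by linarith [hx.2]
    have h2 : (0 : ℝ) < 1 - x ^ 2 := by nlinarith [hx.1]
    have h3 := hd _ (hxe x hx)
    have hn : ‖(x : ℂ) * e‖ = x := by
      simp [hene, abs_of_nonneg hx.1]
    rw [hypDiv, hn] at h3
    have hre : (conj ((x : ℂ) * e) * psi (x * e)).re = x * (conj e * psi (x * e)).re := by
      rw [map_mul, Complex.conj_ofReal, mul_assoc, Complex.re_ofReal_mul]
    rw [hre] at h3
    have h4 : (deriv psi (x * e)).re / (1 - x ^ 2) +
        (conj e * psi (x * e)).re * (2 * x) / (1 - x ^ 2) ^ 2 =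
        ((deriv psi (x * e)).re + 2 * (x * (conj e * psi (x * e)).re) / (1 - x ^ 2)) /
          (1 - x ^ 2) := by
      field_simp
    rw [h4]
    have h5 : ((deriv psi (x * e)).re + 2 * (x * (conj e * psi (x * e)).re) / (1 - x ^ 2)) /
          (1 - x ^ 2) ≤ -s / (1 - x ^ 2) := by gcongr
    have h6 : s / 2 / (1 - x) ≤ s / (1 - x ^ 2) := by
      rw [div_div, div_le_div_iff₀ (by nlinarith) h2]
      have : 0 ≤ s * (1 - x) := mul_nonneg hs (by linarith)
      nlinarith [hx.1]
    rw [neg_div] at h5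
    linarith
  have key := hanti (left_mem_Icc.2 hlpos.le) (right_mem_Icc.2 hlpos.le) hlpos.le
  simp only [F, hle] at key
  have h2 : (0 : ℝ) < 1 - ‖l‖ ^ 2 := by nlinarith
  have key2 : (conj e * psi l).re / (1 - ‖l‖ ^ 2) ≤
      (conj e * psi 0).re + s / 2 * Real.log (1 - ‖l‖) := by
    simp at key ⊢; linarith
  rw [div_le_iff₀ h2] at key2
  have hre : ∀ w : ℂ, (conj l * w).re = ‖l‖ * (conj e * w).re := by
    intro w
    conv_lhs => rw [← hle]
    rw [map_mul, Complex.conj_ofReal, mul_assoc, Complex.re_ofReal_mul]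
  rw [hre, hre]
  nlinarith

/-- The logarithm in the radial estimate beats |psi 0| near the unit circle, so psi points strictly
inward on some circle. A zero-free field of this kind contradicts the maximum principle. -/
theorem exists_zero_of_hypDiv_le {psi : ℂ → ℂ} (hpsi : DifferentiableOn ℂ psi (ball 0 1))
    {s : ℝ} (hs : 0 < s) (hd : ∀ mu ∈ ball (0 : ℂ) 1, hypDiv psi mu ≤ -s) :
    ∃ l ∈ ball (0 : ℂ) 1, psi l = 0 := by
  by_contra! hne
  -- This radius makes (s/2) log(1 - r) equal to -(‖psi 0‖ + 1), just enough to dominate the term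
  -- with psi 0.
  set r : ℝ := 1 - Real.exp (-(2 / s) * (‖psi 0‖ + 1)) with hr
  have hexp : Real.exp (-(2 / s) * (‖psi 0‖ + 1)) < 1 := by
    rw [Real.exp_lt_one_iff]
    have : 0 < 2 / s * (‖psi 0‖ + 1) := by positivity
    linarith
  have hr0 : 0 < r := by linarith
  have hr1 : r < 1 := by
    have := Real.exp_pos (-(2 / s) * (‖psi 0‖ + 1)); linarith
  have hneg : ∀ l : ℂ, ‖l‖ = r → (conj l * psi l).re < 0 := by
    intro l hl
    have h := re_conj_mul_le_of_hypDiv_le hpsi hs.le hd (l := l) (by simp [hl, hr1])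
    refine h.trans_lt (mul_neg_of_pos_of_neg (by rw [hl]; nlinarith) ?_)
    have h1 : (conj l * psi 0).re ≤ r * ‖psi 0‖ := by
      refine (Complex.re_le_norm _).trans ?_
      rw [norm_mul, RCLike.norm_conj, hl]
    have h2 : Real.log (1 - ‖l‖) = -(2 / s) * (‖psi 0‖ + 1) := by
      rw [hl, hr, sub_sub_cancel, Real.log_exp]
    rw [h2, hl]
    have : s / 2 * r * (-(2 / s) * (‖psi 0‖ + 1)) = -(r * (‖psi 0‖ + 1)) := by
      field_simp
    rw [this]
    nlinarith
  have hsub : closedBall (0 : ℂ) r ⊆ ball 0 1 := closedBall_subset_ball hr1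
  -- This has modulus 1 at the centre and less than 1 on the circle, as Re(l / psi l) has the sign
  -- of Re(conj l · psi l).
  let F : ℂ → ℂ := fun l => Complex.exp (l / psi l)
  have hFd : DifferentiableOn ℂ F (closedBall 0 r) := by
    intro l hl
    have h1 := (hpsi l (hsub hl)).mono hsub
    exact (differentiableWithinAt_id.div h1 (hne l (hsub hl))).cexp
  have hdc : DiffContOnCl ℂ F (ball 0 r) := by
    refine DifferentiableOn.diffContOnCl ?_
    rwa [closure_ball _ hr0.ne']
  obtain ⟨z, hz, hmax⟩ := Complex.exists_mem_frontier_isMaxOn_norm isBounded_ball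
    (nonempty_ball.2 hr0) hdc
  rw [frontier_ball _ hr0.ne', mem_sphere_zero_iff_norm] at hz
  have h0 := hmax (subset_closure (mem_ball_self hr0))
  simp only [Function.comp, mem_ofPred_eq, F, Complex.norm_exp, zero_div, Complex.zero_re,
    Real.exp_zero] at h0
  have hpz : psi z ≠ 0 := hne z (by simp [hz, hr1])
  have : (z / psi z).re < 0 := by
    have h1 : z / psi z = (Complex.normSq (psi z))⁻¹ * (z * conj (psi z)) := by
      rw [div_eq_mul_inv, Complex.inv_def]; push_cast; ring
    rw [h1, Complex.re_ofReal_mul]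
    refine mul_neg_of_pos_of_neg (inv_pos.2 (Complex.normSq_pos.2 hpz)) ?_
    have := hneg z hz
    simp at this ⊢
    linarith
  have := Real.exp_lt_one_iff.2 this
  linarith

/-- The pull-back of the vector field `psi` under a disc automorphism. -/
theorem hypDiv_pullback {psi : ℂ → ℂ} (hpsi : DifferentiableOn ℂ psi (ball 0 1)) {a l : ℂ}
    (ha : a ∈ ball (0 : ℂ) 1) (hl : l ∈ ball (0 : ℂ) 1) :
    hypDiv (fun l => psi (discAut a l) * ((1 + conj a * l) ^ 2 / (1 - conj a * a))) l =
      hypDiv psi (discAut a l) := by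
  have hm := discAut_mapsTo ha hl
  have ha1 : ‖a‖ < 1 := by simpa using ha
  have hl1 : ‖l‖ < 1 := by simpa using hl
  have hm1 : ‖discAut a l‖ < 1 := by simpa using hm
  have n1 := one_add_conj_mul_ne_zero ha1 hl1
  have n2 := one_sub_conj_mul_ne_zero ha1 ha1
  have n3 := one_sub_conj_mul_ne_zero hl1 hl1
  have n4 := one_sub_conj_mul_ne_zero hm1 hm1
  have n1' : 1 + a * conj l ≠ 0 := by
    intro h; apply n1
    have := congrArg conj h
    simpa using this
  have c1 : 1 + l * conj a ≠ 0 := by rwa [mul_comm]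
  have c1' : 1 + conj l * a ≠ 0 := by rwa [mul_comm]
  have c2 : 1 - a * conj a ≠ 0 := by rwa [mul_comm]
  have c3 : 1 - l * conj l ≠ 0 := by rwa [mul_comm]
  have d0 : HasDerivAt psi (deriv psi (discAut a l)) (discAut a l) :=
    (hpsi.differentiableAt (isOpen_ball.mem_nhds hm)).hasDerivAt
  have d1 := d0.comp l (hasDerivAt_discAut ha1 hl1)
  have d2 : HasDerivAt (fun x : ℂ => (1 + conj a * x) ^ 2 / (1 - conj a * a))
      (2 * (1 + conj a * l) * conj a / (1 - conj a * a)) l := by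
    have := ((((hasDerivAt_id l).const_mul (conj a)).const_add 1).pow 2).div_const
      (1 - conj a * a)
    simpa using this
  have d3 := d1.mul d2
  have hds : deriv (fun l => psi (discAut a l) * ((1 + conj a * l) ^ 2 / (1 - conj a * a))) l =
      deriv psi (discAut a l) + psi (discAut a l) *
        (2 * (1 + conj a * l) * conj a / (1 - conj a * a)) := by
    refine (d3.congr_deriv ?_).deriv
    simp only [Function.comp]
    field_simp
  have hform : ∀ (w m : ℂ), 2 * (conj m * w).re / (1 - ‖m‖ ^ 2) =
      (2 * conj m * w / (1 - conj m * m)).re := by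
    intro w m
    have : (1 : ℂ) - conj m * m = ((1 - ‖m‖ ^ 2 : ℝ) : ℂ) := by
      rw [mul_comm, Complex.mul_conj, Complex.normSq_eq_norm_sq]; push_cast; rfl
    rw [this, Complex.div_ofReal_re, mul_assoc, ← Complex.ofReal_ofNat, Complex.re_ofReal_mul]
  unfold hypDiv
  rw [hds, hform, hform, ← Complex.add_re, ← Complex.add_re]
  congr 1
  have hA : 2 * conj (discAut a l) / (1 - conj (discAut a l) * discAut a l) =
      2 * (conj l + conj a) * (1 + conj a * l) / ((1 - conj a * a) * (1 - conj l * l)) := by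
    have hc : conj (discAut a l) = (conj l + conj a) / (1 + a * conj l) := by
      simp [discAut]
    rw [hc] at n4 ⊢
    rw [div_eq_div_iff n4 (mul_ne_zero n2 n3)]
    unfold discAut
    field_simp
    ring
  rw [show 2 * conj (discAut a l) * psi (discAut a l) /
    (1 - conj (discAut a l) * discAut a l) = psi (discAut a l) *
      (2 * conj (discAut a l) / (1 - conj (discAut a l) * discAut a l)) by ring, hA]
  field_simp
  ring

/-- A disc automorphism carries a to 0 and preserves `hypDiv`. With a zero at the centre the radial
estimate is strictly negative away from it and excludes a second zero. -/
theorem eq_of_hypDiv_neg {psi : ℂ → ℂ} (hpsi : DifferentiableOn ℂ psi (ball 0 1))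
    {s : ℝ} (hs : 0 < s) (hd : ∀ mu ∈ ball (0 : ℂ) 1, hypDiv psi mu ≤ -s) {a b : ℂ}
    (ha : a ∈ ball (0 : ℂ) 1) (hb : b ∈ ball (0 : ℂ) 1) (hpa : psi a = 0) (hpb : psi b = 0) :
    a = b := by
  have ha1 : ‖a‖ < 1 := by simpa using ha
  have hb1 : ‖b‖ < 1 := by simpa using hb
  have hna : -a ∈ ball (0 : ℂ) 1 := by simpa using ha
  set l := discAut (-a) b with hl
  have hlb : l ∈ ball (0 : ℂ) 1 := discAut_mapsTo hna hb
  have hdiff : DifferentiableOn ℂ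
      (fun l => psi (discAut a l) * ((1 + conj a * l) ^ 2 / (1 - conj a * a))) (ball 0 1) := by
    refine (hpsi.comp (differentiableOn_discAut ha) (discAut_mapsTo ha)).mul ?_
    fun_prop
  have key := re_conj_mul_le_of_hypDiv_le hdiff hs.le
    (fun mu hmu => by rw [hypDiv_pullback hpsi ha hmu]; exact hd _ (discAut_mapsTo ha hmu)) hlb
  simp only [hl, discAut_discAut_neg ha1 hb1, discAut_zero, hpa, hpb] at key
  rw [← hl] at key
  by_contra hne
  have hl0 : l ≠ 0 := by
    intro h
    apply hne
    have := discAut_discAut_neg ha1 hb1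
    rw [← hl, h, discAut_zero] at this
    exact this
  have hlpos : 0 < ‖l‖ := norm_pos_iff.2 hl0
  have hl1 : ‖l‖ < 1 := by simpa using hlb
  have hlog : Real.log (1 - ‖l‖) < 0 := Real.log_neg (by linarith) (by linarith)
  have : (1 - ‖l‖ ^ 2) * (s / 2 * ‖l‖ * Real.log (1 - ‖l‖)) < 0 :=
    mul_neg_of_pos_of_neg (by nlinarith) (mul_neg_of_pos_of_neg (by positivity) hlog)
  simp at key
  linarith

/-! ### Dual families along a disc and the left inverses they define -/

section DualPair

variable {E : Type*} [NormedAddCommGroup E] [NormedSpace ℂ E]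

/-- A holomorphic disc `f` in `D` and a holomorphic family `h` of linear functionals along `f`, dual
to `f'`, such that the vector fields `lam ↦ h lam (z - f lam)`, `z ∈ D`, do not dilate the
hyperbolic metric. -/
structure IsDualPair (D : Set E) (f : ℂ → E) (h : ℂ → E →L[ℂ] ℂ) : Prop where
  holo : DifferentiableOn ℂ f (ball 0 1)
  mapsTo : MapsTo f (ball 0 1) D
  holo_dual : DifferentiableOn ℂ h (ball 0 1)
  apply_deriv : ∀ l ∈ ball (0 : ℂ) 1, h l (deriv f l) = 1
  hypDiv_nonpos : ∀ z ∈ D, ∀ l ∈ ball (0 : ℂ) 1, hypDiv (fun l => h l (z - f l)) l ≤ 0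

theorem hasDerivAt_clm_apply_sub {f : ℂ → E} {h : ℂ → E →L[ℂ] ℂ}
    (hf : DifferentiableOn ℂ f (ball 0 1)) (hh : DifferentiableOn ℂ h (ball 0 1)) (z : E) {l : ℂ}
    (hl : l ∈ ball (0 : ℂ) 1) :
    HasDerivAt (fun l => h l (z - f l)) (deriv h l (z - f l) - h l (deriv f l)) l := by
  have h1 := (hh.differentiableAt (isOpen_ball.mem_nhds hl)).hasDerivAt
  have h2 := (hf.differentiableAt (isOpen_ball.mem_nhds hl)).hasDerivAt
  refine (h1.clm_apply (h2.const_sub z)).congr_deriv ?_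
  simp [sub_eq_add_neg]

namespace IsDualPair

variable {D : Set E} {f : ℂ → E} {h : ℂ → E →L[ℂ] ℂ}

theorem differentiableOn_apply (hp : IsDualPair D f h) (z : E) :
    DifferentiableOn ℂ (fun l => h l (z - f l)) (ball 0 1) := fun _ hl =>
  (hasDerivAt_clm_apply_sub hp.holo hp.holo_dual z hl).differentiableAt.differentiableWithinAt

theorem hypDiv_eq (hp : IsDualPair D f h) (z : E) {l : ℂ} (hl : l ∈ ball (0 : ℂ) 1) :
    hypDiv (fun l => h l (z - f l)) l =
      (deriv h l (z - f l)).re + 2 * (conj l * h l (z - f l)).re / (1 - ‖l‖ ^ 2) - 1 := by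
  rw [hypDiv, (hasDerivAt_clm_apply_sub hp.holo hp.holo_dual z hl).deriv, hp.apply_deriv l hl]
  simp
  ring

/-- Here `hypDiv` + 1 is real-linear in z - f l. Boundedness of D allows one t > 0 such that f l +
(1 + t)(z - f l) lies in D for all l. Nonpositivity at that point bounds `hypDiv` at z by 1/(1 + t)
- 1. -/
theorem exists_hypDiv_le (hp : IsDualPair D f h) (hD : IsOpen D) (hDb : Bornology.IsBounded D)
    {z : E} (hz : z ∈ D) :
    ∃ s > 0, ∀ l ∈ ball (0 : ℂ) 1, hypDiv (fun l => h l (z - f l)) l ≤ -s := by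
  obtain ⟨ε, hε, hball⟩ := Metric.isOpen_iff.1 hD z hz
  obtain ⟨M, hM⟩ := hDb.subset_closedBall z
  have hM0 : 0 ≤ M := by simpa using hM hz
  set t : ℝ := ε / (2 * (M + 1)) with ht
  have ht0 : 0 < t := by positivity
  refine ⟨t / (1 + t), by positivity, fun l hl => ?_⟩
  have hy : z + (t : ℂ) • (z - f l) ∈ D := by
    apply hball
    rw [mem_ball_iff_norm, add_sub_cancel_left, norm_smul]
    have h1 : ‖z - f l‖ ≤ M := by
      rw [← dist_eq_norm, dist_comm]; exact hM (hp.mapsTo hl)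
    calc ‖(t : ℂ)‖ * ‖z - f l‖ ≤ t * M := by
          rw [Complex.norm_real, Real.norm_of_nonneg ht0.le]; gcongr
      _ < ε := by rw [ht, div_mul_eq_mul_div, div_lt_iff₀ (by positivity)]; nlinarith
  have key := hp.hypDiv_nonpos _ hy l hl
  rw [hp.hypDiv_eq _ hl] at key ⊢
  have he : z + (t : ℂ) • (z - f l) - f l = ((1 + t : ℝ) : ℂ) • (z - f l) := by
    push_cast; module
  have e1 : (deriv h l (((1 + t : ℝ) : ℂ) • (z - f l))).re =
      (1 + t) * (deriv h l (z - f l)).re := by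
    rw [map_smul, smul_eq_mul, Complex.re_ofReal_mul]
  have e2 : (conj l * h l (((1 + t : ℝ) : ℂ) • (z - f l))).re =
      (1 + t) * (conj l * h l (z - f l)).re := by
    rw [map_smul, smul_eq_mul, mul_left_comm, Complex.re_ofReal_mul]
  rw [he, e1, e2] at key
  have h1 : (0 : ℝ) < 1 + t := by linarith
  rw [← mul_le_mul_iff_right₀ h1]
  have : (1 + t) * -(t / (1 + t)) = -t := by field_simp
  rw [this]
  calc _ = (1 + t) * (deriv h l (z - f l)).re +
        2 * ((1 + t) * (conj l * h l (z - f l)).re) / (1 - ‖l‖ ^ 2) - 1 - t := by ring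
    _ ≤ _ := by linarith

theorem existsUnique_zero (hp : IsDualPair D f h) (hD : IsOpen D) (hDb : Bornology.IsBounded D)
    {z : E} (hz : z ∈ D) : ∃! l : ℂ, l ∈ ball (0 : ℂ) 1 ∧ h l (z - f l) = 0 := by
  obtain ⟨s, hs, hd⟩ := hp.exists_hypDiv_le hD hDb hz
  obtain ⟨l, hl, h0⟩ := exists_zero_of_hypDiv_le (hp.differentiableOn_apply z) hs hd
  exact ⟨l, ⟨hl, h0⟩, fun m hm =>
    eq_of_hypDiv_neg (hp.differentiableOn_apply z) hs hd hm.1 hl hm.2 h0⟩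

/-- At a zero of the field `hypDiv` reduces to the real part of the derivative, and it is negative.
-/
theorem deriv_ne_zero_of_zero (hp : IsDualPair D f h) (hD : IsOpen D)
    (hDb : Bornology.IsBounded D) {z : E} (hz : z ∈ D) {l : ℂ} (hl : l ∈ ball (0 : ℂ) 1)
    (h0 : h l (z - f l) = 0) : deriv (fun l => h l (z - f l)) l ≠ 0 := by
  obtain ⟨s, hs, hd⟩ := hp.exists_hypDiv_le hD hDb hz
  intro hcon
  have := hd l hl
  rw [hypDiv, hcon, h0] at this
  simp at this
  linarith

theorem differentiableAt_of_zero [CompleteSpace E] (hp : IsDualPair D f h) (hD : IsOpen D)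
    (hDb : Bornology.IsBounded D) {H : E → ℂ} (hHm : MapsTo H D (ball 0 1))
    (hH : ∀ z ∈ D, h (H z) (z - f (H z)) = 0) {z : E} (hz : z ∈ D) :
    DifferentiableAt ℂ H z := by
  let F : E × ℂ → ℂ := fun v => h v.2 (v.1 - f v.2)
  have hl := hHm hz
  have hcd : ContDiffAt ℂ 1 F (z, H z) := by
    have h1 : ContDiffAt ℂ 1 h (H z) :=
      (hp.holo_dual.analyticAt (isOpen_ball.mem_nhds hl)).contDiffAt
    have h2 : ContDiffAt ℂ 1 f (H z) :=
      (hp.holo.analyticAt (isOpen_ball.mem_nhds hl)).contDiffAt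
    exact (h1.comp (z, H z) contDiffAt_snd).clm_apply
      (contDiffAt_fst.sub (h2.comp (z, H z) contDiffAt_snd))
  have hs := hcd.hasStrictFDerivAt one_ne_zero
  have hpart : (fderiv ℂ F (z, H z)) (0, 1) ≠ 0 := by
    have h1 : HasDerivAt (fun l : ℂ => ((z, l) : E × ℂ)) (0, 1) (H z) :=
      (hasDerivAt_const _ _).prodMk (hasDerivAt_id _)
    have h2 := hs.hasFDerivAt.comp_hasDerivAt (H z) h1
    rw [← h2.deriv]
    exact hp.deriv_ne_zero_of_zero hD hDb hz hl (hH z hz)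
  have hinv : (fderiv ℂ F (z, H z) ∘L .inr ℂ E ℂ).IsInvertible := by
    refine ⟨ContinuousLinearEquiv.unitsEquivAut ℂ (Units.mk0 _ hpart), ?_⟩
    ext
    simp
  have hstrict := (hs.hasStrictFDerivAt_implicitFunctionOfProdDomain hinv).hasFDerivAt
  have hev := hs.eventually_apply_implicitFunctionOfProdDomain hinv
  have htend := hs.tendsto_implicitFunctionOfProdDomain hinv
  set g := hs.implicitFunctionOfProdDomain hinv
  refine hstrict.differentiableAt.congr_of_eventuallyEq ?_
  -- The implicit solution agrees with H near z because zeros in the disc are unique; no continuity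
  -- of H is needed beforehand.
  filter_upwards [hev, htend (isOpen_ball.mem_nhds hl), hD.mem_nhds hz] with x hx hxb hxD
  have hx0 : h (g x) (x - f (g x)) = 0 := by
    have : F (z, H z) = 0 := hH z hz
    rw [this] at hx
    exact hx
  exact (hp.existsUnique_zero hD hDb hxD).unique ⟨hHm hxD, hH x hxD⟩ ⟨hxb, hx0⟩

theorem apply_self_eq_zero (hp : IsDualPair D f h) (hD : IsOpen D) (hDb : Bornology.IsBounded D)
    {H : E → ℂ} (hHm : MapsTo H D (ball 0 1)) (hH : ∀ z ∈ D, h (H z) (z - f (H z)) = 0) {l : ℂ}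
    (hl : l ∈ ball (0 : ℂ) 1) : H (f l) = l :=
  (hp.existsUnique_zero hD hDb (hp.mapsTo hl)).unique
    ⟨hHm (hp.mapsTo hl), hH _ (hp.mapsTo hl)⟩ ⟨hl, by simp⟩

/-- In the derivative of h(H x)(x - f(H x)) = 0 at x = f l, the term with the derivative of h drops
out since x = f(H x) there. What remains is h l v - h l (f' l) · H' v, with h l (f' l) = 1. -/
theorem fderiv_eq [CompleteSpace E] (hp : IsDualPair D f h) (hD : IsOpen D)
    (hDb : Bornology.IsBounded D) {H : E → ℂ} (hHm : MapsTo H D (ball 0 1))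
    (hH : ∀ z ∈ D, h (H z) (z - f (H z)) = 0) {l : ℂ} (hl : l ∈ ball (0 : ℂ) 1) :
    fderiv ℂ H (f l) = h l := by
  have hHl := hp.apply_self_eq_zero hD hDb hHm hH hl
  have hd := (hp.differentiableAt_of_zero hD hDb hHm hH (hp.mapsTo hl)).hasFDerivAt
  have h1 : HasDerivAt h (deriv h l) (H (f l)) := by
    rw [hHl]; exact (hp.holo_dual.differentiableAt (isOpen_ball.mem_nhds hl)).hasDerivAt
  have h2 : HasDerivAt f (deriv f l) (H (f l)) := by
    rw [hHl]; exact (hp.holo.differentiableAt (isOpen_ball.mem_nhds hl)).hasDerivAt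
  have h3 := (h1.hasFDerivAt.comp (f l) hd).clm_apply
    ((hasFDerivAt_id (𝕜 := ℂ) (f l)).sub (h2.hasFDerivAt.comp (f l) hd))
  have h4 : HasFDerivAt (fun _ : E => (0 : ℂ)) (0 : E →L[ℂ] ℂ) (f l) := hasFDerivAt_const _ _
  have h5 := h3.unique (h4.congr_of_eventuallyEq (by
    filter_upwards [hD.mem_nhds (hp.mapsTo hl)] with x hx
    exact hH x hx))
  ext v
  have h6 := congrArg (fun L => L v) h5
  simp [hHl, hp.apply_deriv l hl, sub_eq_zero] at h6
  exact h6.symm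

end IsDualPair

end DualPair

/-! ### Schwarz–Pick and its first variation -/

theorem norm_discAut_le_of_mapsTo {g : ℂ → ℂ} (hg : DifferentiableOn ℂ g (ball 0 1))
    (hm : MapsTo g (ball 0 1) (ball 0 1)) {a b : ℂ} (ha : a ∈ ball (0 : ℂ) 1)
    (hb : b ∈ ball (0 : ℂ) 1) :
    ‖discAut (-g a) (g b)‖ ≤ ‖discAut (-a) b‖ := by
  have ha1 : ‖a‖ < 1 := by simpa using ha
  have hb1 : ‖b‖ < 1 := by simpa using hb
  have hna : -a ∈ ball (0 : ℂ) 1 := by simpa using ha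
  have hnga : -g a ∈ ball (0 : ℂ) 1 := by simpa using hm ha
  have hl := discAut_mapsTo hna hb
  have key := Complex.norm_le_norm_of_mapsTo_ball (R := 1)
    (f := fun l => discAut (-g a) (g (discAut a l))) (z := discAut (-a) b)
    ((differentiableOn_discAut hnga).comp (hg.comp (differentiableOn_discAut ha)
      (discAut_mapsTo ha)) (hm.comp (discAut_mapsTo ha)))
    (fun l hl => ball_subset_closedBall (discAut_mapsTo hnga (hm (discAut_mapsTo ha hl))))
    (by simp [discAut_zero, discAut_neg_self]) (by simpa using hl)
  simpa [discAut_discAut_neg ha1 hb1] using key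

/-- The **Schwarz–Pick lemma**. -/
theorem schwarz_pick {g : ℂ → ℂ} (hg : DifferentiableOn ℂ g (ball 0 1))
    (hm : MapsTo g (ball 0 1) (ball 0 1)) {a b : ℂ} (ha : a ∈ ball (0 : ℂ) 1)
    (hb : b ∈ ball (0 : ℂ) 1) :
    ‖g a - g b‖ * ‖1 - conj a * b‖ ≤ ‖a - b‖ * ‖1 - conj (g a) * g b‖ := by
  have ha1 : ‖a‖ < 1 := by simpa using ha
  have hb1 : ‖b‖ < 1 := by simpa using hb
  have hga : ‖g a‖ < 1 := by simpa using hm ha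
  have hgb : ‖g b‖ < 1 := by simpa using hm hb
  have key := norm_discAut_le_of_mapsTo hg hm ha hb
  have h1 := norm_pos_iff.2 (one_sub_conj_mul_ne_zero ha1 hb1)
  have h2 := norm_pos_iff.2 (one_sub_conj_mul_ne_zero hga hgb)
  simp only [discAut, map_neg, neg_mul, ← sub_eq_add_neg, norm_div] at key
  rw [div_le_div_iff₀ h2 h1] at key
  rwa [norm_sub_rev, norm_sub_rev a b]

theorem nonneg_of_hasDerivAt_of_nonneg {F : ℝ → ℝ} {d : ℝ} (h : HasDerivAt F d 0) (h0 : F 0 = 0)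
    (hF : ∀ t ∈ Ioo (0 : ℝ) 1, 0 ≤ F t) : 0 ≤ d := by
  have h1 := (hasDerivAt_iff_tendsto_slope.1 h).mono_left
    (nhdsWithin_mono (0 : ℝ) (fun x (hx : x ∈ Ioi (0 : ℝ)) => ne_of_gt hx))
  refine ge_of_tendsto h1 ?_
  filter_upwards [Ioo_mem_nhdsGT (zero_lt_one (α := ℝ))] with t ht
  rw [slope_def_field, h0]
  have := hF t ht
  have := ht.1
  simp only [sub_zero]
  positivity

section Dual

variable {E : Type*} [NormedAddCommGroup E] [NormedSpace ℂ E]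

theorem differentiableOn_clm_of_apply [FiniteDimensional ℂ E] {h : ℂ → E →L[ℂ] ℂ} {s : Set ℂ}
    (hh : ∀ v, DifferentiableOn ℂ (fun l => h l v) s) : DifferentiableOn ℂ h s := by
  let b := Module.finBasis ℂ E
  have : h = fun l => ∑ i, h l (b i) • (LinearMap.toContinuousLinearMap (b.coord i)) := by
    ext l v
    have := congrArg (h l) (b.sum_repr v)
    rw [← this, map_sum]
    simp [mul_comm]
  rw [this]
  refine DifferentiableOn.fun_sum fun i _ => ?_
  exact (hh (b i)).smul_const _

/-- Schwarz's lemma is used twice: first it bounds the difference quotient by 2/r, then it bounds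
the variation of that quotient. The estimate depends only on r and the bound on u, so it is uniform
in families. -/
theorem norm_slope_sub_deriv_le {u : ℂ → ℂ} {r : ℝ} (hr : 0 < r)
    (hu : DifferentiableOn ℂ u (ball 0 r)) (hb : ∀ w ∈ ball (0 : ℂ) r, ‖u w‖ ≤ 1) {w : ℂ}
    (hw : w ∈ ball (0 : ℂ) r) (hw0 : w ≠ 0) :
    ‖w⁻¹ * (u w - u 0) - deriv u 0‖ ≤ 4 / r ^ 2 * ‖w‖ := by
  have h0 : (0 : ℂ) ∈ ball (0 : ℂ) r := mem_ball_self hr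
  have h1 : ∀ x ∈ ball (0 : ℂ) r, ‖dslope u 0 x‖ ≤ 2 / r := fun x hx =>
    Complex.norm_dslope_le_div_of_mapsTo_ball hu (fun y hy => by
      rw [mem_closedBall_iff_norm]
      exact (norm_sub_le _ _).trans (by linarith [hb y hy, hb 0 h0])) hx
  have hd : DifferentiableOn ℂ (dslope u 0) (ball 0 r) :=
    (Complex.differentiableOn_dslope (isOpen_ball.mem_nhds h0)).2 hu
  have h2 := Complex.dist_le_div_mul_dist_of_mapsTo_ball (R₂ := 4 / r) hd (fun y hy => by
      rw [mem_closedBall_iff_norm]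
      refine (norm_sub_le _ _).trans ?_
      have := h1 y hy
      have := h1 0 h0
      have : 4 / r = 2 / r + 2 / r := by ring
      linarith) hw
  rw [dist_eq_norm, dslope_same, dslope_of_ne _ hw0, slope_def_module, dist_zero_right] at h2
  simp only [sub_zero, smul_eq_mul] at h2
  refine h2.trans_eq ?_
  field_simp

/-- For each direction v, the function G'(f(l)) v is a locally uniform limit of difference quotients
of G at f l, each holomorphic in l. -/
theorem differentiableOn_fderiv_comp [FiniteDimensional ℂ E] {D : Set E} (hD : IsOpen D)
    {f : ℂ → E} {G : E → ℂ} {U : Set ℂ} (hU : IsOpen U)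
    (hf : DifferentiableOn ℂ f U) (hm : MapsTo f U D)
    (hG : DifferentiableOn ℂ G D) (hGm : MapsTo G D (ball 0 1)) :
    DifferentiableOn ℂ (fun l => fderiv ℂ G (f l)) U := by
  refine differentiableOn_clm_of_apply fun v l₀ hl₀ => ?_
  refine DifferentiableAt.differentiableWithinAt ?_
  obtain ⟨ε, hε, hball⟩ := Metric.isOpen_iff.1 hD (f l₀) (hm hl₀)
  set r : ℝ := ε / (2 * (‖v‖ + 1)) with hr
  have hr0 : 0 < r := by positivity
  have hrv : r * ‖v‖ ≤ ε / 2 := by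
    rw [hr, div_mul_eq_mul_div, div_le_div_iff₀ (by positivity) (by positivity)]
    nlinarith [norm_nonneg v]
  have hV : {l | l ∈ U ∧ f l ∈ ball (f l₀) (ε / 2)} ∈ 𝓝 l₀ := by
    filter_upwards [hU.mem_nhds hl₀, (hf.continuousOn.continuousAt (hU.mem_nhds hl₀))
      (ball_mem_nhds (f l₀) (half_pos hε))] with l h1 h2
    exact ⟨h1, h2⟩
  obtain ⟨V, hVs, hVo, hlV⟩ := _root_.mem_nhds_iff.1 hV
  have hin : ∀ l ∈ V, ∀ w ∈ ball (0 : ℂ) r, f l + w • v ∈ D := by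
    intro l hl w hw
    apply hball
    rw [mem_ball_iff_norm]
    have h1 : ‖f l - f l₀‖ < ε / 2 := by rw [← mem_ball_iff_norm]; exact (hVs hl).2
    have h2 : ‖w • v‖ ≤ ε / 2 := by
      rw [norm_smul]
      refine le_trans ?_ hrv
      gcongr
      exact (mem_ball_zero_iff.1 hw).le
    calc ‖f l + w • v - f l₀‖ = ‖(f l - f l₀) + w • v‖ := by congr 1; abel
      _ < ε := by linarith [norm_add_le (f l - f l₀) (w • v)]
  let w : ℕ → ℂ := fun k => (r / 2 : ℝ) * ((1 / ((k : ℝ) + 1) : ℝ) : ℂ)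
  have hwn : ∀ k, ‖w k‖ = r / 2 * (1 / ((k : ℝ) + 1)) := by
    intro k
    simp only [w, norm_mul, Complex.norm_real, Real.norm_eq_abs]
    rw [abs_of_pos (by positivity), abs_of_pos (by positivity)]
  have hw0 : ∀ k, w k ≠ 0 := fun k => by
    rw [← norm_pos_iff, hwn]; positivity
  have hwb : ∀ k, w k ∈ ball (0 : ℂ) r := fun k => by
    rw [mem_ball_zero_iff, hwn]
    have : 1 / ((k : ℝ) + 1) ≤ 1 := by
      rw [div_le_one (by positivity)]; linarith [k.cast_nonneg (α := ℝ)]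
    nlinarith
  have hwt : Tendsto (fun k => ‖w k‖) atTop (𝓝 0) := by
    simp only [hwn]
    simpa using (tendsto_one_div_add_atTop_nhds_zero_nat (𝕜 := ℝ)).const_mul (r / 2)
  let F : ℕ → ℂ → ℂ := fun k l => (w k)⁻¹ * (G (f l + w k • v) - G (f l))
  have hunif : TendstoUniformlyOn F (fun l => fderiv ℂ G (f l) v) atTop V := by
    rw [Metric.tendstoUniformlyOn_iff]
    intro δ hδ
    have h1 : ∀ᶠ k in atTop, 4 / r ^ 2 * ‖w k‖ < δ := by
      have := hwt.const_mul (4 / r ^ 2)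
      rw [mul_zero] at this
      exact this.eventually_lt_const hδ
    filter_upwards [h1] with k hk l hl
    have hd : DifferentiableOn ℂ (fun y : ℂ => G (f l + y • v)) (ball 0 r) :=
      hG.comp (by fun_prop) (fun y hy => hin l hl y hy)
    have hder : HasDerivAt (fun y : ℂ => G (f l + y • v)) (fderiv ℂ G (f l) v) 0 := by
      have h2 : HasDerivAt (fun y : ℂ => f l + y • v) v 0 := by
        simpa using ((hasDerivAt_id (0 : ℂ)).smul_const v).const_add (f l)
      have h3 : HasFDerivAt G (fderiv ℂ G (f l)) (f l + (0 : ℂ) • v) := by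
        rw [zero_smul, add_zero]
        exact (hG.differentiableAt (hD.mem_nhds (hm (hVs hl).1))).hasFDerivAt
      exact h3.comp_hasDerivAt 0 h2
    have := norm_slope_sub_deriv_le hr0 hd (fun y hy => (mem_ball_zero_iff.1
      (hGm (hin l hl y hy))).le) (hwb k) (hw0 k)
    rw [hder.deriv] at this
    rw [dist_comm, dist_eq_norm]
    simp only [zero_smul, add_zero] at this
    exact this.trans_lt hk
  refine (hunif.tendstoLocallyUniformlyOn.differentiableOn (Eventually.of_forall fun k => ?_)
    hVo).differentiableAt (hVo.mem_nhds hlV)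
  have hfV : DifferentiableOn ℂ f V := hf.mono fun l hl => (hVs hl).1
  exact (((hG.comp (hfV.add_const _) fun l hl => hin l hl _ (hwb k)).sub
    (hG.comp hfV fun l hl => hm (hVs hl).1))).const_mul _

/-- The assumption is the infinitesimal form of the squared Schwarz–Pick inequality for the pair a,
b. Putting b = a + x with x ↓ 0 and dividing by x² passes from pairs of points to the metric at a.
-/
theorem hypDiv_nonpos_of_two_point {psi : ℂ → ℂ} {a : ℂ} (ha : a ∈ ball (0 : ℂ) 1)
    (hpsi : DifferentiableAt ℂ psi a)
    (h : ∀ b ∈ ball (0 : ℂ) 1,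
      0 ≤ ‖a - b‖ ^ 2 * (conj (1 - conj a * b) * -(conj (psi a) * b + conj a * psi b)).re -
        (conj (a - b) * (psi a - psi b)).re * ‖1 - conj a * b‖ ^ 2) :
    hypDiv psi a ≤ 0 := by
  have ha1 : ‖a‖ < 1 := by simpa using ha
  have hc : HasDerivAt (fun x : ℝ => a + (x : ℂ)) 1 0 :=
    (Complex.ofRealCLM.hasDerivAt (x := (0 : ℝ))).const_add a
  have hd : HasDerivAt (fun x : ℝ => psi (a + x)) (deriv psi a) 0 := by
    have h1 : HasDerivAt psi (deriv psi a) (a + ((0 : ℝ) : ℂ)) := by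
      simpa using hpsi.hasDerivAt
    exact (h1.scomp (0 : ℝ) hc).congr_deriv (one_smul _ _)
  have hs := (hasDerivAt_iff_tendsto_slope.1 hd).mono_left
    (nhdsWithin_mono (0 : ℝ) (fun x (hx : x ∈ Ioi (0 : ℝ)) => ne_of_gt hx))
  have hct : Tendsto (fun x : ℝ => a + (x : ℂ)) (𝓝[>] 0) (𝓝 a) := by
    have := hc.continuousAt.tendsto.mono_left (nhdsWithin_le_nhds (s := Ioi 0))
    simpa using this
  have hpt : Tendsto (fun x : ℝ => psi (a + x)) (𝓝[>] 0) (𝓝 (psi a)) :=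
    hpsi.continuousAt.tendsto.comp hct
  have h1t : Tendsto (fun x : ℝ => 1 - conj a * (a + x)) (𝓝[>] 0) (𝓝 (1 - conj a * a)) :=
    tendsto_const_nhds.sub (hct.const_mul _)
  have hlim : Tendsto (fun x : ℝ => (conj (1 - conj a * (a + x)) *
      -(conj (psi a) * (a + x) + conj a * psi (a + x))).re -
      (slope (fun x : ℝ => psi (a + x)) 0 x).re * ‖1 - conj a * (a + x)‖ ^ 2) (𝓝[>] 0)
      (𝓝 ((conj (1 - conj a * a) * -(conj (psi a) * a + conj a * psi a)).re -
        (deriv psi a).re * ‖1 - conj a * a‖ ^ 2)) := by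
    refine Tendsto.sub ?_ ?_
    · refine (Complex.continuous_re.tendsto _).comp (Tendsto.mul ?_ ?_)
      · exact (Complex.continuous_conj.tendsto _).comp h1t
      · exact ((hct.const_mul _).add (hpt.const_mul _)).neg
    · exact ((Complex.continuous_re.tendsto _).comp hs).mul (h1t.norm.pow 2)
  have hge := ge_of_tendsto (b := 0) hlim (by
    have hb : ∀ᶠ x : ℝ in 𝓝[>] 0, a + (x : ℂ) ∈ ball (0 : ℂ) 1 :=
      hct (isOpen_ball.mem_nhds ha)
    filter_upwards [hb, self_mem_nhdsWithin] with x hx hx0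
    have hx0 : 0 < x := hx0
    have h1 := h _ hx
    have e1 : a - (a + x) = -(x : ℂ) := by ring
    have e2 : ‖-(x : ℂ)‖ ^ 2 = x ^ 2 := by simp
    have e3 : (conj (-(x : ℂ)) * (psi a - psi (a + x))).re =
        x ^ 2 * (slope (fun x : ℝ => psi (a + x)) 0 x).re := by
      have : conj (-(x : ℂ)) * (psi a - psi (a + x)) =
          ((x ^ 2 : ℝ) : ℂ) * slope (fun x : ℝ => psi (a + x)) 0 x := by
        have hxc : (x : ℂ) ≠ 0 := by exact_mod_cast hx0.ne'
        rw [slope_def_module]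
        simp
        field_simp
        ring
      rw [this, Complex.re_ofReal_mul]
    rw [e1, e2, e3, mul_assoc, ← mul_sub] at h1
    exact nonneg_of_mul_nonneg_right h1 (by positivity))
  have hr : (1 : ℂ) - conj a * a = ((1 - ‖a‖ ^ 2 : ℝ) : ℂ) := by
    rw [mul_comm, Complex.mul_conj, Complex.normSq_eq_norm_sq]; push_cast; rfl
  have hpos : 0 < 1 - ‖a‖ ^ 2 := by nlinarith [norm_nonneg a]
  rw [hr, Complex.conj_ofReal, Complex.re_ofReal_mul, Complex.norm_real,
    Real.norm_of_nonneg hpos.le] at hge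
  have e4 : (-(conj (psi a) * a + conj a * psi a)).re = -(2 * (conj a * psi a).re) := by
    simp; ring
  rw [e4] at hge
  rw [hypDiv, ← mul_le_mul_iff_right₀ (pow_pos hpos 2)]
  have : (1 - ‖a‖ ^ 2) ^ 2 * ((deriv psi a).re + 2 * (conj a * psi a).re / (1 - ‖a‖ ^ 2)) =
    (deriv psi a).re * (1 - ‖a‖ ^ 2) ^ 2 + (1 - ‖a‖ ^ 2) * (2 * (conj a * psi a).re) := by
    field_simp
  rw [this]
  linarith

/-- Schwarz–Pick holds for every self-map g t with t in (0, 1) and is an equality at t = 0, where g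
0 is the identity. Its t-derivative there is the two-point inequality for psi. -/
theorem isDualPair_of_leftInverse [FiniteDimensional ℂ E] {D : Set E} (hD : IsOpen D)
    (hDc : Convex ℝ D) {f : ℂ → E} {G : E → ℂ} (hf : DifferentiableOn ℂ f (ball 0 1))
    (hfm : MapsTo f (ball 0 1) D) (hG : DifferentiableOn ℂ G D) (hGm : MapsTo G D (ball 0 1))
    (hGf : ∀ l ∈ ball (0 : ℂ) 1, G (f l) = l) :
    IsDualPair D f (fun l => fderiv ℂ G (f l)) := by
  have hGd : ∀ l ∈ ball (0 : ℂ) 1, HasFDerivAt G (fderiv ℂ G (f l)) (f l) := fun l hl =>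
    (hG.differentiableAt (hD.mem_nhds (hfm hl))).hasFDerivAt
  have hh := differentiableOn_fderiv_comp hD isOpen_ball hf hfm hG hGm
  refine ⟨hf, hfm, hh, fun l hl => ?_, fun z hz a ha => ?_⟩
  · have h1 := (hGd l hl).comp_hasDerivAt l
      (hf.differentiableAt (isOpen_ball.mem_nhds hl)).hasDerivAt
    have h2 : HasDerivAt (fun x : ℂ => x) 1 l := hasDerivAt_id l
    refine (h1.congr_of_eventuallyEq ?_).unique h2
    filter_upwards [isOpen_ball.mem_nhds hl] with x hx
    exact (hGf x hx).symm
  set psi : ℂ → ℂ := fun l => fderiv ℂ G (f l) (z - f l) with hpsi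
  have hpd : DifferentiableAt ℂ psi a :=
    (hasDerivAt_clm_apply_sub hf hh z ha).differentiableAt
  refine hypDiv_nonpos_of_two_point ha hpd fun b hb => ?_
  have hu : ∀ c ∈ ball (0 : ℂ) 1,
      HasDerivAt (fun t : ℝ => G (f c + (t : ℂ) • (z - f c))) (psi c) 0 := by
    intro c hc
    have h1 : HasDerivAt (fun t : ℂ => f c + t • (z - f c)) (z - f c) (((0 : ℝ) : ℂ)) := by
      simpa using ((hasDerivAt_id (((0 : ℝ) : ℂ))).smul_const (z - f c)).const_add (f c)
    have h2 : HasFDerivAt G (fderiv ℂ G (f c)) (f c + ((0 : ℝ) : ℂ) • (z - f c)) := by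
      simpa using hGd c hc
    have h3 := h2.comp_hasDerivAt _ h1
    exact (h3.scomp (0 : ℝ) (Complex.ofRealCLM.hasDerivAt (x := (0 : ℝ)))).congr_deriv
      (by simp [hpsi])
  let g : ℝ → ℂ → ℂ := fun t c => G (f c + (t : ℂ) • (z - f c))
  have hin : ∀ t ∈ Icc (0 : ℝ) 1, ∀ c ∈ ball (0 : ℂ) 1, f c + (t : ℂ) • (z - f c) ∈ D := by
    intro t ht c hc
    have := hDc.add_smul_sub_mem (hfm hc) hz ht
    simpa using this
  have hg0 : ∀ c ∈ ball (0 : ℂ) 1, g 0 c = c := fun c hc => by simp [g, hGf c hc]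
  let F : ℝ → ℝ := fun t => ‖a - b‖ ^ 2 * ‖1 - conj (g t a) * g t b‖ ^ 2 -
    ‖g t a - g t b‖ ^ 2 * ‖1 - conj a * b‖ ^ 2
  have da : HasDerivAt (fun t => g t a) (psi a) 0 := hu a ha
  have db : HasDerivAt (fun t => g t b) (psi b) 0 := hu b hb
  have hF := nonneg_of_hasDerivAt_of_nonneg (F := F)
    (((((da.star.mul db).const_sub 1).norm_sq).const_mul (‖a - b‖ ^ 2)).sub
      ((da.sub db).norm_sq.mul_const (‖1 - conj a * b‖ ^ 2)))
    (by simp only [F, hg0 a ha, hg0 b hb]; ring) (fun t ht => by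
      have ht' : t ∈ Icc (0 : ℝ) 1 := ⟨ht.1.le, ht.2.le⟩
      have hgd : DifferentiableOn ℂ (g t) (ball 0 1) :=
        hG.comp (hf.add ((hf.const_sub z).const_smul (t : ℂ))) (hin t ht')
      have := schwarz_pick hgd (fun c hc => hGm (hin t ht' c hc)) ha hb
      have h2 := pow_le_pow_left₀ (by positivity) this 2
      rw [mul_pow, mul_pow] at h2
      exact sub_nonneg.2 h2)
  simp only [hg0 a ha, hg0 b hb, Complex.inner, Pi.sub_apply, Pi.mul_apply,
    RCLike.star_def] at hF
  have e : (2 : ℝ) * (‖a - b‖ ^ 2 * (conj (1 - conj a * b) *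
      -(conj (psi a) * b + conj a * psi b)).re -
      (conj (a - b) * (psi a - psi b)).re * ‖1 - conj a * b‖ ^ 2) =
      ‖a - b‖ ^ 2 * (2 * (conj (1 - conj a * b) *
      -(conj (psi a) * b + conj a * psi b)).re) -
      2 * (conj (a - b) * (psi a - psi b)).re * ‖1 - conj a * b‖ ^ 2 := by ring
  rw [← mul_nonneg_iff_of_pos_left (zero_lt_two (α := ℝ)), e]
  simp at hF ⊢
  linarith

end Dual

/-! ### The Poincaré distance and discs near a segment -/

theorem poincareDist_eq (s t : ℂ) : poincareDist s t = Real.artanh ‖discAut (-s) t‖ := by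
  simp [poincareDist, discAut, sub_eq_add_neg]

theorem poincareDist_nonneg (s t : ℂ) : 0 ≤ poincareDist s t :=
  Real.artanh_nonneg (norm_nonneg _)

/-- Among points of fixed moduli the hyperbolic distance is least on a common radius: the identity
for 1 - |discAut|² combines with |1 - conj x · y| ≥ 1 - |x||y|. -/
theorem norm_sub_norm_le_norm_discAut {x y : ℂ} (hx : ‖x‖ < 1) (hy : ‖y‖ < 1) :
    ‖y‖ - ‖x‖ ≤ ‖discAut (-x) y‖ * (1 - ‖x‖ * ‖y‖) := by
  have h1 := one_sub_normSq_discAut (a := -x) (l := y) (by simpa using hx) hy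
  simp only [Complex.normSq_eq_norm_sq, map_neg, neg_mul, norm_neg, ← sub_eq_add_neg] at h1
  have hX := norm_nonneg x
  have hY := norm_nonneg y
  have hXY : 0 < 1 - ‖x‖ * ‖y‖ := by nlinarith
  have h2 : 1 - ‖x‖ * ‖y‖ ≤ ‖1 - conj x * y‖ := by
    have := norm_sub_norm_le (1 : ℂ) (conj x * y)
    simpa using this
  set R := ‖discAut (-x) y‖
  have hR : R < 1 := norm_discAut_lt_one (by simpa using hx) hy
  have hR0 : 0 ≤ R := norm_nonneg _
  have h3 : (1 - R ^ 2) * (1 - ‖x‖ * ‖y‖) ^ 2 ≤ (1 - ‖x‖ ^ 2) * (1 - ‖y‖ ^ 2) := by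
    rw [← h1]
    have : 0 ≤ 1 - R ^ 2 := by nlinarith
    gcongr
  refine le_of_sq_le_sq ?_ (by positivity)
  nlinarith

theorem artanh_norm_le_add {x y : ℂ} (hx : ‖x‖ < 1) (hy : ‖y‖ < 1) :
    Real.artanh ‖y‖ ≤ Real.artanh ‖x‖ + Real.artanh ‖discAut (-x) y‖ := by
  have h := norm_sub_norm_le_norm_discAut hx hy
  set R := ‖discAut (-x) y‖
  have hR : R < 1 := norm_discAut_lt_one (by simpa using hx) hy
  have hR0 : 0 ≤ R := norm_nonneg _
  have hX := norm_nonneg x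
  have hY := norm_nonneg y
  rw [Real.artanh_eq_half_log ⟨by linarith, hy.le⟩, Real.artanh_eq_half_log ⟨by linarith, hx.le⟩,
    Real.artanh_eq_half_log ⟨by linarith, hR.le⟩, ← mul_add, ← Real.log_mul]
  · refine mul_le_mul_of_nonneg_left (Real.log_le_log ?_ ?_) (by norm_num)
    · exact div_pos (by linarith) (by linarith)
    · rw [div_mul_div_comm, div_le_div_iff₀ (by linarith)
        (mul_pos (by linarith) (by linarith))]
      nlinarith
  · exact (div_pos (by linarith) (by linarith)).ne'
  · exact (div_pos (by linarith) (by linarith)).ne'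

theorem strictMono_tanh : StrictMono Real.tanh := by
  intro x y hxy
  by_contra! h
  have := Real.artanh_le_artanh (Real.neg_one_lt_tanh y) (Real.tanh_lt_one x) h
  rw [Real.artanh_tanh, Real.artanh_tanh] at this
  linarith

/-- Inside every neighbourhood of `[0, 1]` there is a holomorphic image of the disc through two
given points of `(0, 1)`, which may be taken symmetric about `1 / 2`. -/
theorem exists_disc_near_segment {η a : ℝ} (hη : 0 < η) (ha0 : 0 < a) (ha : a < 1 / 2) :
    ∃ (g : ℂ → ℂ) (t : ℂ), DifferentiableOn ℂ g (ball 0 1) ∧ t ∈ ball (0 : ℂ) 1 ∧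
      g t = 1 / 2 + a ∧ g (-t) = 1 / 2 - a ∧
      ∀ l ∈ ball (0 : ℂ) 1, (g l).re ∈ Icc (0 : ℝ) 1 ∧ |(g l).im| ≤ η := by
  have hpi := Real.pi_pos
  -- The map log((1 + l)/(1 - l)) sends the disc to the strip |Im| < π/2. The factor c makes the
  -- height η, and restricting to radius r = tanh(1/(4c)) makes the real part at most 1/2 in
  -- modulus.
  set c : ℝ := 2 * η / Real.pi with hc
  have hc0 : 0 < c := by positivity
  set r : ℝ := Real.tanh (1 / (4 * c)) with hr
  have hr1 : r < 1 := Real.tanh_lt_one _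
  have htm : StrictMono Real.tanh := strictMono_tanh
  have hr0 : 0 < r := by
    rw [hr, ← Real.tanh_zero]; exact htm (by positivity)
  set q : ℝ := Real.tanh (a / (2 * c)) with hq
  have hqr : q < r := by
    refine htm ?_
    rw [div_lt_div_iff₀ (by positivity) (by positivity)]
    nlinarith
  have hq0 : 0 < q := by
    rw [hq, ← Real.tanh_zero]; exact htm (by positivity)
  have hfrac : ∀ x : ℝ, Real.log ((1 + Real.tanh x) / (1 - Real.tanh x)) = 2 * x := by
    intro x
    have := Real.artanh_eq_half_log (x := Real.tanh x)
      ⟨(Real.neg_one_lt_tanh x).le, (Real.tanh_lt_one x).le⟩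
    rw [Real.artanh_tanh] at this
    linarith
  let u : ℂ → ℂ := fun l => Complex.log ((1 + l) / (1 - l))
  have hpos : ∀ l : ℂ, ‖l‖ < 1 → 0 < ((1 + l) / (1 - l)).re := by
    intro l hl
    have h1 : Complex.normSq l < 1 := norm_lt_one_iff_normSq.1 hl
    have h2 : (1 - l) ≠ 0 := by
      intro h
      rw [sub_eq_zero] at h
      rw [← h] at hl
      simp at hl
    have h3 : ((1 + l) / (1 - l)).re = (1 - Complex.normSq l) / Complex.normSq (1 - l) := by
      rw [Complex.div_re]
      simp [Complex.normSq_apply]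
      ring
    rw [h3]
    exact div_pos (by linarith) (Complex.normSq_pos.2 h2)
  have hrl : ∀ l ∈ ball (0 : ℂ) 1, ‖(r : ℂ) * l‖ ≤ r := by
    intro l hl
    rw [norm_mul, Complex.norm_real, Real.norm_of_nonneg hr0.le]
    have : ‖l‖ < 1 := by simpa using hl
    nlinarith
  have hureal : ∀ x : ℝ, |x| < 1 → u x = (Real.log ((1 + x) / (1 - x)) : ℝ) := by
    intro x hx
    rw [abs_lt] at hx
    have : 0 ≤ (1 + x) / (1 - x) := div_nonneg (by linarith) (by linarith)
    rw [Complex.ofReal_log this]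
    simp [u]
  refine ⟨fun l => 1 / 2 + c * u (r * l), ((q / r : ℝ) : ℂ), ?_, ?_, ?_, ?_, ?_⟩
  · intro l hl
    have h1 : ‖(r : ℂ) * l‖ < 1 := (hrl l hl).trans_lt hr1
    have h2 : (1 - (r : ℂ) * l) ≠ 0 := by
      intro h
      have := hpos _ h1
      rw [h] at this
      simp at this
    have h3 : DifferentiableAt ℂ (fun l : ℂ => (1 + (r : ℂ) * l) / (1 - r * l)) l :=
      DifferentiableAt.fun_div (by fun_prop) (by fun_prop) h2
    have h4 : DifferentiableAt ℂ (fun l : ℂ => u (r * l)) l :=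
      h3.clog (Or.inl (hpos _ h1))
    exact ((h4.const_mul (c : ℂ)).const_add _).differentiableWithinAt
  · rw [mem_ball_zero_iff, Complex.norm_real, Real.norm_of_nonneg (by positivity),
      div_lt_one hr0]
    exact hqr
  · have : (r : ℂ) * ((q / r : ℝ) : ℂ) = (q : ℝ) := by
      rw [← Complex.ofReal_mul, mul_div_cancel₀ _ hr0.ne']
    beta_reduce
    rw [this, hureal q (by rw [abs_lt]; constructor <;> linarith), hq, hfrac]
    have : c * (2 * (a / (2 * c))) = a := by field_simp
    rw [← Complex.ofReal_mul, this]
  · have : (r : ℂ) * -((q / r : ℝ) : ℂ) = ((Real.tanh (-(a / (2 * c))) : ℝ) : ℂ) := by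
      rw [Real.tanh_neg, ← hq, mul_neg, ← Complex.ofReal_mul, mul_div_cancel₀ _ hr0.ne']
      simp
    beta_reduce
    rw [this, hureal _ (by rw [Real.tanh_neg, ← hq, abs_lt]; constructor <;> linarith), hfrac]
    have : c * (2 * (-(a / (2 * c)))) = -a := by field_simp
    rw [← Complex.ofReal_mul, this]
    push_cast
    ring
  · intro l hl
    have h1 := hrl l hl
    have h1' : ‖(r : ℂ) * l‖ < 1 := h1.trans_lt hr1
    set v := (r : ℂ) * l
    have hp := hpos v h1'
    have hn1 : ‖1 + v‖ ≤ 1 + r := (norm_add_le _ _).trans (by simpa using h1)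
    have hn2 : ‖1 - v‖ ≤ 1 + r := (norm_sub_le _ _).trans (by simpa using h1)
    have hn3 : 1 - r ≤ ‖1 + v‖ := by
      have := norm_sub_norm_le (1 : ℂ) (-v)
      simp at this
      linarith
    have hn4 : 1 - r ≤ ‖1 - v‖ := by
      have := norm_sub_norm_le (1 : ℂ) v
      simp at this
      linarith
    have hlogr : Real.log ((1 + r) / (1 - r)) = 1 / (2 * c) := by
      rw [hr, hfrac]; field_simp; norm_num
    have hre : |(u v).re| ≤ 1 / (2 * c) := by
      simp only [u, Complex.log_re, norm_div]
      rw [abs_le]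
      constructor
      · rw [← hlogr, ← Real.log_inv, inv_div]
        refine Real.log_le_log (div_pos (by linarith) (by linarith)) ?_
        exact div_le_div₀ (norm_nonneg _) hn3 (by linarith) hn2
      · rw [← hlogr]
        refine Real.log_le_log (div_pos (by linarith) (by linarith)) ?_
        exact div_le_div₀ (by linarith) hn1 (by linarith) hn4
    have him : |(u v).im| ≤ Real.pi / 2 := by
      simp only [u, Complex.log_im]
      exact Complex.abs_arg_le_pi_div_two_iff.2 hp.le
    have e1 : (1 / 2 + (c : ℂ) * u v).re = 1 / 2 + c * (u v).re := by
      simp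
    have e2 : (1 / 2 + (c : ℂ) * u v).im = c * (u v).im := by
      simp
    have h5 : c * (1 / (2 * c)) = 1 / 2 := by field_simp
    have h6 : c * (Real.pi / 2) = η := by rw [hc]; field_simp
    rw [e1, e2, abs_mul, abs_of_pos hc0]
    rw [abs_le] at hre
    refine ⟨⟨?_, ?_⟩, ?_⟩
    · have := mul_le_mul_of_nonneg_left hre.1 hc0.le
      linarith
    · have := mul_le_mul_of_nonneg_left hre.2 hc0.le
      linarith
    · rw [← h6]
      gcongr

/-! ### Discs through two points of a convex domain -/

section Disc

variable {E : Type*} [NormedAddCommGroup E] [NormedSpace ℂ E]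

/-- A thin disc around the segment from w to z, prolonged by the proportion η at both ends, stays in
D. The affine map (1 + 2η)g - η turns the symmetric parameters into exactly 0 and 1. -/
theorem exists_disc_through {D : Set E} (hD : IsOpen D) (hDc : Convex ℝ D) {w z : E} (hw : w ∈ D)
    (hz : z ∈ D) : ∃ (φ : ℂ → E) (s t : ℂ), DifferentiableOn ℂ φ (ball 0 1) ∧
      MapsTo φ (ball 0 1) D ∧ s ∈ ball (0 : ℂ) 1 ∧ t ∈ ball (0 : ℂ) 1 ∧ φ s = w ∧ φ t = z := by
  obtain ⟨ε₁, hε₁, h1⟩ := Metric.isOpen_iff.1 hD w hw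
  obtain ⟨ε₂, hε₂, h2⟩ := Metric.isOpen_iff.1 hD z hz
  set ε := min ε₁ ε₂ with hε
  have hε0 : 0 < ε := lt_min hε₁ hε₂
  set v := z - w with hv
  set η : ℝ := ε / (4 * (‖v‖ + 1)) with hη
  have hη0 : 0 < η := by positivity
  have hηv : (η + 2 * η) * ‖v‖ < ε := by
    rw [hη]
    have h4 : ε / (4 * (‖v‖ + 1)) * (4 * (‖v‖ + 1)) = ε := by field_simp
    have : 0 ≤ ε / (4 * (‖v‖ + 1)) := hη0.le
    nlinarith [norm_nonneg v]
  obtain ⟨g, t, hg, ht, hgt, hgs, hgm⟩ := exists_disc_near_segment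
    (η := η / (1 + 2 * η))
    (a := 1 / (2 * (1 + 2 * η))) (by positivity) (by positivity) (by
      rw [div_lt_div_iff₀ (by positivity) (by positivity)]; nlinarith)
  have hnear : ∀ k : ℂ, ‖k‖ ≤ η + 2 * η → w + k • v ∈ D ∧ z + k • v ∈ D := by
    intro k hk
    have : ‖k • v‖ < ε := by
      rw [norm_smul]
      refine lt_of_le_of_lt ?_ hηv
      gcongr
    refine ⟨h1 ?_, h2 ?_⟩
    · rw [mem_ball_iff_norm, add_sub_cancel_left]; exact this.trans_le (min_le_left _ _)
    · rw [mem_ball_iff_norm, add_sub_cancel_left]; exact this.trans_le (min_le_right _ _)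
  have hη1 : (1 + 2 * (η : ℂ)) ≠ 0 := by
    have : (1 + 2 * η : ℝ) ≠ 0 := by positivity
    exact_mod_cast this
  refine ⟨fun l => w + ((1 + 2 * η) * g l - η) • v, -t, t, ?_, ?_, by simpa using ht, ht, ?_, ?_⟩
  · exact (((hg.const_mul _).sub_const _).smul_const v).const_add w
  · intro l hl
    obtain ⟨hre, him⟩ := hgm l hl
    -- The point is a convex combination, with weights 1 - Re g and Re g, of a point near w and a
    -- point near z; both carry the same small imaginary displacement.
    have key := hDc (hnear (-η + (1 + 2 * η) * ((g l).im * Complex.I)) ?_).1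
      (hnear (η + (1 + 2 * η) * ((g l).im * Complex.I)) ?_).2 (sub_nonneg.2 hre.2) hre.1
      (by ring)
    · convert! key using 1
      rw [← Complex.coe_smul, ← Complex.coe_smul]
      have hgl := Complex.re_add_im (g l)
      generalize (g l).re = x at hgl ⊢
      generalize (g l).im = y at hgl ⊢
      beta_reduce
      rw [← hgl, hv]
      push_cast
      module
    all_goals
      have h5 : ‖(1 + 2 * (η : ℂ)) * ((g l).im * Complex.I)‖ ≤ η := by
        have : ‖(1 + 2 * (η : ℂ))‖ = 1 + 2 * η := by
          have h6 : (1 + 2 * (η : ℂ)) = ((1 + 2 * η : ℝ) : ℂ) := by push_cast; rfl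
          rw [h6, Complex.norm_real, Real.norm_of_nonneg (by positivity)]
        rw [norm_mul, norm_mul, this, Complex.norm_I, mul_one, Complex.norm_real, Real.norm_eq_abs]
        rw [le_div_iff₀ (by positivity)] at him
        linarith
      refine (norm_add_le _ _).trans ?_
      have h7 : ‖(η : ℂ)‖ = η := by rw [Complex.norm_real, Real.norm_of_nonneg hη0.le]
      simp only [norm_neg, h7]
      linarith
  · simp only
    rw [hgs]
    have : (1 + 2 * (η : ℂ)) * (1 / 2 - ((1 / (2 * (1 + 2 * η)) : ℝ) : ℂ)) - η = 0 := by
      push_cast; field_simp; ring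
    rw [this]; simp
  · simp only
    rw [hgt]
    have : (1 + 2 * (η : ℂ)) * (1 / 2 + ((1 / (2 * (1 + 2 * η)) : ℝ) : ℂ)) - η = 1 := by
      push_cast; field_simp; ring
    rw [this]; simp [hv]

end Disc

/-! ### Holomorphic functions contract the Kobayashi distance -/

section Kobayashi

variable {n : ℕ} {D : Set (EuclideanSpace ℂ (Fin n))}

theorem lempertFunction_nonneg (w z : EuclideanSpace ℂ (Fin n)) : 0 ≤ lempertFunction D w z := by
  refine Real.sInf_nonneg ?_
  rintro r ⟨φ, s, t, -, -, -, -, -, -, rfl⟩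
  exact poincareDist_nonneg s t

theorem lempertFunction_le {φ : ℂ → EuclideanSpace ℂ (Fin n)} {s t : ℂ}
    (hφ : DifferentiableOn ℂ φ (ball 0 1)) (hm : MapsTo φ (ball 0 1) D) (hs : s ∈ ball (0 : ℂ) 1)
    (ht : t ∈ ball (0 : ℂ) 1) : lempertFunction D (φ s) (φ t) ≤ poincareDist s t := by
  refine csInf_le ⟨0, ?_⟩ ⟨φ, s, t, hφ, hm, hs, ht, rfl, rfl, rfl⟩
  rintro r ⟨φ, s, t, -, -, -, -, -, -, rfl⟩
  exact poincareDist_nonneg s t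

theorem kobayashiDist_le_lempertFunction {w z : EuclideanSpace ℂ (Fin n)} (hw : w ∈ D)
    (hz : z ∈ D) : kobayashiDist D w z ≤ lempertFunction D w z := by
  refine csInf_le ⟨0, ?_⟩ ⟨1, fun j => if j = 0 then w else z, by simp, by simp, ?_, by simp⟩
  · rintro r ⟨N, c, -, -, -, rfl⟩
    exact Finset.sum_nonneg fun j _ => lempertFunction_nonneg _ _
  · intro j _
    dsimp only
    split_ifs
    exacts [hw, hz]

theorem kobayashiDist_le_artanh {φ : ℂ → EuclideanSpace ℂ (Fin n)} {t : ℂ}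
    (hφ : DifferentiableOn ℂ φ (ball 0 1)) (hm : MapsTo φ (ball 0 1) D)
    (ht : t ∈ ball (0 : ℂ) 1) : kobayashiDist D (φ 0) (φ t) ≤ Real.artanh ‖t‖ := by
  have h0 : (0 : ℂ) ∈ ball (0 : ℂ) 1 := by simp
  refine (kobayashiDist_le_lempertFunction (hm h0) (hm ht)).trans
    ((lempertFunction_le hφ hm h0 ht).trans_eq ?_)
  simp [poincareDist]

theorem artanh_norm_le_add_lempertFunction (hD : IsOpen D) (hDc : Convex ℝ D)
    {H : EuclideanSpace ℂ (Fin n) → ℂ} (hH : DifferentiableOn ℂ H D) (hHm : MapsTo H D (ball 0 1))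
    {w z : EuclideanSpace ℂ (Fin n)} (hw : w ∈ D) (hz : z ∈ D) :
    Real.artanh ‖H z‖ ≤ Real.artanh ‖H w‖ + lempertFunction D w z := by
  rw [← sub_le_iff_le_add']
  -- A connecting disc is needed because the infimum of the empty set would be 0.
  obtain ⟨φ₀, s₀, t₀, h1, h2, h3, h4, h5, h6⟩ := exists_disc_through hD hDc hw hz
  refine le_csInf ⟨_, φ₀, s₀, t₀, h1, h2, h3, h4, h5, h6, rfl⟩ ?_
  rintro r ⟨φ, s, t, hφ, hm, hs, ht, rfl, rfl, rfl⟩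
  have hns : -s ∈ ball (0 : ℂ) 1 := by simpa using hs
  have key := norm_discAut_le_of_mapsTo (hH.comp hφ hm) (hHm.comp hm) hs ht
  have h7 := artanh_norm_le_add (x := H (φ s)) (y := H (φ t)) (by simpa using hHm (hm hs))
    (by simpa using hHm (hm ht))
  have h8 := Real.artanh_le_artanh (by linarith [norm_nonneg (discAut (-(H ∘ φ) s) ((H ∘ φ) t))])
    (by simpa using discAut_mapsTo hns ht) key
  rw [poincareDist_eq]
  simp only [Function.comp] at h8
  linarith

/-- Along a chain from p, each link raises artanh |H| by at most its Lempert length, and the chain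
starts at the value 0. -/
theorem artanh_norm_le_kobayashiDist (hD : IsOpen D) (hDc : Convex ℝ D)
    {H : EuclideanSpace ℂ (Fin n) → ℂ} (hH : DifferentiableOn ℂ H D) (hHm : MapsTo H D (ball 0 1))
    {p z : EuclideanSpace ℂ (Fin n)} (hp : p ∈ D) (hz : z ∈ D) (hHp : H p = 0) :
    Real.artanh ‖H z‖ ≤ kobayashiDist D p z := by
  refine le_csInf ⟨_, 1, fun j => if j = 0 then p else z, by simp, by simp, ?_, rfl⟩ ?_
  · intro j _
    dsimp only
    split_ifs
    exacts [hp, hz]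
  rintro r ⟨N, c, h0, hN, hc, rfl⟩
  rw [← hN]
  have key : ∀ m ≤ N, Real.artanh ‖H (c m)‖ ≤
      ∑ j ∈ Finset.range m, lempertFunction D (c j) (c (j + 1)) := by
    intro m
    induction m with
    | zero => intro _; simp [h0, hHp]
    | succ m ih =>
      intro hm
      rw [Finset.sum_range_succ]
      have := artanh_norm_le_add_lempertFunction hD hDc hH hHm (hc m (by omega)) (hc (m + 1) hm)
      linarith [ih (by omega)]
  exact key N le_rfl

theorem mem_kobayashiBall_of_disc {φ : ℂ → EuclideanSpace ℂ (Fin n)} {t : ℂ} {R : ℝ}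
    (hφ : DifferentiableOn ℂ φ (ball 0 1)) (hm : MapsTo φ (ball 0 1) D)
    (ht : t ∈ ball (0 : ℂ) 1) (htR : ‖t‖ < R) : φ t ∈ kobayashiBall D (φ 0) R := by
  refine ⟨hm ht, ?_⟩
  have h1 := strictMono_tanh.monotone (kobayashiDist_le_artanh hφ hm ht)
  rw [Real.tanh_artanh ⟨by linarith [norm_nonneg t], by simpa using ht⟩] at h1
  linarith

theorem norm_lt_of_mem_kobayashiBall (hD : IsOpen D) (hDc : Convex ℝ D)
    {H : EuclideanSpace ℂ (Fin n) → ℂ} (hH : DifferentiableOn ℂ H D) (hHm : MapsTo H D (ball 0 1))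
    {p z : EuclideanSpace ℂ (Fin n)} {R : ℝ} (hp : p ∈ D) (hHp : H p = 0)
    (hz : z ∈ kobayashiBall D p R) : ‖H z‖ < R := by
  have h1 := strictMono_tanh.monotone (artanh_norm_le_kobayashiDist hD hDc hH hHm hp hz.1 hHp)
  rw [Real.tanh_artanh ⟨by linarith [norm_nonneg (H z)], by simpa using hHm hz.1⟩] at h1
  exact h1.trans_lt hz.2

end Kobayashi

/-! ### Normal families -/

section Montel

variable {E : Type*} [NormedAddCommGroup E] [NormedSpace ℂ E]

/-- These are Cauchy's estimates on circles of radius r, with r → 1. -/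
theorem norm_taylorCoeff_le [CompleteSpace E] {φ : ℂ → E} {M : ℝ}
    (hφ : DifferentiableOn ℂ φ (ball 0 1)) (hM : ∀ l ∈ ball (0 : ℂ) 1, ‖φ l‖ ≤ M) (m : ℕ) :
    ‖((m.factorial : ℂ)⁻¹) • iteratedDeriv m φ 0‖ ≤ M := by
  have h1 : ∀ r ∈ Ioo (0 : ℝ) 1,
      r ^ m * ‖((m.factorial : ℂ)⁻¹) • iteratedDeriv m φ 0‖ ≤ M := by
    intro r hr
    have h2 := Complex.norm_iteratedDeriv_le_of_forall_mem_sphere_norm_le (c := (0 : ℂ)) (R := r)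
      (C := M) (f := φ) m hr.1 (DifferentiableOn.diffContOnCl (by
        rw [closure_ball _ hr.1.ne']
        exact hφ.mono (closedBall_subset_ball hr.2)))
      (fun z hz => hM z (by
        rw [mem_sphere_zero_iff_norm] at hz
        rw [mem_ball_zero_iff, hz]
        exact hr.2))
    rw [norm_smul, norm_inv, Complex.norm_natCast]
    have hf : (0 : ℝ) < m.factorial := by exact_mod_cast m.factorial_pos
    have hrm : 0 < r ^ m := pow_pos hr.1 m
    rw [le_div_iff₀ hrm] at h2
    rw [mul_left_comm, inv_mul_le_iff₀ hf]
    linarith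
  have ht : Tendsto (fun r : ℝ => r ^ m * ‖((m.factorial : ℂ)⁻¹) • iteratedDeriv m φ 0‖)
      (𝓝[<] 1) (𝓝 (1 ^ m * ‖((m.factorial : ℂ)⁻¹) • iteratedDeriv m φ 0‖)) :=
    (Continuous.tendsto (by fun_prop) _).mono_left nhdsWithin_le_nhds
  rw [one_pow, one_mul] at ht
  refine le_of_tendsto ht ?_
  filter_upwards [Ioo_mem_nhdsLT (zero_lt_one (α := ℝ))] with r hr
  exact h1 r hr

/-- **Montel's theorem** for uniformly bounded discs in a finite-dimensional space. -/
theorem exists_subseq_tendstoLocallyUniformlyOn [FiniteDimensional ℂ E] {φ : ℕ → ℂ → E} {M : ℝ}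
    (hφ : ∀ k, DifferentiableOn ℂ (φ k) (ball 0 1))
    (hM : ∀ k, ∀ l ∈ ball (0 : ℂ) 1, ‖φ k l‖ ≤ M) :
    ∃ (Φ : ℂ → E) (σ : ℕ → ℕ), StrictMono σ ∧ DifferentiableOn ℂ Φ (ball 0 1) ∧
      TendstoLocallyUniformlyOn (fun k => φ (σ k)) Φ atTop (ball 0 1) := by
  have : CompleteSpace E := FiniteDimensional.complete ℂ E
  have : ProperSpace E := FiniteDimensional.proper ℂ E
  let c : ℕ → ℕ → E := fun k m => ((m.factorial : ℂ)⁻¹) • iteratedDeriv m (φ k) 0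
  have hc : ∀ k, c k ∈ Set.pi univ (fun _ : ℕ => closedBall (0 : E) M) := fun k m _ => by
    rw [mem_closedBall_zero_iff]
    exact norm_taylorCoeff_le (hφ k) (hM k) m
  -- Compactness of the product of balls gives simultaneous convergence of all Taylor coefficients;
  -- no diagonal argument or equicontinuity is required.
  obtain ⟨a, ha, σ, hσ, hlim⟩ := (isCompact_univ_pi
    (fun _ : ℕ => isCompact_closedBall (0 : E) M)).tendsto_subseq hc
  have hM0 : 0 ≤ M := (norm_nonneg _).trans (hM 0 0 (by simp))
  rw [tendsto_pi_nhds] at hlim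
  have hcb : ∀ k m, ‖c k m‖ ≤ M := fun k m => mem_closedBall_zero_iff.1 (hc k m trivial)
  have hab : ∀ m, ‖a m‖ ≤ M := fun m => mem_closedBall_zero_iff.1 (ha m trivial)
  let Φ : ℂ → E := fun l => ∑' m, l ^ m • a m
  have hφs : ∀ k, ∀ l ∈ ball (0 : ℂ) 1, φ k l = ∑' m, l ^ m • c k m := by
    intro k l hl
    have := (Complex.hasSum_taylorSeries_on_ball (hφ k) hl).tsum_eq
    rw [← this]
    simp only [sub_zero, c, smul_smul, mul_comm]
  -- Dominated convergence with r^m M, taken jointly in the index and the point. It is used once for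
  -- the constant coefficients a and once for the subsequence; comparing the two limits gives local
  -- uniform convergence.
  have key : ∀ x ∈ ball (0 : ℂ) 1, ∀ (b : ℕ × ℂ → ℕ → E), (∀ y m, ‖b y m‖ ≤ M) →
      (∀ m, Tendsto (fun y => b y m) (atTop ×ˢ 𝓝 x) (𝓝 (a m))) →
      Tendsto (fun y : ℕ × ℂ => ∑' m, y.2 ^ m • b y m) (atTop ×ˢ 𝓝 x) (𝓝 (Φ x)) := by
    intro x hx b hb hbt
    obtain ⟨r, hxr, hr1⟩ := exists_between (mem_ball_zero_iff.1 hx)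
    have hr0 : 0 ≤ r := (norm_nonneg _).trans hxr.le
    refine tendsto_tsum_of_dominated_convergence (bound := fun m => r ^ m * M)
      ((summable_geometric_of_lt_one hr0 hr1).mul_right M) (fun m => ?_) ?_
    · exact (((continuous_pow m).tendsto x).comp tendsto_snd).smul (hbt m)
    · have : ∀ᶠ y : ℕ × ℂ in atTop ×ˢ 𝓝 x, ‖y.2‖ < r :=
        tendsto_snd.eventually ((continuous_norm.tendsto x).eventually (gt_mem_nhds hxr))
      filter_upwards [this] with y hy m
      rw [norm_smul, norm_pow]
      gcongr
      exact hb y m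
  have hlu : TendstoLocallyUniformlyOn (fun k => φ (σ k)) Φ atTop (ball 0 1) := by
    rw [isOpen_ball.tendstoLocallyUniformlyOn_iff_forall_tendsto]
    intro x hx
    have h1 := key x hx (fun _ => a) (fun _ => hab) (fun m => tendsto_const_nhds)
    have h2 := key x hx (fun y => c (σ y.1)) (fun y m => hcb _ m)
      (fun m => (hlim m).comp tendsto_fst)
    have h3 : Tendsto (fun y : ℕ × ℂ => φ (σ y.1) y.2) (atTop ×ˢ 𝓝 x) (𝓝 (Φ x)) := by
      refine h2.congr' ?_
      have : ∀ᶠ y : ℕ × ℂ in atTop ×ˢ 𝓝 x, y.2 ∈ ball (0 : ℂ) 1 :=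
        tendsto_snd.eventually (isOpen_ball.mem_nhds hx)
      filter_upwards [this] with y hy
      exact (hφs _ _ hy).symm
    rw [tendsto_uniformity_iff_dist_tendsto_zero]
    have := h1.dist h3
    rwa [dist_self] at this
  exact ⟨Φ, σ, hσ, hlu.differentiableOn (Eventually.of_forall fun k => hφ _) isOpen_ball, hlu⟩

end Montel

/-! ### The maximum principle for discs in convex sets -/

section MaximumPrinciple

variable {E : Type*} [NormedAddCommGroup E] [NormedSpace ℂ E]

/-- Re of a linear functional of a holomorphic disc, at an interior maximum, is constant. -/
theorem re_clm_eq_of_isMax {Φ : ℂ → E} (hΦ : DifferentiableOn ℂ Φ (ball 0 1)) (b : E →L[ℂ] ℂ)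
    {l₀ : ℂ} (hl₀ : l₀ ∈ ball (0 : ℂ) 1)
    (hb : ∀ l ∈ ball (0 : ℂ) 1, (b (Φ l)).re ≤ (b (Φ l₀)).re) {l : ℂ}
    (hl : l ∈ ball (0 : ℂ) 1) : (b (Φ l)).re = (b (Φ l₀)).re := by
  have hd : DifferentiableOn ℂ (fun l => Complex.exp (b (Φ l))) (ball 0 1) :=
    (b.differentiable.comp_differentiableOn hΦ).cexp
  have := Complex.norm_eqOn_of_isPreconnected_of_isMaxOn (convex_ball (0 : ℂ) 1).isPreconnected
    isOpen_ball hd hl₀ (fun l hl => by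
      simp only [Function.comp, mem_ofPred_eq, Complex.norm_exp]
      exact Real.exp_le_exp.2 (hb l hl)) hl
  simp only [Function.comp, Function.const_apply, Complex.norm_exp] at this
  exact Real.exp_injective this

/-- If a value left D, a functional separating it from D would attain an interior maximum of its
real part, hence be constant on the disc, against Φ l₀ ∈ D. -/
theorem mapsTo_of_mapsTo_closure {D : Set E} (hD : IsOpen D) (hDc : Convex ℝ D) {Φ : ℂ → E}
    (hΦ : DifferentiableOn ℂ Φ (ball 0 1)) (hm : MapsTo Φ (ball 0 1) (closure D)) {l₀ : ℂ}
    (hl₀ : l₀ ∈ ball (0 : ℂ) 1) (h0 : Φ l₀ ∈ D) : MapsTo Φ (ball 0 1) D := by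
  intro l hl
  by_contra hcon
  obtain ⟨b, hb⟩ := RCLike.geometric_hahn_banach_open_point (𝕜 := ℂ) hDc hD hcon
  have hcl : ∀ x ∈ closure D, (b x).re ≤ (b (Φ l)).re := fun x hx =>
    closure_minimal (fun y hy => (hb y hy).le)
      (isClosed_le (Complex.continuous_re.comp b.continuous) continuous_const) hx
  have := re_clm_eq_of_isMax hΦ b hl (fun m hm' => hcl _ (hm hm')) hl₀
  exact absurd this (hb _ h0).ne

theorem mem_of_sphere_subset {D : Set E} (hD : IsOpen D) (hDc : Convex ℝ D) {ψ : ℂ → E}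
    {ρ : ℝ} (hρ : 1 < ρ) (hψ : DifferentiableOn ℂ ψ (ball 0 ρ))
    (hs : ∀ l ∈ sphere (0 : ℂ) 1, ψ l ∈ D) {l : ℂ} (hl : l ∈ closedBall (0 : ℂ) 1) : ψ l ∈ D := by
  by_contra hcon
  obtain ⟨b, hb⟩ := RCLike.geometric_hahn_banach_open_point (𝕜 := ℂ) hDc hD hcon
  have hd : DiffContOnCl ℂ (fun l => Complex.exp (b (ψ l))) (ball 0 1) := by
    refine DifferentiableOn.diffContOnCl ?_
    rw [closure_ball _ one_ne_zero]
    exact (b.differentiable.comp_differentiableOn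
      (hψ.mono (closedBall_subset_ball hρ))).cexp
  obtain ⟨z, hz, hmax⟩ := Complex.exists_mem_frontier_isMaxOn_norm isBounded_ball
    (nonempty_ball.2 zero_lt_one) hd
  rw [frontier_ball _ one_ne_zero] at hz
  rw [closure_ball _ one_ne_zero] at hmax
  have h1 := hmax hl
  simp only [Function.comp, mem_ofPred_eq, Complex.norm_exp, Real.exp_le_exp] at h1
  exact absurd h1 (not_le.2 (hb _ (hs z hz)))

end MaximumPrinciple

/-! ### The separating functional of a linear extremal problem -/

section ExtremalFunctional

variable {E : Type*} [NormedAddCommGroup E] [NormedSpace ℂ E]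

theorem exists_circle_eq {ρ : ℝ} (hρ : 1 < ρ) {g : ℂ → E} (hg : DifferentiableOn ℂ g (ball 0 ρ)) :
    ∃ u : C(sphere (0 : ℂ) 1, E), ∀ ζ, u ζ = g ζ :=
  ⟨⟨fun ζ => g ζ, (hg.continuousOn.mono
    (sphere_subset_closedBall.trans (closedBall_subset_ball hρ))).domRestrict⟩, fun _ => rfl⟩

theorem clm_real_smul (a : E →L[ℝ] ℝ) (t : ℝ) (e : E) : a ((t : ℂ) • e) = t * a e := by
  rw [Complex.coe_smul, map_smul, smul_eq_mul]

theorem exists_clm_pos {a : E →L[ℝ] ℝ} (ha : a ≠ 0) : ∃ e, a e = 1 := by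
  obtain ⟨e, he⟩ : ∃ e, a e ≠ 0 := by
    by_contra! hcon
    exact ha (ContinuousLinearMap.ext hcon)
  exact ⟨(a e)⁻¹ • e, by rw [map_smul, smul_eq_mul, inv_mul_cancel₀ he]⟩

/-- A functional on `C(𝕋, E)` that separates the loops in `D` from the boundary values of the
holomorphic discs that start at `p` and reach the half-space `{a ≥ a q}` at the point `R`. -/
structure IsExtremalFunctional (D : Set E) (a : E →L[ℝ] ℝ) (R : ℝ) (p q : E) (c : ℝ)
    (Λ : C(sphere (0 : ℂ) 1, E) →L[ℂ] ℂ) : Prop where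
  re_lt : ∀ u : C(sphere (0 : ℂ) 1, E), (∀ ζ, u ζ ∈ D) → (Λ u).re < c
  le_re : ∀ (ρ : ℝ) (ψ : ℂ → E), 1 < ρ → DifferentiableOn ℂ ψ (ball 0 ρ) → ψ 0 = p →
    a q ≤ a (ψ R) → ∀ u : C(sphere (0 : ℂ) 1, E), (∀ ζ, u ζ = ψ ζ) → c ≤ (Λ u).re

/-- The loops in D form an open convex set, and the boundary values of discs with a(ψ R) ≥ a q form
a convex one. Extremality makes them disjoint, so Hahn–Banach applies. -/
theorem exists_isExtremalFunctional {D : Set E} (hD : IsOpen D) (hDc : Convex ℝ D)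
    {a : E →L[ℝ] ℝ} (ha : a ≠ 0) {R : ℝ} (hR : 0 < R) {p q : E}
    (hsup : ∀ (ρ : ℝ) (ψ : ℂ → E), 1 < ρ → DifferentiableOn ℂ ψ (ball 0 ρ) →
      (∀ l ∈ closedBall (0 : ℂ) 1, ψ l ∈ D) → ψ 0 = p → a (ψ R) ≤ a q) :
    ∃ c Λ, IsExtremalFunctional D a R p q c Λ := by
  let U : Set C(sphere (0 : ℂ) 1, E) := {u | ∀ ζ, u ζ ∈ D}
  let V : Set C(sphere (0 : ℂ) 1, E) := {u | ∃ (ρ : ℝ) (ψ : ℂ → E), 1 < ρ ∧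
    DifferentiableOn ℂ ψ (ball 0 ρ) ∧ ψ 0 = p ∧ a q ≤ a (ψ R) ∧ ∀ ζ, u ζ = ψ ζ}
  have hUo : IsOpen U := by
    have := ContinuousMap.isOpen_setOfPred_mapsTo (X := sphere (0 : ℂ) 1) (Y := E) isCompact_univ hD
    convert! this using 1
    ext u
    simp [U, MapsTo]
  have hUc : Convex ℝ U := by
    intro u hu v hv s t hs ht hst ζ
    exact hDc (hu ζ) (hv ζ) hs ht hst
  have hVc : Convex ℝ V := by
    rintro u ⟨ρ, ψ, hρ, hψ, h0, h1, h2⟩ v ⟨ρ', ψ', hρ', hψ', h0', h1', h2'⟩ s t hs ht hst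
    refine ⟨min ρ ρ', fun l => s • ψ l + t • ψ' l, lt_min hρ hρ', ?_, ?_, ?_, ?_⟩
    · exact ((hψ.mono (ball_subset_ball (min_le_left _ _))).const_smul s).add
        ((hψ'.mono (ball_subset_ball (min_le_right _ _))).const_smul t)
    · beta_reduce
      rw [h0, h0', ← add_smul, hst, one_smul]
    · rw [map_add, map_smul, map_smul, smul_eq_mul, smul_eq_mul]
      have ht' : t = 1 - s := by linarith
      subst ht'
      nlinarith [mul_le_mul_of_nonneg_left h1 hs, mul_le_mul_of_nonneg_left h1' ht]
    · intro ζ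
      rw [ContinuousMap.add_apply, ContinuousMap.smul_apply, ContinuousMap.smul_apply, h2, h2']
  have hdisj : Disjoint U V := by
    rw [Set.disjoint_left]
    rintro u hu ⟨ρ, ψ, hρ, hψ, h0, h1, h2⟩
    -- A common loop could be moved by ε l e. By openness it would stay in D, by the maximum
    -- principle its disc would too, and a at R would grow by εR, exceeding a q.
    obtain ⟨e, he⟩ := exists_clm_pos ha
    obtain ⟨w, hw⟩ := exists_circle_eq (g := fun l : ℂ => l • e) hρ
      (differentiable_id.smul_const e).differentiableOn
    have hev : ∀ᶠ ε : ℝ in 𝓝[>] 0, u + (ε : ℂ) • w ∈ U := by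
      have hc : Continuous fun ε : ℝ => u + (ε : ℂ) • w := by fun_prop
      have : Tendsto (fun ε : ℝ => u + (ε : ℂ) • w) (𝓝[>] 0) (𝓝 (u + ((0 : ℝ) : ℂ) • w)) :=
        (hc.tendsto 0).mono_left nhdsWithin_le_nhds
      exact this.eventually (hUo.mem_nhds (by simpa using hu))
    obtain ⟨ε, hεU, hε⟩ := (hev.and self_mem_nhdsWithin).exists
    have hε : 0 < ε := hε
    have hd : DifferentiableOn ℂ (fun l : ℂ => ψ l + (ε : ℂ) • l • e) (ball 0 ρ) :=
      hψ.add ((differentiable_id.smul_const e).differentiableOn.const_smul (ε : ℂ))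
    have := hsup ρ (fun l : ℂ => ψ l + (ε : ℂ) • l • e) hρ hd
      (fun l hl => mem_of_sphere_subset hD hDc hρ hd (fun l hl => by
        have := hεU ⟨l, hl⟩
        rwa [ContinuousMap.add_apply, ContinuousMap.smul_apply, h2, hw] at this) hl)
      (by simp [h0])
    rw [map_add, clm_real_smul, clm_real_smul, he] at this
    nlinarith [mul_pos hε hR]
  obtain ⟨Λ, c, h1, h2⟩ := RCLike.geometric_hahn_banach_open (𝕜 := ℂ) hUc hUo hVc hdisj
  exact ⟨c, Λ, h1, fun ρ ψ hρ hψ h0 hq u hu => h2 u ⟨ρ, ψ, hρ, hψ, h0, hq, hu⟩⟩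

namespace IsExtremalFunctional

variable {D : Set E} {a : E →L[ℝ] ℝ} {R : ℝ} {p q : E} {c : ℝ}
  {Λ : C(sphere (0 : ℂ) 1, E) →L[ℂ] ℂ}

/-- Adding t·g with t ≥ 0 to the affine disc from p through q keeps it among the discs on which Re Λ
is at least c. Letting t grow forces the sign. -/
theorem re_nonneg (h : IsExtremalFunctional D a R p q c Λ) (hR : R ≠ 0) {ρ : ℝ} (hρ : 1 < ρ)
    {g : ℂ → E} (hg : DifferentiableOn ℂ g (ball 0 ρ)) (h0 : g 0 = 0) (ha : 0 ≤ a (g R))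
    {u : C(sphere (0 : ℂ) 1, E)} (hu : ∀ ζ, u ζ = g ζ) : 0 ≤ (Λ u).re := by
  have hRc : (R : ℂ) ≠ 0 := by exact_mod_cast hR
  have hb : DifferentiableOn ℂ (fun l : ℂ => p + (l / R) • (q - p)) (ball 0 ρ) := by fun_prop
  obtain ⟨w, hw⟩ := exists_circle_eq hρ hb
  have key : ∀ t : ℝ, 0 ≤ t → c ≤ (Λ w).re + t * (Λ u).re := by
    intro t ht
    have := h.le_re ρ (fun l : ℂ => p + (l / R) • (q - p) + (t : ℂ) • g l) hρ
      (hb.add (hg.const_smul (t : ℂ))) (by simp [h0])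
      (by
        rw [div_self hRc, one_smul, add_sub_cancel, map_add, clm_real_smul]
        nlinarith [mul_nonneg ht ha])
      (w + (t : ℂ) • u) (fun ζ => by
        rw [ContinuousMap.add_apply, ContinuousMap.smul_apply, hw, hu])
    rwa [map_add, map_smul, Complex.add_re, smul_eq_mul, Complex.re_ofReal_mul] at this
  by_contra! hneg
  have h2 := key ((|(Λ w).re - c| + 1) / (-(Λ u).re))
    (div_nonneg (by positivity) (by linarith))
  have h3 : (|(Λ w).re - c| + 1) / (-(Λ u).re) * (Λ u).re = -(|(Λ w).re - c| + 1) := by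
    rw [div_mul_eq_mul_div, div_eq_iff (by linarith)]; ring
  rw [h3] at h2
  linarith [le_abs_self ((Λ w).re - c)]

/-- Every complex multiple of a disc vanishing at 0 and R satisfies `re_nonneg`. So Λ annihilates
such discs; this makes its Cauchy transform behave like a holomorphic density. -/
theorem eq_zero (h : IsExtremalFunctional D a R p q c Λ) (hR : R ≠ 0) {ρ : ℝ} (hρ : 1 < ρ)
    {g : ℂ → E} (hg : DifferentiableOn ℂ g (ball 0 ρ)) (h0 : g 0 = 0) (hgR : g R = 0)
    {u : C(sphere (0 : ℂ) 1, E)} (hu : ∀ ζ, u ζ = g ζ) : Λ u = 0 := by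
  have key : ∀ ω : ℂ, 0 ≤ (ω * Λ u).re := by
    intro ω
    have := h.re_nonneg hR hρ (hg.const_smul ω) (by simp [h0]) (by simp [hgR]) (u := ω • u)
      (fun ζ => by simp [hu])
    rwa [map_smul, smul_eq_mul] at this
  have h1 := key 1
  have h2 := key (-1)
  have h3 := key Complex.I
  have h4 := key (-Complex.I)
  simp at h1 h2 h3 h4
  apply Complex.ext
  · simp; linarith
  · simp; linarith

/-- Since 0 ≤ χ/M ≤ 1, the loop φ + (χ/M)(g - φ) lies in D, while φ(r·) plus a linear correction
reaches q at R. Comparing Re Λ on the two leaves only the correction, which is small for r near 1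
when φ R = q. -/
theorem re_weighted_le (h : IsExtremalFunctional D a R p q c Λ) (hDc : Convex ℝ D) (hR : 0 < R)
    {φ g : ℂ → E} (hφ : DifferentiableOn ℂ φ (ball 0 1))
    (hφm : MapsTo φ (ball 0 1) D) (hφ0 : φ 0 = p) (hgm : MapsTo g (ball 0 1) D) {M : ℝ} (hM : 0 < M) {χ : sphere (0 : ℂ) 1 → ℝ}
    (hχ0 : ∀ ζ, 0 ≤ χ ζ) (hχM : ∀ ζ, χ ζ ≤ M) {r : ℝ} (hr : 0 < r)
    (hr1 : r < 1) {w : C(sphere (0 : ℂ) 1, E)}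
    (hw : ∀ ζ : sphere (0 : ℂ) 1, w ζ = (χ ζ : ℂ) • (g (r * ζ) - φ (r * ζ))) :
    (Λ w).re ≤ M * ‖Λ‖ * (‖q - φ (r * R)‖ / R) := by
  have hRc : (R : ℂ) ≠ 0 := by exact_mod_cast hR.ne'
  have hρ : 1 < 1 / r := by rwa [lt_div_iff₀ hr, one_mul]
  have hmap : MapsTo (fun l : ℂ => (r : ℂ) * l) (ball 0 (1 / r)) (ball 0 1) := by
    intro l hl
    rw [mem_ball_zero_iff, lt_div_iff₀ hr] at hl
    rw [mem_ball_zero_iff, norm_mul, Complex.norm_real, Real.norm_of_nonneg hr.le, mul_comm]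
    exact hl
  have hsph : ∀ ζ : sphere (0 : ℂ) 1, (r : ℂ) * ζ ∈ ball (0 : ℂ) 1 := fun ζ =>
    hmap (closedBall_subset_ball hρ (sphere_subset_closedBall ζ.2))
  have hφr : DifferentiableOn ℂ (fun l : ℂ => φ (r * l)) (ball 0 (1 / r)) :=
    hφ.comp (differentiable_id.const_mul (r : ℂ)).differentiableOn hmap
  obtain ⟨f, hf⟩ := exists_circle_eq hρ hφr
  obtain ⟨k, hk⟩ := exists_circle_eq (g := fun l : ℂ => (l / R) • (q - φ (r * R))) hρ (by fun_prop)
  have h1 := h.re_lt (f + ((M⁻¹ : ℝ) : ℂ) • w) (fun ζ => by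
    rw [ContinuousMap.add_apply, ContinuousMap.smul_apply, hw, hf, smul_smul, ← Complex.ofReal_mul,
      Complex.coe_smul]
    refine hDc.add_smul_sub_mem (hφm (hsph ζ)) (hgm (hsph ζ)) ⟨?_, ?_⟩
    · have := hχ0 ζ; positivity
    · rw [inv_mul_le_iff₀ hM, mul_one]; exact hχM ζ)
  have h2 := h.le_re _ (fun l : ℂ => φ (r * l) + (l / R) • (q - φ (r * R))) hρ
    (hφr.add (by fun_prop)) (by simp [hφ0]) (by rw [div_self hRc, one_smul, add_sub_cancel])
    (f + k) (fun ζ => by rw [ContinuousMap.add_apply, hf, hk])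
  have h3 := h1.le.trans h2
  rw [map_add, map_add, Complex.add_re, Complex.add_re, map_smul, smul_eq_mul,
    Complex.re_ofReal_mul, add_le_add_iff_left, inv_mul_le_iff₀ hM] at h3
  refine h3.trans ?_
  rw [mul_assoc]
  gcongr
  calc (Λ k).re ≤ ‖Λ k‖ := Complex.re_le_norm _
    _ ≤ ‖Λ‖ * ‖k‖ := Λ.le_opNorm k
    _ ≤ ‖Λ‖ * (‖q - φ (r * R)‖ / R) := by
      gcongr
      rw [ContinuousMap.norm_le _ (by positivity)]
      intro ζ
      rw [hk, norm_smul, norm_div, mem_sphere_zero_iff_norm.1 ζ.2, Complex.norm_real,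
        Real.norm_of_nonneg hR.le, one_div, div_eq_inv_mul]

end IsExtremalFunctional

end ExtremalFunctional

/-! ### The Cauchy transform of a functional on loops -/

section CauchyKernel

/-- The inclusion of the unit circle in the plane. -/
noncomputable def circleCoord : C(sphere (0 : ℂ) 1, ℂ) := ⟨fun ζ => ζ, continuous_subtype_val⟩

/-- The Cauchy kernel `1 / (ζ - l)` as a function on the circle. -/
noncomputable def cauchyKernel (l : ℂ) : C(sphere (0 : ℂ) 1, ℂ) := -resolvent circleCoord l

theorem circle_sub_ne_zero {l : ℂ} (hl : l ∈ ball (0 : ℂ) 1) (ζ : sphere (0 : ℂ) 1) :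
    (ζ : ℂ) - l ≠ 0 := by
  intro h
  have h1 := mem_sphere_zero_iff_norm.1 ζ.2
  rw [sub_eq_zero.1 h] at h1
  exact (mem_ball_zero_iff.1 hl).ne h1

theorem mem_resolventSet_circleCoord {l : ℂ} (hl : l ∈ ball (0 : ℂ) 1) :
    l ∈ resolventSet ℂ circleCoord := by
  rw [spectrum.mem_resolventSet_iff, ContinuousMap.isUnit_iff_forall_ne_zero]
  intro ζ h
  apply circle_sub_ne_zero hl ζ
  have : l - (ζ : ℂ) = 0 := h
  rw [← neg_sub, this, neg_zero]

theorem cauchyKernel_apply {l : ℂ} (hl : l ∈ ball (0 : ℂ) 1) (ζ : sphere (0 : ℂ) 1) :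
    cauchyKernel l ζ = ((ζ : ℂ) - l)⁻¹ := by
  have h1 := Ring.mul_inverse_cancel _
    (spectrum.mem_resolventSet_iff.1 (mem_resolventSet_circleCoord hl))
  have h2 := DFunLike.congr_fun h1 ζ
  have h3 : (l - (ζ : ℂ)) * resolvent circleCoord l ζ = 1 := h2
  have h4 : cauchyKernel l ζ = -resolvent circleCoord l ζ := rfl
  rw [h4]
  refine eq_inv_of_mul_eq_one_left ?_
  rw [← h3]
  ring

/-- Viewing the kernel as a resolvent in the Banach algebra of functions on the circle gives
differentiability in the uniform norm. -/
theorem hasDerivAt_cauchyKernel {l : ℂ} (hl : l ∈ ball (0 : ℂ) 1) :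
    HasDerivAt cauchyKernel (cauchyKernel l ^ 2) l := by
  refine (spectrum.hasDerivAt_resolvent_const_left
    (mem_resolventSet_circleCoord hl)).neg.congr_deriv ?_
  simp [cauchyKernel]

variable {E : Type*} [NormedAddCommGroup E] [NormedSpace ℂ E]

theorem circle_mul_eq (a : ℂ) (ζ : sphere (0 : ℂ) 1) :
    ((ζ : ℂ) - a) * (1 - conj a * ζ) = ζ * ((‖(ζ : ℂ) - a‖ ^ 2 : ℝ) : ℂ) := by
  have h1 : (ζ : ℂ) * conj (ζ : ℂ) = 1 := by
    rw [Complex.mul_conj', mem_sphere_zero_iff_norm.1 ζ.2]; simp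
  rw [Complex.ofReal_pow, ← Complex.mul_conj', map_sub]
  linear_combination (a - (ζ : ℂ)) * h1

/-- Multiplication of a constant vector by a scalar function on the circle. -/
noncomputable def circleSmul (e : E) : C(sphere (0 : ℂ) 1, ℂ) →L[ℂ] C(sphere (0 : ℂ) 1, E) :=
  ContinuousLinearMap.compLeftContinuous ℂ _ (ContinuousLinearMap.toSpanSingleton ℂ e)

theorem circleSmul_apply (e : E) (k : C(sphere (0 : ℂ) 1, ℂ)) (ζ : sphere (0 : ℂ) 1) :
    circleSmul e k ζ = k ζ • e := rfl

variable [FiniteDimensional ℂ E]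

/-- The functional `e ↦ Λ (k • e)` on `E`. -/
noncomputable def kernelFunctional (Λ : C(sphere (0 : ℂ) 1, E) →L[ℂ] ℂ) (k : C(sphere (0 : ℂ) 1, ℂ)) :
    E →L[ℂ] ℂ :=
  LinearMap.toContinuousLinearMap
    { toFun := fun e => Λ (circleSmul e k)
      map_add' := fun e e' => by
        rw [← map_add]
        congr 1
        ext ζ
        simp [circleSmul_apply]
      map_smul' := fun t e => by
        rw [RingHom.id_apply, ← map_smul]
        congr 1
        ext ζ
        simp only [circleSmul_apply, ContinuousMap.smul_apply]
        rw [smul_comm] }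

theorem kernelFunctional_apply (Λ : C(sphere (0 : ℂ) 1, E) →L[ℂ] ℂ) (k : C(sphere (0 : ℂ) 1, ℂ))
    (e : E) : kernelFunctional Λ k e = Λ (circleSmul e k) := rfl

/-- The Cauchy transform, with density `W`, of a functional on `C(𝕋, E)`. -/
noncomputable def cauchyTransform (Λ : C(sphere (0 : ℂ) 1, E) →L[ℂ] ℂ) (W : C(sphere (0 : ℂ) 1, ℂ)) (l : ℂ) :
    E →L[ℂ] ℂ :=
  kernelFunctional Λ (W * cauchyKernel l)

theorem hasDerivAt_cauchyTransform_apply (Λ : C(sphere (0 : ℂ) 1, E) →L[ℂ] ℂ)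
    (W : C(sphere (0 : ℂ) 1, ℂ)) (e : E) {l : ℂ} (hl : l ∈ ball (0 : ℂ) 1) :
    HasDerivAt (fun l => cauchyTransform Λ W l e)
      (kernelFunctional Λ (W * cauchyKernel l ^ 2) e) l := by
  have h1 := (hasDerivAt_cauchyKernel hl).const_mul W
  have h2 := (Λ.comp (circleSmul e)).hasFDerivAt.comp_hasDerivAt l h1
  exact h2

theorem differentiableOn_cauchyTransform (Λ : C(sphere (0 : ℂ) 1, E) →L[ℂ] ℂ)
    (W : C(sphere (0 : ℂ) 1, ℂ)) : DifferentiableOn ℂ (cauchyTransform Λ W) (ball 0 1) :=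
  differentiableOn_clm_of_apply fun e _ hl =>
    (hasDerivAt_cauchyTransform_apply Λ W e hl).differentiableAt.differentiableWithinAt

theorem deriv_cauchyTransform (Λ : C(sphere (0 : ℂ) 1, E) →L[ℂ] ℂ)
    (W : C(sphere (0 : ℂ) 1, ℂ)) {l : ℂ} (hl : l ∈ ball (0 : ℂ) 1) :
    deriv (cauchyTransform Λ W) l = kernelFunctional Λ (W * cauchyKernel l ^ 2) := by
  ext e
  have h1 := ((differentiableOn_cauchyTransform Λ W).differentiableAt
    (isOpen_ball.mem_nhds hl)).hasDerivAt.clm_apply (hasDerivAt_const l e)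
  rw [map_zero, add_zero] at h1
  exact h1.unique (hasDerivAt_cauchyTransform_apply Λ W e hl)

/-- The density `ζ (ζ - R) (1 - R ζ) = ζ² |ζ - R|²` on the circle. -/
noncomputable def circleDensity (R : ℝ) : C(sphere (0 : ℂ) 1, ℂ) :=
  ⟨fun ζ => (ζ : ℂ) * ((ζ - R) * (1 - R * ζ)), by fun_prop⟩

theorem circleDensity_apply (R : ℝ) (ζ : sphere (0 : ℂ) 1) :
    circleDensity R ζ = (ζ : ℂ) * ((ζ - R) * (1 - R * ζ)) := rfl

/-- On the circle (ζ - l)(1 - conj l · ζ) = ζ|ζ - l|², so the factors ζ² cancel. The density thus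
has two virtues: it vanishes at 0 and R, and it produces a non-negative weight usable as χ in
`re_weighted_le`. -/
theorem circleDensity_div_eq (R : ℝ) {l : ℂ} (hl : l ∈ ball (0 : ℂ) 1) (ζ : sphere (0 : ℂ) 1) :
    circleDensity R ζ * cauchyKernel l ζ ^ 2 * ((1 - conj l * ζ)⁻¹) ^ 2 =
      ((‖(ζ : ℂ) - R‖ ^ 2 / (‖(ζ : ℂ) - l‖ ^ 2) ^ 2 : ℝ) : ℂ) := by
  have h1 := circle_mul_eq (R : ℂ) ζ
  rw [Complex.conj_ofReal] at h1
  have h2 := circle_mul_eq l ζ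
  have hζ : (ζ : ℂ) ≠ 0 := by
    intro h
    have := mem_sphere_zero_iff_norm.1 ζ.2
    simp [h] at this
  have h3 : ((‖(ζ : ℂ) - l‖ ^ 2 : ℝ) : ℂ) ≠ 0 := by
    have := circle_sub_ne_zero hl ζ
    simpa using this
  rw [circleDensity_apply, cauchyKernel_apply hl, h1, mul_assoc, ← mul_pow, ← mul_inv, h2,
    Complex.ofReal_div, Complex.ofReal_pow (‖(ζ : ℂ) - l‖ ^ 2)]
  field_simp

namespace IsExtremalFunctional

variable {D : Set E} {a : E →L[ℝ] ℝ} {R : ℝ} {p q : E} {c : ℝ}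
  {Λ : C(sphere (0 : ℂ) 1, E) →L[ℂ] ℂ}

/-- Expand w to second order at μ. The remainder cancels the double pole and, multiplied by the
density, vanishes at 0 and R, so Λ kills it; the other two terms give the transform and its
derivative. -/
theorem apply_circleDensity_mul (h : IsExtremalFunctional D a R p q c Λ) (hR : R ≠ 0)
    {μ : ℂ} (hμ : μ ∈ ball (0 : ℂ) 1) {ρ : ℝ} (hρ : 1 < ρ) {w : ℂ → E}
    (hw : DifferentiableOn ℂ w (ball 0 ρ)) {v : C(sphere (0 : ℂ) 1, E)}
    (hv : ∀ ζ, v ζ = (circleDensity R ζ * cauchyKernel μ ζ ^ 2) • w ζ) :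
    Λ v = deriv (cauchyTransform Λ (circleDensity R)) μ (w μ) +
      cauchyTransform Λ (circleDensity R) μ (deriv w μ) := by
  have : CompleteSpace E := FiniteDimensional.complete ℂ E
  have hμρ : ball (0 : ℂ) ρ ∈ 𝓝 μ := isOpen_ball.mem_nhds (ball_subset_ball hρ.le hμ)
  have h2 : DifferentiableOn ℂ (dslope (dslope w μ) μ) (ball 0 ρ) :=
    (Complex.differentiableOn_dslope hμρ).2 ((Complex.differentiableOn_dslope hμρ).2 hw)
  have hexp : ∀ ζ, w ζ = w μ + (ζ - μ) • deriv w μ + (ζ - μ) ^ 2 • dslope (dslope w μ) μ ζ := by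
    intro ζ
    have e1 := sub_smul_dslope w μ ζ
    have e2 := sub_smul_dslope (dslope w μ) μ ζ
    rw [dslope_same] at e2
    rw [pow_two, mul_smul, e2, smul_sub, e1]
    abel
  have h3 : DifferentiableOn ℂ (fun ζ : ℂ => (ζ * ((ζ - R) * (1 - R * ζ))) •
      dslope (dslope w μ) μ ζ) (ball 0 ρ) := by
    refine DifferentiableOn.smul ?_ h2
    fun_prop
  obtain ⟨k, hk⟩ := exists_circle_eq hρ h3
  have hk0 : Λ k = 0 := h.eq_zero hR hρ h3 (by simp) (by simp) hk
  have hv' : v = circleSmul (w μ) (circleDensity R * cauchyKernel μ ^ 2) +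
      circleSmul (deriv w μ) (circleDensity R * cauchyKernel μ) + k := by
    ext1 ζ
    have hne := circle_sub_ne_zero hμ ζ
    rw [hv, hexp]
    simp only [ContinuousMap.add_apply, circleSmul_apply, ContinuousMap.mul_apply,
      ContinuousMap.pow_apply, hk, circleDensity_apply, cauchyKernel_apply hμ, smul_add, smul_smul]
    congr 1
    · congr 2
      field_simp
    · congr 1
      field_simp
  rw [hv', map_add, map_add, hk0, add_zero, deriv_cauchyTransform _ _ hμ, kernelFunctional_apply,
    cauchyTransform, kernelFunctional_apply]

end IsExtremalFunctional

end CauchyKernel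

/-! ### The first variation along the extremal disc -/

section Variation

variable {E : Type*} [NormedAddCommGroup E] [NormedSpace ℂ E] [FiniteDimensional ℂ E]

namespace IsExtremalFunctional

variable {D : Set E} {a : E →L[ℝ] ℝ} {R : ℝ} {p q : E} {c : ℝ}
  {Λ : C(sphere (0 : ℂ) 1, E) →L[ℂ] ℂ}

theorem apply_weighted (h : IsExtremalFunctional D a R p q c Λ) (hR : R ≠ 0)
    {μ : ℂ} (hμ : μ ∈ ball (0 : ℂ) 1) {ρ : ℝ} (hρ : 1 < ρ) {u : ℂ → E}
    (hu : DifferentiableOn ℂ u (ball 0 ρ)) {v : C(sphere (0 : ℂ) 1, E)}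
    (hv : ∀ ζ : sphere (0 : ℂ) 1,
      v ζ = ((‖(ζ : ℂ) - R‖ ^ 2 / (‖(ζ : ℂ) - μ‖ ^ 2) ^ 2 : ℝ) : ℂ) • u ζ) :
    (1 - conj μ * μ) ^ 2 * Λ v =
      deriv (cauchyTransform Λ (circleDensity R)) μ (u μ) +
        cauchyTransform Λ (circleDensity R) μ (deriv u μ) +
        2 * conj μ / (1 - conj μ * μ) * cauchyTransform Λ (circleDensity R) μ (u μ) := by
  have hμ1 : ‖μ‖ < 1 := mem_ball_zero_iff.1 hμ
  -- This radius exceeds 1 but stays below 1/‖μ‖, so (1 - conj μ · ζ)⁻² is holomorphic past the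
  -- closed disc.
  set ρ' : ℝ := min ρ (2 / (1 + ‖μ‖)) with hρ'
  have h0 : 0 < 1 + ‖μ‖ := by positivity
  have hρ1 : 1 < ρ' := lt_min hρ (by rw [lt_div_iff₀ h0]; linarith)
  have hne : ∀ ζ ∈ ball (0 : ℂ) ρ', 1 - conj μ * ζ ≠ 0 := by
    intro ζ hζ hcon
    have h1 : ‖conj μ * ζ‖ = 1 := by rw [← sub_eq_zero.1 hcon, norm_one]
    rw [norm_mul, RCLike.norm_conj] at h1
    have h2 : ‖ζ‖ < 2 / (1 + ‖μ‖) :=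
      (mem_ball_zero_iff.1 hζ).trans_le (min_le_right _ _)
    rw [lt_div_iff₀ h0] at h2
    nlinarith [norm_nonneg μ, norm_nonneg ζ]
  have hμρ : μ ∈ ball (0 : ℂ) ρ' := ball_subset_ball hρ1.le hμ
  have hu' : DifferentiableOn ℂ u (ball 0 ρ') := hu.mono (ball_subset_ball (min_le_left _ _))
  have hinv : DifferentiableOn ℂ (fun ζ => ((1 - conj μ * ζ)⁻¹) ^ 2) (ball 0 ρ') :=
    (DifferentiableOn.inv (by fun_prop) hne).pow 2
  have hw : DifferentiableOn ℂ (fun ζ => ((1 - conj μ * ζ)⁻¹) ^ 2 • u ζ) (ball 0 ρ') :=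
    hinv.smul hu'
  have key := h.apply_circleDensity_mul hR hμ hρ1 hw (v := v) (fun ζ => by
    rw [hv, smul_smul, circleDensity_div_eq R hμ])
  have hd : HasDerivAt (fun ζ => ((1 - conj μ * ζ)⁻¹) ^ 2 • u ζ)
      (((1 - conj μ * μ)⁻¹) ^ 2 • deriv u μ +
        (2 * conj μ * ((1 - conj μ * μ)⁻¹) ^ 3) • u μ) μ := by
    have h1 : HasDerivAt (fun ζ => ((1 - conj μ * ζ)⁻¹) ^ 2)
        (2 * conj μ * ((1 - conj μ * μ)⁻¹) ^ 3) μ := by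
      have h2 : HasDerivAt (fun ζ => 1 - conj μ * ζ) (-conj μ) μ := by
        simpa using ((hasDerivAt_id μ).const_mul (conj μ)).const_sub 1
      have hn := hne μ hμρ
      refine ((h2.inv hn).pow 2).congr_deriv ?_
      field_simp
      simp
      rw [mul_assoc, inv_mul_cancel₀ hn, mul_one, mul_comm]
    exact h1.smul (hu'.differentiableAt (isOpen_ball.mem_nhds hμρ)).hasDerivAt
  have hn := hne μ hμρ
  rw [key, hd.deriv]
  simp only [map_add, map_smul, smul_eq_mul]
  field_simp
  ring

/-- The first variation of the extremal problem. -/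
theorem re_variation_nonpos (h : IsExtremalFunctional D a R p q c Λ) (hDc : Convex ℝ D)
    (hR : 0 < R) (hR1 : R < 1) {φ g : ℂ → E} (hφ : DifferentiableOn ℂ φ (ball 0 1))
    (hφm : MapsTo φ (ball 0 1) D) (hφ0 : φ 0 = p) (hφR : φ R = q)
    (hg : DifferentiableOn ℂ g (ball 0 1)) (hgm : MapsTo g (ball 0 1) D)
    {μ : ℂ} (hμ : μ ∈ ball (0 : ℂ) 1) :
    (deriv (cauchyTransform Λ (circleDensity R)) μ (g μ - φ μ) +
        cauchyTransform Λ (circleDensity R) μ (deriv g μ - deriv φ μ) +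
        2 * conj μ / (1 - conj μ * μ) *
          cauchyTransform Λ (circleDensity R) μ (g μ - φ μ)).re ≤ 0 := by
  have hμ1 : ‖μ‖ < 1 := mem_ball_zero_iff.1 hμ
  have hRb : (R : ℂ) ∈ ball (0 : ℂ) 1 := by
    rw [mem_ball_zero_iff, Complex.norm_real, Real.norm_of_nonneg hR.le]; exact hR1
  have : CompleteSpace E := FiniteDimensional.complete ℂ E
  set H := cauchyTransform Λ (circleDensity R)
  set w : ℂ → E := fun l => g l - φ l with hw
  have hwd : DifferentiableOn ℂ w (ball 0 1) := hg.sub hφ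
  have hdw : deriv w μ = deriv g μ - deriv φ μ :=
    deriv_sub (hg.differentiableAt (isOpen_ball.mem_nhds hμ))
      (hφ.differentiableAt (isOpen_ball.mem_nhds hμ))
  have hdc : ContinuousOn (deriv w) (ball 0 1) := (hwd.deriv isOpen_ball).continuousOn
  -- An upper bound for the weight |ζ - R|² / |ζ - μ|⁴ on the circle.
  set M : ℝ := (1 + 1) ^ 2 / ((1 - ‖μ‖) ^ 2) ^ 2 with hM
  have hsub : 0 < 1 - ‖μ‖ := by linarith
  have hM0 : 0 < M := by positivity
  have hsq : ‖μ‖ ^ 2 < 1 := by nlinarith [norm_nonneg μ]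
  have hcμ : 1 - conj μ * μ = ((1 - ‖μ‖ ^ 2 : ℝ) : ℂ) := by
    rw [Complex.conj_mul']; push_cast; rfl
  -- Neither φ nor g need have boundary values, so the comparison is made for the dilated discs and
  -- r tends to 1.
  have key : ∀ r ∈ Ioo (0 : ℝ) 1,
      (deriv H μ (w (r * μ)) + H μ ((r : ℂ) • deriv w (r * μ)) +
        2 * conj μ / (1 - conj μ * μ) * H μ (w (r * μ))).re ≤
        (1 - ‖μ‖ ^ 2) ^ 2 * (M * ‖Λ‖ * (‖q - φ (r * R)‖ / R)) := by
    intro r hr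
    have hρ : 1 < 1 / r := by rw [lt_div_iff₀ hr.1, one_mul]; exact hr.2
    have hmap : MapsTo (fun l : ℂ => (r : ℂ) * l) (ball 0 (1 / r)) (ball 0 1) := by
      intro l hl
      rw [mem_ball_zero_iff, lt_div_iff₀ hr.1] at hl
      rw [mem_ball_zero_iff, norm_mul, Complex.norm_real, Real.norm_of_nonneg hr.1.le, mul_comm]
      exact hl
    have hu : DifferentiableOn ℂ (fun l : ℂ => w (r * l)) (ball 0 (1 / r)) :=
      hwd.comp (differentiable_id.const_mul (r : ℂ)).differentiableOn hmap
    obtain ⟨u, hu'⟩ := exists_circle_eq hρ hu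
    have hχc : Continuous fun ζ : sphere (0 : ℂ) 1 =>
        ((‖(ζ : ℂ) - R‖ ^ 2 / (‖(ζ : ℂ) - μ‖ ^ 2) ^ 2 : ℝ) : ℂ) := by
      refine Complex.continuous_ofReal.comp (Continuous.div (by fun_prop) (by fun_prop) ?_)
      intro ζ
      have := norm_ne_zero_iff.2 (circle_sub_ne_zero hμ ζ)
      positivity
    let v : C(sphere (0 : ℂ) 1, E) := ⟨_, hχc.smul u.continuous⟩
    have hv : ∀ ζ : sphere (0 : ℂ) 1,
      v ζ = ((‖(ζ : ℂ) - R‖ ^ 2 / (‖(ζ : ℂ) - μ‖ ^ 2) ^ 2 : ℝ) : ℂ) • w (r * ζ) := by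
      intro ζ
      rw [← hu']
      rfl
    have h1 := h.apply_weighted hR.ne' hμ hρ hu hv
    have h2 := h.re_weighted_le hDc hR hφ hφm hφ0 hgm hM0 (fun ζ => by positivity)
      (fun ζ => by
        have hζ := mem_sphere_zero_iff_norm.1 ζ.2
        rw [hM]
        gcongr
        · calc ‖(ζ : ℂ) - R‖ ≤ ‖(ζ : ℂ)‖ + ‖(R : ℂ)‖ := norm_sub_le _ _
            _ ≤ 1 + 1 := by rw [hζ]; gcongr; exact (mem_ball_zero_iff.1 hRb).le
        · calc 1 - ‖μ‖ = ‖(ζ : ℂ)‖ - ‖μ‖ := by rw [hζ]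
            _ ≤ ‖(ζ : ℂ) - μ‖ := norm_sub_norm_le _ _) hr.1 hr.2 hv
    have h3 : deriv (fun l : ℂ => w (r * l)) μ = (r : ℂ) • deriv w (r * μ) := by
      exact deriv_comp_mul_left (r : ℂ) w μ
    rw [h3] at h1
    rw [← h1, hcμ, ← Complex.ofReal_pow, Complex.re_ofReal_mul]
    gcongr
  have ht : Tendsto (fun r : ℝ => (r : ℂ) * μ) (𝓝[<] 1) (𝓝 μ) := by
    have : Tendsto (fun r : ℝ => (r : ℂ) * μ) (𝓝 1) (𝓝 (((1 : ℝ) : ℂ) * μ)) :=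
      Continuous.tendsto (by fun_prop) _
    rw [Complex.ofReal_one, one_mul] at this
    exact this.mono_left nhdsWithin_le_nhds
  have htR : Tendsto (fun r : ℝ => (r : ℂ) * R) (𝓝[<] 1) (𝓝 (R : ℂ)) := by
    have : Tendsto (fun r : ℝ => (r : ℂ) * R) (𝓝 1) (𝓝 (((1 : ℝ) : ℂ) * R)) :=
      Continuous.tendsto (by fun_prop) _
    rw [Complex.ofReal_one, one_mul] at this
    exact this.mono_left nhdsWithin_le_nhds
  have hr1 : Tendsto (fun r : ℝ => (r : ℂ)) (𝓝[<] 1) (𝓝 ((1 : ℝ) : ℂ)) :=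
    (Complex.continuous_ofReal.tendsto 1).mono_left nhdsWithin_le_nhds
  have hw1 : Tendsto (fun r : ℝ => w (r * μ)) (𝓝[<] 1) (𝓝 (w μ)) :=
    (hwd.continuousOn.continuousAt (isOpen_ball.mem_nhds hμ)).tendsto.comp ht
  have hw2 : Tendsto (fun r : ℝ => (r : ℂ) • deriv w (r * μ)) (𝓝[<] 1) (𝓝 (deriv w μ)) := by
    have := hr1.smul ((hdc.continuousAt (isOpen_ball.mem_nhds hμ)).tendsto.comp ht)
    rwa [Complex.ofReal_one, one_smul] at this
  have hw3 : Tendsto (fun r : ℝ => φ (r * R)) (𝓝[<] 1) (𝓝 q) := by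
    have := (hφ.continuousOn.continuousAt (isOpen_ball.mem_nhds hRb)).tendsto.comp htR
    rwa [hφR] at this
  have hL := Complex.continuous_re.continuousAt.tendsto.comp
    (((((deriv H μ).continuous.tendsto _).comp hw1).add
    (((H μ).continuous.tendsto _).comp hw2)).add
    ((((H μ).continuous.tendsto _).comp hw1).const_mul (2 * conj μ / (1 - conj μ * μ))))
  have hRt : Tendsto (fun r : ℝ => (1 - ‖μ‖ ^ 2) ^ 2 * (M * ‖Λ‖ * (‖q - φ (r * R)‖ / R)))
      (𝓝[<] 1) (𝓝 ((1 - ‖μ‖ ^ 2) ^ 2 * (M * ‖Λ‖ * (‖q - q‖ / R)))) :=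
    (((hw3.const_sub q).norm.div_const R).const_mul _).const_mul _
  rw [sub_self, norm_zero, zero_div, mul_zero, mul_zero] at hRt
  rw [← hdw]
  refine le_of_tendsto_of_tendsto hL hRt ?_
  filter_upwards [Ioo_mem_nhdsLT (zero_lt_one (α := ℝ))] with r hr
  exact key r hr

end IsExtremalFunctional

end Variation

/-! ### From the extremal functional to a dual family -/

section Duality

variable {E : Type*} [NormedAddCommGroup E] [NormedSpace ℂ E]

/-- Rotation of a disc about an interior point. -/
theorem exists_rotation {D : Set E} {φ : ℂ → E} (hφ : DifferentiableOn ℂ φ (ball 0 1))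
    (hφm : MapsTo φ (ball 0 1) D) {μ : ℂ} (hμ : μ ∈ ball (0 : ℂ) 1) {ω : ℂ} (hω : ‖ω‖ = 1) :
    ∃ g : ℂ → E, DifferentiableOn ℂ g (ball 0 1) ∧ MapsTo g (ball 0 1) D ∧ g μ = φ μ ∧
      deriv g μ = ω • deriv φ μ := by
  have hμ1 := mem_ball_zero_iff.1 hμ
  have hnμ : ‖-μ‖ < 1 := by rwa [norm_neg]
  have hnμb : -μ ∈ ball (0 : ℂ) 1 := mem_ball_zero_iff.2 hnμ
  have hrot : MapsTo (fun l => ω * l) (ball (0 : ℂ) 1) (ball 0 1) := fun l hl => by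
    rw [mem_ball_zero_iff, norm_mul, hω, one_mul]
    exact mem_ball_zero_iff.1 hl
  have hA : MapsTo (fun l => discAut μ (ω * discAut (-μ) l)) (ball 0 1) (ball 0 1) := fun l hl =>
    discAut_mapsTo hμ (hrot (discAut_mapsTo hnμb hl))
  have hAd : DifferentiableOn ℂ (fun l => discAut μ (ω * discAut (-μ) l)) (ball 0 1) :=
    (differentiableOn_discAut hμ).comp ((differentiableOn_discAut hnμb).const_mul ω)
      (fun l hl => hrot (discAut_mapsTo hnμb hl))
  have h0 : discAut (-μ) μ = 0 := by
    rw [discAut]; simp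
  have hAμ : discAut μ (ω * discAut (-μ) μ) = μ := by rw [h0, mul_zero, discAut_zero]
  have hn : 1 - conj μ * μ ≠ 0 := one_sub_conj_mul_ne_zero hμ1 hμ1
  have hdA : HasDerivAt (fun l => discAut μ (ω * discAut (-μ) l)) ω μ := by
    have h1 : HasDerivAt (discAut (-μ)) (1 - conj μ * μ)⁻¹ μ := by
      refine (hasDerivAt_discAut hnμ hμ1).congr_deriv ?_
      simp only [map_neg, neg_mul, mul_neg, neg_neg, ← sub_eq_add_neg]
      field_simp
    have h2 : HasDerivAt (fun l => ω * discAut (-μ) l) (ω * (1 - conj μ * μ)⁻¹) μ :=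
      h1.const_mul ω
    have h3 : HasDerivAt (discAut μ) (1 - conj μ * μ) (ω * discAut (-μ) μ) := by
      rw [h0, mul_zero]
      exact (hasDerivAt_discAut (l := 0) hμ1 (by simp)).congr_deriv (by simp)
    refine (HasDerivAt.comp μ h3 h2).congr_deriv ?_
    rw [mul_comm, mul_assoc, inv_mul_cancel₀ hn, mul_one]
  refine ⟨φ ∘ fun l => discAut μ (ω * discAut (-μ) l), hφ.comp hAd hA, hφm.comp hA, ?_, ?_⟩
  · simp [hAμ]
  · have h1 : HasDerivAt φ (deriv φ μ) (discAut μ (ω * discAut (-μ) μ)) := by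
      rw [hAμ]
      exact (hφ.differentiableAt (isOpen_ball.mem_nhds hμ)).hasDerivAt
    exact (h1.scomp μ hdA).deriv

theorem exists_unit_mul_eq_norm (z : ℂ) : ∃ ω : ℂ, ‖ω‖ = 1 ∧ ω * z = ‖z‖ := by
  by_cases hz : z = 0
  · exact ⟨1, by simp, by simp [hz]⟩
  · have hn : (‖z‖ : ℂ) ≠ 0 := by simpa using hz
    refine ⟨conj z / ‖z‖, by simp [hz], ?_⟩
    rw [div_mul_eq_mul_div, Complex.conj_mul']
    field_simp

theorem norm_le_re_of_forall_rotation {z : ℂ} (h : ∀ ω : ℂ, ‖ω‖ = 1 → (ω * z).re ≤ z.re) :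
    z = ‖z‖ := by
  obtain ⟨ω, hω, he⟩ := exists_unit_mul_eq_norm z
  have h1 := h ω hω
  rw [he, Complex.ofReal_re] at h1
  have h2 : z.re = ‖z‖ := le_antisymm (Complex.re_le_norm z) h1
  have h3 : z.im = 0 := by
    have h4 := Complex.sq_norm_sub_sq_re z
    rw [h2, sub_self] at h4
    exact pow_eq_zero_iff (two_ne_zero) |>.1 h4.symm
  exact Complex.ext (by simpa using h2) (by simpa using h3)

/-- A functional on a complex space whose real part is non-negative on a real half-space is a
non-negative multiple of the functional of the half-space. -/
theorem exists_re_eq_mul {h : E →L[ℂ] ℂ} {a : E →L[ℝ] ℝ} (ha : a ≠ 0)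
    (hpos : ∀ e, 0 ≤ a e → 0 ≤ (h e).re) : ∃ κ : ℝ, 0 ≤ κ ∧ ∀ e, (h e).re = κ * a e := by
  obtain ⟨e₀, he₀⟩ := exists_clm_pos ha
  refine ⟨(h e₀).re, hpos _ (by rw [he₀]; exact zero_le_one), fun e => ?_⟩
  have h0 : a (e - (a e : ℂ) • e₀) = 0 := by rw [map_sub, clm_real_smul, he₀]; ring
  have h1 := hpos _ h0.ge
  have h2 := hpos (-(e - (a e : ℂ) • e₀)) (by rw [map_neg, h0, neg_zero])
  rw [map_neg, Complex.neg_re] at h2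
  have h3 : (h (e - (a e : ℂ) • e₀)).re = 0 := by linarith
  rw [map_sub, map_smul, Complex.sub_re, smul_eq_mul, Complex.re_ofReal_mul] at h3
  linarith

variable [FiniteDimensional ℂ E]

/-- The transform at R evaluates Λ on ζ(1 - Rζ)e, a disc vanishing at 0 with value R(1 - R²)e at R;
`re_nonneg` makes it non-negative on the half-space of a. -/
theorem IsExtremalFunctional.exists_apply_eq {D : Set E} {a : E →L[ℝ] ℝ} {R : ℝ} {p q : E}
    {c : ℝ} {Λ : C(sphere (0 : ℂ) 1, E) →L[ℂ] ℂ} (h : IsExtremalFunctional D a R p q c Λ)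
    (ha : a ≠ 0) (hR : 0 < R) (hR1 : R < 1) (hp : p ∈ D) :
    ∃ κ : ℝ, 0 < κ ∧ ∀ e, (cauchyTransform Λ (circleDensity R) R e).re = κ * a e := by
  have hRb : (R : ℂ) ∈ ball (0 : ℂ) 1 := by
    rw [mem_ball_zero_iff, Complex.norm_real, Real.norm_of_nonneg hR.le]; exact hR1
  have hRc : (R : ℂ) ≠ 0 := by exact_mod_cast hR.ne'
  have hR2 : 0 < 1 - R ^ 2 := by nlinarith
  have hval : ∀ (e : E) (ζ : sphere (0 : ℂ) 1),
      circleSmul e (circleDensity R * cauchyKernel R) ζ = ((ζ : ℂ) * (1 - R * ζ)) • e := by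
    intro e ζ
    have hne := circle_sub_ne_zero hRb ζ
    rw [circleSmul_apply, ContinuousMap.mul_apply, cauchyKernel_apply hRb, circleDensity_apply]
    congr 1
    field_simp
  have hpos : ∀ e, 0 ≤ a e → 0 ≤ (cauchyTransform Λ (circleDensity R) R e).re := by
    intro e he
    refine h.re_nonneg hR.ne' one_lt_two (g := fun ζ : ℂ => (ζ * (1 - R * ζ)) • e) (by fun_prop)
      (by simp) ?_ (hval e)
    have : (R : ℂ) * (1 - R * R) = ((R * (1 - R ^ 2) : ℝ) : ℂ) := by push_cast; ring
    rw [this, clm_real_smul]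
    positivity
  obtain ⟨κ, hκ0, hκ⟩ := exists_re_eq_mul ha hpos
  refine ⟨κ, hκ0.lt_of_ne fun hcon => ?_, hκ⟩
  have hzero : ∀ e, cauchyTransform Λ (circleDensity R) R e = 0 := by
    intro e
    have h1 := hκ e
    have h2 := hκ (Complex.I • e)
    rw [← hcon, zero_mul] at h1 h2
    rw [map_smul, smul_eq_mul, Complex.I_mul_re, neg_eq_zero] at h2
    exact Complex.ext h1 h2
  have hconst : ∀ ζ : sphere (0 : ℂ) 1, ContinuousMap.const (sphere (0 : ℂ) 1) p ζ = p :=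
    fun _ => rfl
  have h1 := h.re_lt (ContinuousMap.const _ p) (fun _ => hp)
  obtain ⟨k, hk⟩ := exists_circle_eq (g := fun l : ℂ => (l / R) • (q - p)) one_lt_two (by fun_prop)
  have h2 := h.le_re 2 (fun l : ℂ => p + (l / (R : ℂ)) • (q - p)) one_lt_two (by fun_prop) (by simp)
    (by rw [div_self hRc, one_smul, add_sub_cancel]) (ContinuousMap.const _ p + k)
    (fun ζ => by rw [ContinuousMap.add_apply, hk]; rfl)
  have hc : ((1 : ℂ) - R ^ 2) ≠ 0 := by exact_mod_cast hR2.ne'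
  -- If κ = 0, the transform vanishes at R. The loop k of the linear disc (l/R)(q - p) differs from
  -- one of the form ζ(1 - Rζ)e by a disc vanishing at 0 and R, so Λ k = 0. Then c ≤ Re Λ(p) < c.
  have h3 : Λ (k - circleSmul (((R : ℂ) * (1 - R ^ 2))⁻¹ • (q - p))
      (circleDensity R * cauchyKernel R)) = 0 := by
    refine h.eq_zero hR.ne' one_lt_two (g := fun ζ : ℂ => (ζ / R) • (q - p) -
      (ζ * (1 - R * ζ)) • ((R : ℂ) * (1 - R ^ 2))⁻¹ • (q - p)) (by fun_prop) (by simp) ?_ ?_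
    · rw [smul_smul, div_self hRc, ← sub_smul]
      rw [← pow_two, mul_inv_cancel₀ (mul_ne_zero hRc hc), sub_self, zero_smul]
    · intro ζ
      rw [ContinuousMap.sub_apply, hk, hval]
  have h4 := hzero (((R : ℂ) * (1 - R ^ 2))⁻¹ • (q - p))
  rw [cauchyTransform, kernelFunctional_apply] at h4
  rw [map_sub, h4, sub_zero] at h3
  rw [map_add, h3, add_zero] at h2
  linarith

/-- A disc that solves the linear extremal problem "maximize `a (ψ R)` among the discs `ψ` in `D`
with `ψ 0 = p`" has a dual family, whose value at `R` is a multiple of the complexification of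
`a`. -/
theorem exists_isDualPair {D : Set E} (hD : IsOpen D) (hDc : Convex ℝ D)
    {a : E →L[ℝ] ℝ} (ha : a ≠ 0) {R : ℝ} (hR : 0 < R) (hR1 : R < 1) {φ : ℂ → E}
    (hφ : DifferentiableOn ℂ φ (ball 0 1)) (hφm : MapsTo φ (ball 0 1) D)
    (hsup : ∀ (ρ : ℝ) (ψ : ℂ → E), 1 < ρ → DifferentiableOn ℂ ψ (ball 0 ρ) →
      (∀ l ∈ closedBall (0 : ℂ) 1, ψ l ∈ D) → ψ 0 = φ 0 → a (ψ R) ≤ a (φ R)) :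
    ∃ (h : ℂ → E →L[ℂ] ℂ) (κ : ℝ), 0 < κ ∧ IsDualPair D φ h ∧ ∀ e, (h R e).re = κ * a e := by
  have hRb : (R : ℂ) ∈ ball (0 : ℂ) 1 := by
    rw [mem_ball_zero_iff, Complex.norm_real, Real.norm_of_nonneg hR.le]; exact hR1
  obtain ⟨c, Λ, hΛ⟩ := exists_isExtremalFunctional hD hDc ha hR hsup
  have hvar := fun g hg hgm μ hμ =>
    hΛ.re_variation_nonpos hDc hR hR1 hφ hφm rfl rfl (g := g) hg hgm (μ := μ) hμ
  obtain ⟨κ, hκ, hκa⟩ := hΛ.exists_apply_eq ha hR hR1 (hφm (by simp))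
  have hHd := differentiableOn_cauchyTransform Λ (circleDensity R)
  set H := cauchyTransform Λ (circleDensity R) with hH
  set N : ℂ → ℂ := fun l => H l (deriv φ l) with hN
  have hNd : DifferentiableOn ℂ N (ball 0 1) := by
    have : CompleteSpace E := FiniteDimensional.complete ℂ E
    exact hHd.clm_apply (hφ.deriv isOpen_ball)
  -- Rotating φ about μ changes only its derivative there, by a unit factor ω. The variation
  -- inequality becomes Re(ω N) ≤ Re N for all ω, so N is real and non-negative, hence constant by
  -- holomorphy.
  have hNr : ∀ μ ∈ ball (0 : ℂ) 1, N μ = ‖N μ‖ := by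
    intro μ hμ
    refine norm_le_re_of_forall_rotation fun ω hω => ?_
    obtain ⟨g, hg, hgm, hgμ, hgd⟩ := exists_rotation hφ hφm hμ hω
    have := hvar g hg hgm μ hμ
    rw [hgμ, hgd, sub_self, map_zero, map_zero, mul_zero, zero_add, add_zero, map_sub, map_smul,
      smul_eq_mul, Complex.sub_re] at this
    exact sub_nonpos.1 this
  obtain ⟨C, hC⟩ := AnalyticOnNhd.eq_const_of_im_eq_const (c₀ := 0)
    (hNd.analyticOnNhd isOpen_ball) (fun μ hμ => by rw [hNr μ hμ, Complex.ofReal_im]) isOpen_ball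
    ((convex_ball (0 : ℂ) 1).isConnected (nonempty_ball.2 one_pos))
  -- Were N(R) zero, the small affine disc through φ R with derivative εe, a e = 1, would have
  -- positive variation εκ.
  have hNR : N R ≠ 0 := by
    intro hcon
    obtain ⟨e, he⟩ := exists_clm_pos ha
    obtain ⟨δ, hδ, hball⟩ := Metric.isOpen_iff.1 hD _ (hφm hRb)
    have he0 : 0 < ‖e‖ := norm_pos_iff.2 (by rintro rfl; simp at he)
    set ε : ℝ := δ / (2 * ‖e‖) with hε
    have hε0 : 0 < ε := by positivity
    have hd : ∀ l : ℂ, HasDerivAt (fun l : ℂ => φ R + (l - R) • (ε : ℂ) • e) ((ε : ℂ) • e) l := by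
      intro l
      have := (((hasDerivAt_id l).sub_const (R : ℂ)).smul_const ((ε : ℂ) • e)).const_add (φ R)
      simpa using this
    have h1 := hvar (fun l : ℂ => φ R + (l - R) • (ε : ℂ) • e)
      (fun l _ => (hd l).differentiableAt.differentiableWithinAt) (fun l hl => by
        apply hball
        rw [mem_ball_iff_norm, add_sub_cancel_left, norm_smul, norm_smul, Complex.norm_real,
          Real.norm_of_nonneg hε0.le]
        have h2 : ‖l - R‖ < 2 := by
          calc ‖l - R‖ ≤ ‖l‖ + ‖(R : ℂ)‖ := norm_sub_le _ _
            _ < 1 + 1 := add_lt_add (mem_ball_zero_iff.1 hl) (mem_ball_zero_iff.1 hRb)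
            _ = 2 := by norm_num
        calc ‖l - R‖ * (ε * ‖e‖) < 2 * (ε * ‖e‖) := by gcongr
          _ = δ := by rw [hε]; field_simp) R hRb
    beta_reduce at h1
    rw [(hd R).deriv, sub_self, zero_smul, add_zero, sub_self, map_zero, map_zero, mul_zero,
      zero_add, add_zero, map_sub] at h1
    have h3 : H R (deriv φ R) = 0 := hcon
    rw [h3, sub_zero, map_smul, smul_eq_mul, Complex.re_ofReal_mul, hκa, he] at h1
    have : 0 < ε * (κ * 1) := by positivity
    linarith
  set C' : ℝ := ‖N R‖ with hC'
  have hC0 : 0 < C' := norm_pos_iff.2 hNR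
  have hCN : ∀ μ ∈ ball (0 : ℂ) 1, N μ = (C' : ℂ) := by
    intro μ hμ
    rw [hC μ hμ, ← hC R hRb]
    exact hNr R hRb
  have hCc : (C' : ℂ) ≠ 0 := by exact_mod_cast hC0.ne'
  have hhd : DifferentiableOn ℂ (fun l => ((C'⁻¹ : ℝ) : ℂ) • H l) (ball 0 1) := hHd.const_smul ((C'⁻¹ : ℝ) : ℂ)
  refine ⟨fun l => ((C'⁻¹ : ℝ) : ℂ) • H l, C'⁻¹ * κ, by positivity,
    ⟨hφ, hφm, hhd, ?_, ?_⟩, fun e => ?_⟩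
  · intro l hl
    have := hCN l hl
    rw [hN] at this
    beta_reduce at this
    rw [_root_.smul_apply, this, smul_eq_mul, Complex.ofReal_inv, inv_mul_cancel₀ hCc]
  · intro z hz l hl
    -- The variation inequality for the constant disc z is exactly the sign condition on `hypDiv`.
    have h1 := hvar (fun _ => z) (differentiableOn_const z) (fun _ _ => hz) l hl
    have h2 := hasDerivAt_clm_apply_sub hφ hhd z hl
    have h3 : deriv (fun l => ((C'⁻¹ : ℝ) : ℂ) • H l) l = ((C'⁻¹ : ℝ) : ℂ) • deriv H l :=
      deriv_const_smul ((C'⁻¹ : ℝ) : ℂ) (hHd.differentiableAt (isOpen_ball.mem_nhds hl))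
    have hl2 : 1 - conj l * l = ((1 - ‖l‖ ^ 2 : ℝ) : ℂ) := by
      rw [Complex.conj_mul']; push_cast; rfl
    rw [hypDiv, h2.deriv, h3]
    simp only [_root_.smul_apply, smul_eq_mul]
    rw [← mul_sub, mul_left_comm, Complex.re_ofReal_mul, Complex.re_ofReal_mul]
    have h4 : (deriv H l (z - φ l) - H l (deriv φ l)).re +
        2 * (conj l * H l (z - φ l)).re / (1 - ‖l‖ ^ 2) ≤ 0 := by
      rw [hl2] at h1
      simp only [deriv_const', zero_sub, map_neg] at h1
      have h5 : 2 * conj l / ((1 - ‖l‖ ^ 2 : ℝ) : ℂ) * H l (z - φ l) =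
          ((2 / (1 - ‖l‖ ^ 2) : ℝ) : ℂ) * (conj l * H l (z - φ l)) := by
        rw [Complex.ofReal_div, Complex.ofReal_ofNat]; ring
      rw [h5, Complex.add_re, Complex.re_ofReal_mul] at h1
      rw [sub_eq_add_neg, mul_div_right_comm]
      exact h1
    have h6 := mul_nonpos_of_nonneg_of_nonpos (inv_nonneg.2 hC0.le) h4
    refine le_of_eq_of_le ?_ h6
    ring
  · rw [_root_.smul_apply, smul_eq_mul, Complex.re_ofReal_mul, hκa, mul_assoc]

end Duality

/-! ### Existence of extremal discs -/

section ExtremalDiscs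

variable {E : Type*} [NormedAddCommGroup E] [NormedSpace ℂ E] {D : Set E}

theorem exists_add_mem_of_closedBall (hD : IsOpen D) {ρ : ℝ} (hρ : 1 < ρ) {ψ : ℂ → E}
    (hψ : DifferentiableOn ℂ ψ (ball 0 ρ)) (hm : ∀ l ∈ closedBall (0 : ℂ) 1, ψ l ∈ D) :
    ∃ δ > 0, ∀ l ∈ closedBall (0 : ℂ) 1, ∀ v, ‖v‖ < δ → ψ l + v ∈ D := by
  have hK : IsCompact (ψ '' closedBall 0 1) := (isCompact_closedBall (0 : ℂ) 1).image_of_continuousOn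
    (hψ.continuousOn.mono (closedBall_subset_ball hρ))
  obtain ⟨δ, hδ, hsub⟩ := hK.exists_thickening_subset_open hD (image_subset_iff.2 hm)
  refine ⟨δ, hδ, fun l hl v hv => hsub ?_⟩
  rw [mem_thickening_iff]
  exact ⟨ψ l, mem_image_of_mem ψ hl, by rwa [dist_eq_norm, add_sub_cancel_left]⟩

theorem exists_disc_of_mem (hD : IsOpen D) (hDc : Convex ℝ D) {p q : E} (hp : p ∈ D) (hq : q ∈ D) :
    ∃ (ψ : ℂ → E) (t : ℝ), 0 ≤ t ∧ t < 1 ∧ DifferentiableOn ℂ ψ (ball 0 1) ∧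
      MapsTo ψ (ball 0 1) D ∧ ψ 0 = p ∧ ψ t = q := by
  obtain ⟨φ, s, t, hφ, hφm, hs, ht, hφs, hφt⟩ := exists_disc_through hD hDc hp hq
  have hs1 := mem_ball_zero_iff.1 hs
  have ht1 := mem_ball_zero_iff.1 ht
  have hns : -s ∈ ball (0 : ℂ) 1 := by rw [mem_ball_zero_iff, norm_neg]; exact hs1
  have hu := mem_ball_zero_iff.1 (discAut_mapsTo hns ht)
  set u := discAut (-s) t with hu'
  obtain ⟨ω, hω, hωu⟩ := exists_unit_mul_eq_norm u
  have hω0 : ω ≠ 0 := norm_ne_zero_iff.1 (by rw [hω]; exact one_ne_zero)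
  have hrot : MapsTo (fun l => ω⁻¹ * l) (ball (0 : ℂ) 1) (ball 0 1) := fun l hl => by
    rw [mem_ball_zero_iff, norm_mul, norm_inv, hω, inv_one, one_mul]
    exact mem_ball_zero_iff.1 hl
  refine ⟨fun l => φ (discAut s (ω⁻¹ * l)), ‖u‖, norm_nonneg u, hu, ?_, ?_, ?_, ?_⟩
  · exact hφ.comp ((differentiableOn_discAut hs).comp (by fun_prop) hrot)
      (fun l hl => discAut_mapsTo hs (hrot hl))
  · exact fun l hl => hφm (discAut_mapsTo hs (hrot hl))
  · beta_reduce
    rw [mul_zero, discAut_zero, hφs]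
  · beta_reduce
    rw [← hωu, inv_mul_cancel_left₀ hω0, hu', discAut_discAut_neg hs1 ht1, hφt]

variable [FiniteDimensional ℂ E]

/-- Montel gives a limit in the closure of D; since it passes through p in D, it stays in D. -/
theorem exists_limit_disc (hD : IsOpen D) (hDb : Bornology.IsBounded D) (hDc : Convex ℝ D) {p : E}
    (hp : p ∈ D) {ψ : ℕ → ℂ → E} (hψ : ∀ k, DifferentiableOn ℂ (ψ k) (ball 0 1))
    (hψm : ∀ k, MapsTo (ψ k) (ball 0 1) D) (hψ0 : ∀ k, ψ k 0 = p) {t : ℕ → ℂ} {t₀ : ℂ}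
    (ht : Tendsto t atTop (𝓝 t₀)) (ht₀ : t₀ ∈ ball (0 : ℂ) 1) :
    ∃ (Φ : ℂ → E) (σ : ℕ → ℕ), StrictMono σ ∧ DifferentiableOn ℂ Φ (ball 0 1) ∧
      MapsTo Φ (ball 0 1) D ∧ Φ 0 = p ∧
      Tendsto (fun k => ψ (σ k) (t (σ k))) atTop (𝓝 (Φ t₀)) := by
  obtain ⟨M, hM⟩ := hDb.exists_norm_le
  obtain ⟨Φ, σ, hσ, hΦ, hlim⟩ := exists_subseq_tendstoLocallyUniformlyOn hψ
    (fun k l hl => hM _ (hψm k hl))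
  have hpt := fun l (hl : l ∈ ball (0 : ℂ) 1) => hlim.tendsto_at hl
  have hΦ0 : Φ 0 = p := by
    have := hpt 0 (by simp)
    simp only [hψ0] at this
    exact tendsto_nhds_unique this tendsto_const_nhds
  refine ⟨Φ, σ, hσ, hΦ, ?_, hΦ0, ?_⟩
  · exact mapsTo_of_mapsTo_closure hD hDc hΦ (fun l hl => mem_closure_of_tendsto (hpt l hl)
      (Eventually.of_forall fun k => hψm _ hl)) (l₀ := 0) (by simp) (by rwa [hΦ0])
  · refine hlim.tendsto_comp (hΦ.continuousOn t₀ ht₀) ht₀ ?_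
    rw [isOpen_ball.nhdsWithin_eq ht₀]
    exact ht.comp hσ.tendsto_atTop

/-- Two distinct points of a bounded convex domain lie on a disc that solves a linear extremal
problem. -/
theorem exists_extremal_disc (hD : IsOpen D) (hDb : Bornology.IsBounded D) (hDc : Convex ℝ D)
    {p q : E} (hp : p ∈ D) (hq : q ∈ D) (hpq : p ≠ q) :
    ∃ (φ : ℂ → E) (τ : ℝ) (a : E →L[ℝ] ℝ), 0 < τ ∧ τ < 1 ∧ a ≠ 0 ∧
      DifferentiableOn ℂ φ (ball 0 1) ∧ MapsTo φ (ball 0 1) D ∧ φ 0 = p ∧ φ τ = q ∧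
      ∀ (ρ : ℝ) (ψ : ℂ → E), 1 < ρ → DifferentiableOn ℂ ψ (ball 0 ρ) →
        (∀ l ∈ closedBall (0 : ℂ) 1, ψ l ∈ D) → ψ 0 = p → a (ψ τ) ≤ a q := by
  -- The extremal disc reaches q at the least possible parameter τ = inf T, attained by a
  -- normal-families limit.
  let T : Set ℝ := {t | 0 ≤ t ∧ t < 1 ∧ ∃ ψ : ℂ → E, DifferentiableOn ℂ ψ (ball 0 1) ∧
    MapsTo ψ (ball 0 1) D ∧ ψ 0 = p ∧ ψ t = q}
  have hTne : T.Nonempty := by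
    obtain ⟨ψ, t, h0, h1, h2⟩ := exists_disc_of_mem hD hDc hp hq
    exact ⟨t, h0, h1, ψ, h2⟩
  have hTb : BddBelow T := ⟨0, fun t ht => ht.1⟩
  obtain ⟨t, -, htt, htT⟩ := exists_seq_tendsto_sInf hTne hTb
  set τ := sInf T with hτ
  choose ht0 ht1 ψ hψ hψm hψ0 hψt using htT
  have hτ1 : τ < 1 := (csInf_le hTb ⟨ht0 0, ht1 0, ψ 0, hψ 0, hψm 0, hψ0 0, hψt 0⟩).trans_lt (ht1 0)
  have hτ0 : 0 ≤ τ := le_csInf hTne fun t ht => ht.1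
  have hτb : (τ : ℂ) ∈ ball (0 : ℂ) 1 := by
    rw [mem_ball_zero_iff, Complex.norm_real, Real.norm_of_nonneg hτ0]; exact hτ1
  obtain ⟨φ, σ, -, hφ, hφm, hφ0, hlim⟩ := exists_limit_disc hD hDb hDc hp hψ hψm hψ0
    ((Complex.continuous_ofReal.tendsto τ).comp htt) hτb
  have hφτ : φ τ = q := by
    simp only [Function.comp, hψt] at hlim
    exact (tendsto_nhds_unique hlim tendsto_const_nhds)
  have hτpos : 0 < τ := by
    refine hτ0.lt_of_ne fun h => hpq ?_
    rw [← hφ0, ← hφτ, ← h, Complex.ofReal_zero]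
  have hτc : (τ : ℂ) ≠ 0 := by exact_mod_cast hτpos.ne'
  let S : Set E := {x | ∃ (ρ : ℝ) (ψ : ℂ → E), 1 < ρ ∧ DifferentiableOn ℂ ψ (ball 0 ρ) ∧
    (∀ l ∈ closedBall (0 : ℂ) 1, ψ l ∈ D) ∧ ψ 0 = p ∧ ψ τ = x}
  have hSc : Convex ℝ S := by
    rintro x ⟨ρ, ψ, hρ, hψ, hm, h0, h1⟩ y ⟨ρ', ψ', hρ', hψ', hm', h0', h1'⟩ s t hs ht hst
    refine ⟨min ρ ρ', fun l => s • ψ l + t • ψ' l, lt_min hρ hρ', ?_, ?_, ?_, ?_⟩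
    · exact ((hψ.mono (ball_subset_ball (min_le_left _ _))).const_smul s).add
        ((hψ'.mono (ball_subset_ball (min_le_right _ _))).const_smul t)
    · exact fun l hl => hDc (hm l hl) (hm' l hl) hs ht hst
    · beta_reduce
      rw [h0, h0', ← add_smul, hst, one_smul]
    · beta_reduce
      rw [h1, h1']
  have hSo : IsOpen S := by
    rw [Metric.isOpen_iff]
    rintro x ⟨ρ, ψ, hρ, hψ, hm, h0, h1⟩
    obtain ⟨δ, hδ, hadd⟩ := exists_add_mem_of_closedBall hD hρ hψ hm
    refine ⟨δ * τ, by positivity, fun y hy => ⟨ρ, fun l => ψ l + (l / τ) • (y - x), hρ,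
      hψ.add (by fun_prop), fun l hl => hadd l hl _ ?_, by simp [h0], ?_⟩⟩
    · rw [mem_ball_iff_norm] at hy
      rw [norm_smul, norm_div, Complex.norm_real, Real.norm_of_nonneg hτ0, div_mul_eq_mul_div,
        div_lt_iff₀ hτpos]
      calc ‖l‖ * ‖y - x‖ ≤ 1 * ‖y - x‖ := by gcongr; exact mem_closedBall_zero_iff.1 hl
        _ < δ * τ := by rwa [one_mul]
    · beta_reduce
      rw [div_self hτc, one_smul, h1, add_sub_cancel]
  -- A disc with room around its closed image that reaches q at τ could, after a small linear
  -- correction, reach q at some s < τ. So q lies outside the open convex set S, and Hahn–Banach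
  -- supplies the functional a.
  have hqS : q ∉ S := by
    rintro ⟨ρ, ψ, hρ, hψ, hm, h0, h1⟩
    obtain ⟨δ, hδ, hadd⟩ := exists_add_mem_of_closedBall hD hρ hψ hm
    have hcont : Tendsto (fun s : ℝ => ‖q - ψ s‖ / s) (𝓝[<] τ) (𝓝 (‖q - ψ τ‖ / τ)) := by
      have h2 : ContinuousAt ψ τ := hψ.continuousOn.continuousAt
        (isOpen_ball.mem_nhds (ball_subset_ball hρ.le hτb))
      have h3 : Tendsto (fun s : ℝ => ψ s) (𝓝[<] τ) (𝓝 (ψ τ)) :=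
        (h2.tendsto.comp (Complex.continuous_ofReal.tendsto τ)).mono_left nhdsWithin_le_nhds
      exact (h3.const_sub q).norm.div (tendsto_id.mono_left nhdsWithin_le_nhds) hτpos.ne'
    rw [h1, sub_self, norm_zero, zero_div] at hcont
    obtain ⟨s, hs1, hs0, hs⟩ := ((hcont.eventually (gt_mem_nhds hδ)).and
      (Ioo_mem_nhdsLT hτpos)).exists
    have hsc : (s : ℂ) ≠ 0 := by exact_mod_cast hs0.ne'
    refine absurd (csInf_le hTb (?_ : s ∈ T)) (not_le.2 hs)
    refine ⟨hs0.le, hs.trans hτ1, fun l => ψ l + (l / s) • (q - ψ s), ?_, fun l hl => ?_, ?_, ?_⟩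
    · exact (hψ.mono (ball_subset_ball hρ.le)).add (by fun_prop)
    · refine hadd l (ball_subset_closedBall hl) _ (lt_of_le_of_lt ?_ hs1)
      rw [norm_smul, norm_div, Complex.norm_real, Real.norm_of_nonneg hs0.le, div_mul_eq_mul_div]
      gcongr
      calc ‖l‖ * ‖q - ψ s‖ ≤ 1 * ‖q - ψ s‖ := by gcongr; exact (mem_ball_zero_iff.1 hl).le
        _ = _ := one_mul _
    · simp [h0]
    · beta_reduce
      rw [div_self hsc, one_smul, add_sub_cancel]
  obtain ⟨a, ha⟩ := geometric_hahn_banach_open_point hSc hSo hqS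
  have hpS : p ∈ S := ⟨2, fun _ => p, one_lt_two, differentiableOn_const p, fun _ _ => hp, rfl, rfl⟩
  refine ⟨φ, τ, a, hτpos, hτ1, ?_, hφ, hφm, hφ0, hφτ, fun ρ ψ hρ hψ hm h0 =>
    (ha _ ⟨ρ, ψ, hρ, hψ, hm, h0, rfl⟩).le⟩
  rintro rfl
  simpa using ha p hpS

/-- The left inverse of a disc that is defined by a dual family. -/
theorem IsDualPair.exists_leftInverse {f : ℂ → E} {h : ℂ → E →L[ℂ] ℂ} (hp : IsDualPair D f h)
    (hD : IsOpen D) (hDb : Bornology.IsBounded D) :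
    ∃ H : E → ℂ, MapsTo H D (ball 0 1) ∧ (∀ z ∈ D, h (H z) (z - f (H z)) = 0) ∧
      DifferentiableOn ℂ H D ∧ (∀ l ∈ ball (0 : ℂ) 1, H (f l) = l) ∧
      ∀ l ∈ ball (0 : ℂ) 1, fderiv ℂ H (f l) = h l := by
  have : CompleteSpace E := FiniteDimensional.complete ℂ E
  have hex : ∀ z, ∃ l, z ∈ D → l ∈ ball (0 : ℂ) 1 ∧ h l (z - f l) = 0 := by
    intro z
    by_cases hz : z ∈ D
    · obtain ⟨l, hl⟩ := (hp.existsUnique_zero hD hDb hz).exists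
      exact ⟨l, fun _ => hl⟩
    · exact ⟨0, fun h => absurd h hz⟩
  choose H hH using hex
  have hm : MapsTo H D (ball 0 1) := fun z hz => (hH z hz).1
  have h0 : ∀ z ∈ D, h (H z) (z - f (H z)) = 0 := fun z hz => (hH z hz).2
  exact ⟨H, hm, h0, fun z hz => (hp.differentiableAt_of_zero hD hDb hm h0 hz).differentiableWithinAt,
    fun l hl => hp.apply_self_eq_zero hD hDb hm h0 hl, fun l hl => hp.fderiv_eq hD hDb hm h0 hl⟩

end ExtremalDiscs

/-! ### Kobayashi balls described by single discs -/

section KobayashiBalls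

variable {n : ℕ} {D : Set (EuclideanSpace ℂ (Fin n))} {p q : EuclideanSpace ℂ (Fin n)} {R : ℝ}

/-- An extremal disc from p to z has a dual family, hence a left inverse H. Contraction under H
gives τ = |H z| < R, so chains do no better than this one disc. -/
theorem exists_disc_of_mem_kobayashiBall (hD : IsOpen D) (hDb : Bornology.IsBounded D)
    (hDc : Convex ℝ D) (hp : p ∈ D) (hR : 0 < R) {z : EuclideanSpace ℂ (Fin n)}
    (hz : z ∈ kobayashiBall D p R) :
    ∃ (ψ : ℂ → EuclideanSpace ℂ (Fin n)) (τ : ℝ), 0 ≤ τ ∧ τ < R ∧ τ < 1 ∧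
      DifferentiableOn ℂ ψ (ball 0 1) ∧ MapsTo ψ (ball 0 1) D ∧ ψ 0 = p ∧ ψ τ = z := by
  by_cases hpz : p = z
  · exact ⟨fun _ => p, 0, le_rfl, hR, zero_lt_one, differentiableOn_const p, fun _ _ => hp, rfl, hpz⟩
  obtain ⟨φ, τ, a, hτ0, hτ1, ha, hφ, hφm, hφ0, hφτ, hsup⟩ :=
    exists_extremal_disc hD hDb hDc hp hz.1 hpz
  have hτb : (τ : ℂ) ∈ ball (0 : ℂ) 1 := by
    rw [mem_ball_zero_iff, Complex.norm_real, Real.norm_of_nonneg hτ0.le]; exact hτ1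
  obtain ⟨h, κ, hκ, hdual, -⟩ := exists_isDualPair hD hDc ha hτ0 hτ1 hφ hφm (by rwa [hφ0, hφτ])
  obtain ⟨H, hHm, -, hHd, hHf, -⟩ := hdual.exists_leftInverse hD hDb
  have hHp : H p = 0 := by rw [← hφ0, hHf 0 (by simp)]
  have := norm_lt_of_mem_kobayashiBall hD hDc hHd hHm hp hHp hz
  rw [← hφτ, hHf _ hτb, Complex.norm_real, Real.norm_of_nonneg hτ0.le] at this
  exact ⟨φ, τ, hτ0.le, this, hτ1, hφ, hφm, hφ0, hφτ⟩

/-- A boundary point of a Kobayashi ball of radius `R` about `p` is reached at the point `R` by a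
holomorphic disc that starts at `p`. -/
theorem exists_disc_of_mem_frontier (hD : IsOpen D) (hDb : Bornology.IsBounded D)
    (hDc : Convex ℝ D) (hp : p ∈ D) (hR : 0 < R) (hR1 : R < 1)
    (hq : q ∈ frontier (kobayashiBall D p R)) :
    ∃ φ : ℂ → EuclideanSpace ℂ (Fin n), DifferentiableOn ℂ φ (ball 0 1) ∧
      MapsTo φ (ball 0 1) D ∧ φ 0 = p ∧ φ R = q := by
  obtain ⟨z, hz, hzq⟩ := mem_closure_iff_seq_limit.1 (frontier_subset_closure hq)
  choose ψ τ hτ0 hτR hτ1 hψ hψm hψ0 hψτ using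
    fun k => exists_disc_of_mem_kobayashiBall hD hDb hDc hp hR (hz k)
  obtain ⟨t, ⟨ht0, htR⟩, σ, hσ, ht⟩ := (isCompact_Icc (a := 0) (b := R)).tendsto_subseq
    (fun k => ⟨hτ0 k, (hτR k).le⟩)
  have htb : (t : ℂ) ∈ ball (0 : ℂ) 1 := by
    rw [mem_ball_zero_iff, Complex.norm_real, Real.norm_of_nonneg ht0]; linarith
  obtain ⟨Φ, σ', hσ', hΦ, hΦm, hΦ0, hlim⟩ := exists_limit_disc hD hDb hDc hp
    (fun k => hψ (σ k)) (fun k => hψm (σ k)) (fun k => hψ0 (σ k))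
    ((Complex.continuous_ofReal.tendsto t).comp ht) htb
  have hΦt : Φ t = q := by
    simp only [Function.comp, hψτ] at hlim
    exact tendsto_nhds_unique hlim (hzq.comp (hσ.tendsto_atTop.comp hσ'.tendsto_atTop))
  rcases htR.lt_or_eq with hlt | heq
  -- If q is reached at t < R, reparametrise Φ so that q is reached at some s in (t, R). The image
  -- of the closed disc is then compact in D, and linear corrections reach a whole neighbourhood of
  -- q, making q interior.
  · exfalso
    obtain ⟨s, hts, hsR⟩ := exists_between hlt
    have hs0 : 0 < s := ht0.trans_lt hts
    have hsc : (s : ℂ) ≠ 0 := by exact_mod_cast hs0.ne'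
    have hρ : 1 < 2 / (1 + t / s) := by
      rw [lt_div_iff₀ (by positivity)]
      have : t / s < 1 := (div_lt_one hs0).2 hts
      linarith
    have hmap : MapsTo (fun l : ℂ => (t / s : ℂ) * l) (ball 0 (2 / (1 + t / s))) (ball 0 1) := by
      intro l hl
      rw [mem_ball_zero_iff, lt_div_iff₀ (by positivity)] at hl
      rw [mem_ball_zero_iff, norm_mul, norm_div, Complex.norm_real, Complex.norm_real,
        Real.norm_of_nonneg ht0, Real.norm_of_nonneg hs0.le]
      have h1 : t / s < 1 := (div_lt_one hs0).2 hts
      have h2 : 0 ≤ t / s := by positivity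
      nlinarith [norm_nonneg l]
    have hd : DifferentiableOn ℂ (fun l : ℂ => Φ ((t / s : ℂ) * l)) (ball 0 (2 / (1 + t / s))) :=
      hΦ.comp (by fun_prop) hmap
    obtain ⟨δ, hδ, hadd⟩ := exists_add_mem_of_closedBall hD hρ hd
      (fun l hl => hΦm (hmap (closedBall_subset_ball hρ hl)))
    apply hq.2
    rw [mem_interior_iff_mem_nhds, Metric.mem_nhds_iff]
    refine ⟨δ * s, by positivity, fun y hy => ?_⟩
    rw [mem_ball_iff_norm] at hy
    have hmem := mem_kobayashiBall_of_disc (D := D) (R := R) (t := s)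
      (φ := fun l : ℂ => Φ ((t / s : ℂ) * l) + (l / s) • (y - q))
      ((hd.mono (ball_subset_ball hρ.le)).add (by fun_prop))
      (fun l hl => hadd l (ball_subset_closedBall hl) _ (by
        rw [norm_smul, norm_div, Complex.norm_real, Real.norm_of_nonneg hs0.le, div_mul_eq_mul_div,
          div_lt_iff₀ hs0]
        calc ‖l‖ * ‖y - q‖ ≤ 1 * ‖y - q‖ := by gcongr; exact (mem_ball_zero_iff.1 hl).le
          _ < δ * s := by rwa [one_mul]))
      (by
        rw [mem_ball_zero_iff, Complex.norm_real, Real.norm_of_nonneg hs0.le]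
        exact hsR.trans hR1)
      (by rwa [Complex.norm_real, Real.norm_of_nonneg hs0.le])
    beta_reduce at hmem
    rwa [div_mul_cancel₀ _ hsc, hΦt, div_self hsc, one_smul, add_sub_cancel, zero_div, zero_smul,
      mul_zero, hΦ0, add_zero] at hmem
  · exact ⟨Φ, hΦ, hΦm, hΦ0, by rw [← heq, hΦt]⟩

theorem apply_disc_le_of_supporting (hR : 0 < R) (hR1 : R < 1)
    {a : EuclideanSpace ℂ (Fin n) →L[ℝ] ℝ} (ha : ∀ z ∈ kobayashiBall D p R, a z ≤ a q)
    {ψ : ℂ → EuclideanSpace ℂ (Fin n)} (hψ : DifferentiableOn ℂ ψ (ball 0 1))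
    (hψm : MapsTo ψ (ball 0 1) D) (hψ0 : ψ 0 = p) : a (ψ R) ≤ a q := by
  have hRb : (R : ℂ) ∈ ball (0 : ℂ) 1 := by
    rw [mem_ball_zero_iff, Complex.norm_real, Real.norm_of_nonneg hR.le]; exact hR1
  have hc : Tendsto (fun t : ℝ => a (ψ t)) (𝓝[<] R) (𝓝 (a (ψ R))) :=
    (a.continuous.tendsto _).comp ((hψ.continuousOn.continuousAt
      (isOpen_ball.mem_nhds hRb)).tendsto.comp
        ((Complex.continuous_ofReal.tendsto R).mono_left nhdsWithin_le_nhds))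
  refine le_of_tendsto hc ?_
  filter_upwards [Ioo_mem_nhdsLT hR] with t ht
  apply ha
  rw [← hψ0]
  apply mem_kobayashiBall_of_disc hψ hψm
  · rw [mem_ball_zero_iff, Complex.norm_real, Real.norm_of_nonneg ht.1.le]
    exact ht.2.trans hR1
  · rw [Complex.norm_real, Real.norm_of_nonneg ht.1.le]
    exact ht.2

end KobayashiBalls

/-! ### Boundary behaviour of a disc and its dual family -/

section BoundaryBehaviour

variable {E : Type*} [NormedAddCommGroup E] [NormedSpace ℂ E] {D : Set E}
  {f : ℂ → E} {h : ℂ → E →L[ℂ] ℂ}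

theorem re_lt_of_supporting (hD : IsOpen D) {b : E →L[ℂ] ℂ} (hb : b ≠ 0) {w z : E}
    (hbw : ∀ z ∈ D, (b z).re ≤ (b w).re) (hz : z ∈ D) : (b z).re < (b w).re := by
  obtain ⟨e, he⟩ : ∃ e, b e ≠ 0 := by
    by_contra! hcon
    exact hb (ContinuousLinearMap.ext hcon)
  have hc : Tendsto (fun t : ℝ => z + (t : ℂ) • (b e)⁻¹ • e) (𝓝[>] 0) (𝓝 z) := by
    have : Tendsto (fun t : ℝ => z + (t : ℂ) • (b e)⁻¹ • e) (𝓝 0)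
        (𝓝 (z + ((0 : ℝ) : ℂ) • (b e)⁻¹ • e)) := Continuous.tendsto (by fun_prop) 0
    rw [Complex.ofReal_zero, zero_smul, add_zero] at this
    exact this.mono_left nhdsWithin_le_nhds
  obtain ⟨t, ht, ht0⟩ := ((hc.eventually (hD.mem_nhds hz)).and self_mem_nhdsWithin).exists
  have h1 := hbw _ ht
  rw [map_add, map_smul, map_smul, smul_eq_mul, smul_eq_mul, inv_mul_cancel₀ he, mul_one,
    Complex.add_re, Complex.ofReal_re] at h1
  have : (0 : ℝ) < t := ht0
  linarith

/-- At a point of the boundary, a supporting functional of norm one is unique. -/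
def UniqueUnitSupport (D : Set E) : Prop :=
  ∀ w ∈ frontier D, ∀ b b' : E →L[ℂ] ℂ, ‖b‖ = 1 → ‖b'‖ = 1 → (∀ z ∈ D, (b z).re ≤ (b w).re) →
    (∀ z ∈ D, (b' z).re ≤ (b' w).re) → b = b'

/-- A complex functional that supports `D` attains its maximal real part on the closure of `D` at one
point only. -/
def ExposedBoundary (D : Set E) : Prop :=
  ∀ w ∈ frontier D, ∀ w' ∈ closure D, ∀ b : E →L[ℂ] ℂ, b ≠ 0 →
    (∀ z ∈ D, (b z).re ≤ (b w).re) → (b w').re = (b w).re → w' = w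

/-- Recentre f at l k by disc automorphisms and pass to a limit Φ. Exposedness and the maximum
principle make Φ constant, and its derivative at 0 is the limit of (1 - |l|²) f'(l). -/
theorem IsDualPair.exists_subseq_boundary [FiniteDimensional ℂ E]
    (hp : IsDualPair D f h) (hD : IsOpen D)
    (hDb : Bornology.IsBounded D) (hDc : Convex ℝ D) (hC : ExposedBoundary D) {l : ℕ → ℂ}
    (hl : ∀ k, l k ∈ ball (0 : ℂ) 1) (hl1 : Tendsto (fun k => ‖l k‖) atTop (𝓝 1)) :
    ∃ (ζ : ℂ) (w : E) (σ : ℕ → ℕ), StrictMono σ ∧ ‖ζ‖ = 1 ∧ w ∈ frontier D ∧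
      Tendsto (fun k => l (σ k)) atTop (𝓝 ζ) ∧ Tendsto (fun k => f (l (σ k))) atTop (𝓝 w) ∧
      Tendsto (fun k => (1 - ‖l (σ k)‖ ^ 2) * ‖deriv f (l (σ k))‖) atTop (𝓝 0) := by
  obtain ⟨M, hM⟩ := hDb.exists_norm_le
  obtain ⟨ζ, -, σ₁, hσ₁, hζ⟩ := (isCompact_closedBall (0 : ℂ) 1).tendsto_subseq
    (fun k => ball_subset_closedBall (hl k))
  have hζ1 : ‖ζ‖ = 1 := tendsto_nhds_unique hζ.norm (hl1.comp hσ₁.tendsto_atTop)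
  have hg : ∀ k, DifferentiableOn ℂ (fun x => f (discAut (l (σ₁ k)) x)) (ball 0 1) := fun k =>
    hp.holo.comp (differentiableOn_discAut (hl _)) (discAut_mapsTo (hl _))
  have hgm : ∀ k, MapsTo (fun x => f (discAut (l (σ₁ k)) x)) (ball 0 1) D := fun k x hx =>
    hp.mapsTo (discAut_mapsTo (hl _) hx)
  obtain ⟨Φ, σ₂, hσ₂, hΦ, hlim⟩ := exists_subseq_tendstoLocallyUniformlyOn hg
    (fun k x hx => hM _ (hgm k hx))
  have hpt := fun x (hx : x ∈ ball (0 : ℂ) 1) => hlim.tendsto_at hx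
  have hlimf : Tendsto (fun k => f (l (σ₁ (σ₂ k)))) atTop (𝓝 (Φ 0)) := by
    have := hpt 0 (by simp)
    simpa only [discAut_zero] using this
  have hζ' : Tendsto (fun k => l (σ₁ (σ₂ k))) atTop (𝓝 ζ) := hζ.comp hσ₂.tendsto_atTop
  have hcl : ∀ x ∈ ball (0 : ℂ) 1, Φ x ∈ closure D := fun x hx =>
    mem_closure_of_tendsto (hpt x hx) (Eventually.of_forall fun k => hgm _ hx)
  -- Otherwise the left inverse would be continuous at Φ 0 and take there the value ζ of modulus 1.
  have hfr : Φ 0 ∈ frontier D := by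
    rw [hD.frontier_eq]
    refine ⟨hcl 0 (by simp), fun hmem => ?_⟩
    obtain ⟨H, hHm, -, hHd, hHf, -⟩ := hp.exists_leftInverse hD hDb
    have h1 : Tendsto (fun k => H (f (l (σ₁ (σ₂ k))))) atTop (𝓝 (H (Φ 0))) :=
      (hHd.continuousOn.continuousAt (hD.mem_nhds hmem)).tendsto.comp hlimf
    simp only [hHf _ (hl _)] at h1
    have h2 := mem_ball_zero_iff.1 (hHm hmem)
    rw [tendsto_nhds_unique h1 hζ', hζ1] at h2
    exact lt_irrefl _ h2
  have hnot : Φ 0 ∉ D := by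
    rw [hD.frontier_eq] at hfr
    exact hfr.2
  obtain ⟨b, hb⟩ := RCLike.geometric_hahn_banach_open_point (𝕜 := ℂ) hDc hD hnot
  have hbs : ∀ z ∈ D, (b z).re ≤ (b (Φ 0)).re := fun z hz => (hb z hz).le
  have hb0 : b ≠ 0 := by
    rintro rfl
    simpa using hb _ (hp.mapsTo (show (0 : ℂ) ∈ ball 0 1 by simp))
  have hbcl : ∀ z ∈ closure D, (b z).re ≤ (b (Φ 0)).re := fun z hz =>
    closure_minimal hbs (isClosed_le (Complex.continuous_re.comp b.continuous) continuous_const) hz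
  have hconst : ∀ x ∈ ball (0 : ℂ) 1, Φ x = Φ 0 := fun x hx =>
    hC _ hfr _ (hcl x hx) b hb0 hbs
      (re_clm_eq_of_isMax hΦ b (by simp) (fun y hy => hbcl _ (hcl y hy)) hx)
  have hdΦ : deriv Φ 0 = 0 := by
    have h1 : Φ =ᶠ[𝓝 0] fun _ => Φ 0 := by
      filter_upwards [isOpen_ball.mem_nhds (show (0 : ℂ) ∈ ball 0 1 by simp)] with x hx
      exact hconst x hx
    rw [h1.deriv_eq, deriv_const]
  have hd := (hlim.deriv (Eventually.of_forall fun k => hg _) isOpen_ball).tendsto_at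
    (show (0 : ℂ) ∈ ball 0 1 by simp)
  rw [hdΦ] at hd
  refine ⟨ζ, Φ 0, σ₁ ∘ σ₂, hσ₁.comp hσ₂, hζ1, hfr, hζ', hlimf, ?_⟩
  refine hd.norm.congr' ?_ |>.trans_eq ?_
  · refine Eventually.of_forall fun k => ?_
    have hk := mem_ball_zero_iff.1 (hl (σ₁ (σ₂ k)))
    have h1 := hasDerivAt_discAut (l := 0) hk (by simp)
    have h2 : HasDerivAt f (deriv f (l (σ₁ (σ₂ k)))) (discAut (l (σ₁ (σ₂ k))) 0) := by
      rw [discAut_zero]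
      exact (hp.holo.differentiableAt (isOpen_ball.mem_nhds (hl _))).hasDerivAt
    have h3 : ‖l (σ₁ (σ₂ k))‖ ^ 2 < 1 := by nlinarith [norm_nonneg (l (σ₁ (σ₂ k)))]
    have h4 := (h2.scomp (0 : ℂ) h1).deriv
    simp only [Function.comp_def] at h4 ⊢
    rw [h4, norm_smul, Complex.conj_mul', mul_zero, add_zero, one_pow, div_one]
    congr 1
    have h5 : (1 : ℂ) - (‖l (σ₁ (σ₂ k))‖ : ℂ) ^ 2 = ((1 - ‖l (σ₁ (σ₂ k))‖ ^ 2 : ℝ) : ℂ) := by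
      push_cast; rfl
    rw [h5, Complex.norm_real, Real.norm_of_nonneg (by linarith)]
  · rw [norm_zero]

/-- The dual family `h`, rescaled so that `lam ↦ k lam (f lam - f 0)` is the identity. -/
noncomputable def normalizedDual (f : ℂ → E) (h : ℂ → E →L[ℂ] ℂ) (l : ℂ) : E →L[ℂ] ℂ :=
  (dslope (fun l => h l (f l - f 0)) 0 l)⁻¹ • h l

theorem mul_dslope_eq (f : ℂ → E) (h : ℂ → E →L[ℂ] ℂ) (l : ℂ) :
    l * dslope (fun l => h l (f l - f 0)) 0 l = h l (f l - f 0) := by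
  have := sub_smul_dslope (fun l => h l (f l - f 0)) 0 l
  simpa using this

theorem IsDualPair.dual_ne_zero (hp : IsDualPair D f h) {l : ℂ} (hl : l ∈ ball (0 : ℂ) 1) :
    h l ≠ 0 := by
  intro h0
  have := hp.apply_deriv l hl
  rw [h0] at this
  simp at this

theorem IsDualPair.differentiableOn_dslope (hp : IsDualPair D f h) :
    DifferentiableOn ℂ (dslope (fun l => h l (f l - f 0)) 0) (ball 0 1) := by
  refine (Complex.differentiableOn_dslope (isOpen_ball.mem_nhds (by simp))).2 ?_
  exact hp.holo_dual.clm_apply (hp.holo.sub_const _)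

/-- Off the origin a zero would be a second zero of the field belonging to z = f 0. At the origin
the derivative is h 0 (f' 0) = 1. -/
theorem IsDualPair.dslope_ne_zero (hp : IsDualPair D f h) (hD : IsOpen D)
    (hDb : Bornology.IsBounded D) {l : ℂ} (hl : l ∈ ball (0 : ℂ) 1) :
    dslope (fun l => h l (f l - f 0)) 0 l ≠ 0 := by
  have h00 : (0 : ℂ) ∈ ball (0 : ℂ) 1 := by simp
  by_cases h0 : l = 0
  · rw [h0, dslope_same]
    have h1 := (hasDerivAt_clm_apply_sub hp.holo hp.holo_dual (f 0) h00).neg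
    have h2 : HasDerivAt (fun l => h l (f l - f 0)) (h 0 (deriv f 0)) 0 := by
      convert! h1 using 1
      · ext l
        rw [Pi.neg_apply, ← map_neg, neg_sub]
      · simp
    rw [h2.deriv, hp.apply_deriv 0 h00]
    exact one_ne_zero
  · intro hcon
    have h1 := mul_dslope_eq f h l
    rw [hcon, mul_zero, ← neg_sub, map_neg, eq_comm, neg_eq_zero] at h1
    exact h0 ((hp.existsUnique_zero hD hDb (hp.mapsTo h00)).unique ⟨hl, h1⟩ ⟨h00, by simp⟩)

theorem IsDualPair.differentiableOn_normalizedDual (hp : IsDualPair D f h) (hD : IsOpen D)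
    (hDb : Bornology.IsBounded D) : DifferentiableOn ℂ (normalizedDual f h) (ball 0 1) :=
  (hp.differentiableOn_dslope.inv fun _ hl => hp.dslope_ne_zero hD hDb hl).smul hp.holo_dual

theorem IsDualPair.re_le (hp : IsDualPair D f h) {z : E} (hz : z ∈ D) {l : ℂ}
    (hl : l ∈ ball (0 : ℂ) 1) :
    (conj l * h l (z - f l)).re ≤ (1 - ‖l‖ ^ 2) * (conj l * h 0 (z - f 0)).re := by
  have := re_conj_mul_le_of_hypDiv_le (hp.differentiableOn_apply z) le_rfl
    (fun m hm => by rw [neg_zero]; exact hp.hypDiv_nonpos z hz m hm) hl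
  simpa using this

/-- The unit covectors h/‖h‖, multiplied by conj l, subconverge to some b. From 1 = h(f') ≤ ‖h‖‖f'‖,
the error in `re_le` after division by ‖h‖ is at most a constant times (1 - |l|²)‖f'‖ → 0, so b
supports D at w. The normalisation cancels the uncontrolled factor ‖h‖. -/
theorem IsDualPair.exists_subseq_normalizedDual [FiniteDimensional ℂ E]
    (hp : IsDualPair D f h) (hD : IsOpen D)
    {l : ℕ → ℂ} (hl : ∀ k, l k ∈ ball (0 : ℂ) 1) {ζ : ℂ} {w : E} (hζ1 : ‖ζ‖ = 1)
    (hζ : Tendsto l atTop (𝓝 ζ)) (hw : Tendsto (fun k => f (l k)) atTop (𝓝 w))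
    (hd : Tendsto (fun k => (1 - ‖l k‖ ^ 2) * ‖deriv f (l k)‖) atTop (𝓝 0)) :
    ∃ (b : E →L[ℂ] ℂ) (σ : ℕ → ℕ), StrictMono σ ∧ ‖b‖ = 1 ∧ (∀ z ∈ D, (b z).re ≤ (b w).re) ∧
      Tendsto (fun k => normalizedDual f h (l (σ k))) atTop (𝓝 ((ζ / b (w - f 0)) • b)) := by
  have : ProperSpace (E →L[ℂ] ℂ) := FiniteDimensional.proper ℂ _
  have h00 : (0 : ℂ) ∈ ball (0 : ℂ) 1 := by simp
  let B : ℕ → E →L[ℂ] ℂ := fun k => (conj (l k) / ‖h (l k)‖) • h (l k)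
  have hh0 : ∀ k, 0 < ‖h (l k)‖ := fun k => norm_pos_iff.2 (hp.dual_ne_zero (hl k))
  have hBn : ∀ k, ‖B k‖ = ‖l k‖ := by
    intro k
    rw [norm_smul, norm_div, RCLike.norm_conj, Complex.norm_real, norm_norm,
      div_mul_cancel₀ _ (hh0 k).ne']
  obtain ⟨b, -, σ, hσ, hb⟩ := (isCompact_closedBall (0 : E →L[ℂ] ℂ) 1).tendsto_subseq (x := B)
    (fun k => by rw [mem_closedBall_zero_iff, hBn]; exact (mem_ball_zero_iff.1 (hl k)).le)
  have hlσ : Tendsto (fun k => l (σ k)) atTop (𝓝 ζ) := hζ.comp hσ.tendsto_atTop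
  have hwσ : Tendsto (fun k => f (l (σ k))) atTop (𝓝 w) := hw.comp hσ.tendsto_atTop
  have hb1 : ‖b‖ = 1 := by
    have h1 : Tendsto (fun k => ‖B (σ k)‖) atTop (𝓝 ‖b‖) := hb.norm
    simp only [hBn] at h1
    rw [← hζ1]
    exact tendsto_nhds_unique h1 hlσ.norm
  have hb0 : b ≠ 0 := norm_ne_zero_iff.1 (by rw [hb1]; exact one_ne_zero)
  have happ : ∀ {x : ℕ → E} {y : E}, Tendsto x atTop (𝓝 y) →
      Tendsto (fun k => B (σ k) (x k)) atTop (𝓝 (b y)) := fun hx =>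
    (isBoundedBilinearMap_apply.continuous.tendsto (b, _)).comp (hb.prodMk_nhds hx)
  have hsup : ∀ z ∈ D, (b z).re ≤ (b w).re := by
    intro z hz
    have h1 : Tendsto (fun k => (B (σ k) (z - f (l (σ k)))).re) atTop (𝓝 (b (z - w)).re) :=
      (Complex.continuous_re.tendsto _).comp (happ (hwσ.const_sub z))
    have h2 : Tendsto (fun k => (1 - ‖l (σ k)‖ ^ 2) * ‖deriv f (l (σ k))‖ *
        ‖h 0 (z - f 0)‖) atTop (𝓝 (0 * ‖h 0 (z - f 0)‖)) :=
      (hd.comp hσ.tendsto_atTop).mul_const _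
    rw [zero_mul] at h2
    have h3 : (b (z - w)).re ≤ 0 := by
      refine le_of_tendsto_of_tendsto' h1 h2 fun k => ?_
      have hk := hl (σ k)
      have hk1 := mem_ball_zero_iff.1 hk
      have hkn := norm_nonneg (l (σ k))
      have hks : 0 < 1 - ‖l (σ k)‖ ^ 2 := by nlinarith
      have hhk := hh0 (σ k)
      have h4 : 1 ≤ ‖h (l (σ k))‖ * ‖deriv f (l (σ k))‖ := by
        have := (h (l (σ k))).le_opNorm (deriv f (l (σ k)))
        rwa [hp.apply_deriv _ hk, norm_one] at this
      have h5 : (B (σ k) (z - f (l (σ k)))).re =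
          ‖h (l (σ k))‖⁻¹ * (conj (l (σ k)) * h (l (σ k)) (z - f (l (σ k)))).re := by
        rw [← Complex.re_ofReal_mul]
        congr 1
        simp only [B, _root_.smul_apply, smul_eq_mul, Complex.ofReal_inv]
        ring
      rw [h5, inv_mul_le_iff₀ hhk]
      calc _ ≤ (1 - ‖l (σ k)‖ ^ 2) * (conj (l (σ k)) * h 0 (z - f 0)).re := hp.re_le hz hk
        _ ≤ (1 - ‖l (σ k)‖ ^ 2) * ‖h 0 (z - f 0)‖ := by
          gcongr
          refine (Complex.re_le_norm _).trans ?_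
          rw [norm_mul, RCLike.norm_conj]
          exact mul_le_of_le_one_left (norm_nonneg _) hk1.le
        _ = 1 * ((1 - ‖l (σ k)‖ ^ 2) * ‖h 0 (z - f 0)‖) := (one_mul _).symm
        _ ≤ (‖h (l (σ k))‖ * ‖deriv f (l (σ k))‖) *
            ((1 - ‖l (σ k)‖ ^ 2) * ‖h 0 (z - f 0)‖) := by gcongr
        _ = _ := by ring
    rw [map_sub, Complex.sub_re] at h3
    linarith
  have hbw : b (w - f 0) ≠ 0 := by
    intro hcon
    have h1 := re_lt_of_supporting hD hb0 hsup (hp.mapsTo h00)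
    rw [map_sub, sub_eq_zero] at hcon
    rw [hcon] at h1
    exact lt_irrefl _ h1
  refine ⟨b, σ, hσ, hb1, hsup, ?_⟩
  have hlim : Tendsto (fun k => (l (σ k) / B (σ k) (f (l (σ k)) - f 0)) • B (σ k)) atTop
      (𝓝 ((ζ / b (w - f 0)) • b)) :=
    (hlσ.div (happ (hwσ.sub_const (f 0))) hbw).smul hb
  refine hlim.congr' ?_
  have hne : ∀ᶠ k in atTop, l (σ k) ≠ 0 :=
    hlσ.eventually_ne (norm_ne_zero_iff.1 (by rw [hζ1]; exact one_ne_zero))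
  filter_upwards [hne] with k hk
  have hhc : (‖h (l (σ k))‖ : ℂ) ≠ 0 := by exact_mod_cast (hh0 (σ k)).ne'
  have hck : conj (l (σ k)) ≠ 0 := (map_ne_zero _).2 hk
  have h1 := mul_dslope_eq f h (l (σ k))
  simp only [B, normalizedDual, smul_smul, _root_.smul_apply, smul_eq_mul]
  congr 1
  rw [← h1]
  by_cases h0 : dslope (fun l => h l (f l - f 0)) 0 (l (σ k)) = 0
  · simp only [h0, mul_zero, div_zero, zero_mul, inv_zero]
  · field_simp

end BoundaryBehaviour

/-! ### Uniqueness of the dual family -/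

section Uniqueness

variable {E : Type*} [NormedAddCommGroup E] [NormedSpace ℂ E]

/-- The maximum principle, for boundary values along sequences. -/
theorem eq_zero_of_tendsto_boundary {F : Type*} [NormedAddCommGroup F] [NormedSpace ℂ F]
    {k : ℂ → F} (hk : DifferentiableOn ℂ k (ball 0 1))
    (h : ∀ l : ℕ → ℂ, (∀ m, l m ∈ ball (0 : ℂ) 1) → Tendsto (fun m => ‖l m‖) atTop (𝓝 1) →
      ∃ σ : ℕ → ℕ, Tendsto (fun m => k (l (σ m))) atTop (𝓝 0)) {z : ℂ}
    (hz : z ∈ ball (0 : ℂ) 1) : k z = 0 := by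
  have hz1 := mem_ball_zero_iff.1 hz
  by_contra hcon
  have hε : 0 < ‖k z‖ / 2 := by have := norm_pos_iff.2 hcon; positivity
  have key : ∃ r, ‖z‖ < r ∧ r < 1 ∧ ∀ l : ℂ, ‖l‖ = r → ‖k l‖ ≤ ‖k z‖ / 2 := by
    by_contra! hno
    obtain ⟨u, -, hu, hut⟩ := exists_seq_strictMono_tendsto' hz1
    choose l hl hl' using fun m => hno (u m) (hu m).1 (hu m).2
    obtain ⟨σ, hσ⟩ := h l (fun m => by rw [mem_ball_zero_iff, hl]; exact (hu m).2)
      (by simpa only [hl] using hut)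
    obtain ⟨m, hm⟩ := (hσ.norm.eventually (gt_mem_nhds (by rw [norm_zero]; exact hε))).exists
    exact lt_asymm hm (hl' (σ m))
  obtain ⟨r, hzr, hr1, hr⟩ := key
  have hr0 : 0 < r := (norm_nonneg z).trans_lt hzr
  have := Complex.norm_le_of_forall_mem_frontier_norm_le (U := ball (0 : ℂ) r) isBounded_ball
    (f := k) (C := ‖k z‖ / 2)
    (DifferentiableOn.diffContOnCl (by
      rw [closure_ball _ hr0.ne']
      exact hk.mono (closedBall_subset_ball hr1)))
    (fun l hl => by
      rw [frontier_ball _ hr0.ne'] at hl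
      exact hr l (mem_sphere_zero_iff_norm.1 hl))
    (subset_closure (mem_ball_zero_iff.2 hzr))
  linarith

/-- In a bounded convex domain with smooth and strictly convex boundary, the dual family of a
holomorphic disc is unique. -/
theorem IsDualPair.eqOn [FiniteDimensional ℂ E] {D : Set E} {f : ℂ → E} {h h' : ℂ → E →L[ℂ] ℂ}
    (hp : IsDualPair D f h) (hp' : IsDualPair D f h') (hD : IsOpen D)
    (hDb : Bornology.IsBounded D) (hDc : Convex ℝ D) (hS : UniqueUnitSupport D)
    (hC : ExposedBoundary D) : EqOn h h' (ball 0 1) := by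
  have hk : ∀ l ∈ ball (0 : ℂ) 1, normalizedDual f h l - normalizedDual f h' l = 0 := by
    intro z hz
    refine eq_zero_of_tendsto_boundary (k := fun l => normalizedDual f h l - normalizedDual f h' l)
      ((hp.differentiableOn_normalizedDual hD hDb).sub
        (hp'.differentiableOn_normalizedDual hD hDb)) (fun l hl hl1 => ?_) hz
    obtain ⟨ζ, w, σ, hσ, hζ1, hw, hζ, hlim, hd⟩ := hp.exists_subseq_boundary hD hDb hDc hC hl hl1
    obtain ⟨b, σ₁, hσ₁, hb1, hb, hb'⟩ :=
      hp.exists_subseq_normalizedDual hD (fun k => hl (σ k)) hζ1 hζ hlim hd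
    obtain ⟨c, σ₂, hσ₂, hc1, hc, hc'⟩ :=
      hp'.exists_subseq_normalizedDual hD (fun k => hl (σ (σ₁ k))) hζ1
        (hζ.comp hσ₁.tendsto_atTop) (hlim.comp hσ₁.tendsto_atTop) (hd.comp hσ₁.tendsto_atTop)
    refine ⟨fun k => σ (σ₁ (σ₂ k)), ?_⟩
    have := (hb'.comp hσ₂.tendsto_atTop).sub hc'
    -- Both limits have the form (ζ / b(w - f 0)) b with b the one unit support at w, so their
    -- difference tends to 0.
    rw [hS w hw b c hb1 hc1 hb hc, sub_self] at this
    exact this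
  intro l hl
  have h1 := sub_eq_zero.1 (hk l hl)
  have hn := hp.dslope_ne_zero hD hDb hl
  have hn' := hp'.dslope_ne_zero hD hDb hl
  rw [normalizedDual, normalizedDual] at h1
  -- Evaluating on f' l, where both families equal 1, shows that the scaling factors agree.
  have h2 := DFunLike.congr_fun h1 (deriv f l)
  rw [_root_.smul_apply, _root_.smul_apply, hp.apply_deriv l hl, hp'.apply_deriv l hl,
    smul_eq_mul, smul_eq_mul, mul_one, mul_one] at h2
  rw [h2] at h1
  exact smul_right_injective _ (inv_ne_zero hn') h1

end Uniqueness

/-! ### Boundary geometry from the defining function -/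

section StrongConvexity

variable {E : Type*} [NormedAddCommGroup E] [NormedSpace ℂ E] {D : Set E} {r : E → ℝ}

theorem eq_zero_of_mem_frontier_sublevel {X : Type*} [TopologicalSpace X] {D : Set X} {r : X → ℝ}
    (hr : Continuous r) (hDr : D = {z | r z < 0}) {w : X} (hw : w ∈ frontier D) : r w = 0 := by
  have hD : IsOpen D := by rw [hDr]; exact isOpen_lt hr continuous_const
  rw [hD.frontier_eq] at hw
  refine le_antisymm ?_ ?_
  · exact closure_minimal (t := {z | r z ≤ 0}) (by rw [hDr]; exact fun z (hz : r z < 0) => hz.le)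
      (isClosed_le hr continuous_const) hw.1
  · by_contra! hcon
    exact hw.2 (by rw [hDr]; exact hcon)

/-- A supporting functional at a boundary point is a multiple of the differential of the defining
function. -/
theorem exists_re_eq_mul_fderiv (hr : ContDiff ℝ 2 r) (hDr : D = {z | r z < 0}) {w : E}
    (hw : w ∈ frontier D) (hdr : fderiv ℝ r w ≠ 0) {b : E →L[ℂ] ℂ} (hb0 : b ≠ 0)
    (hb : ∀ z ∈ D, (b z).re ≤ (b w).re) : ∃ κ : ℝ, 0 < κ ∧ ∀ e, (b e).re = κ * fderiv ℝ r w e := by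
  have hrw := eq_zero_of_mem_frontier_sublevel hr.continuous hDr hw
  -- If b increased in a direction v along which r decreases to first order, w + t v could not enter
  -- D for small t > 0, so r would be non-negative there.
  have hneg : ∀ v, fderiv ℝ r w v < 0 → (b v).re ≤ 0 := by
    intro v hv
    have h1 : HasDerivAt (fun t : ℝ => r (w + t • v)) (fderiv ℝ r w v) 0 := by
      have h2 : HasDerivAt (fun t : ℝ => w + t • v) v 0 := by
        simpa using ((hasDerivAt_id (0 : ℝ)).smul_const v).const_add w
      have h3 : HasFDerivAt r (fderiv ℝ r w) (w + (0 : ℝ) • v) := by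
        rw [zero_smul, add_zero]
        exact ((hr.differentiable (by norm_num)) w).hasFDerivAt
      exact h3.comp_hasDerivAt (0 : ℝ) h2
    by_contra! hcon
    have h4 := nonneg_of_hasDerivAt_of_nonneg h1 (by simp [hrw]) (fun t ht => by
      by_contra! hlt
      have h5 := hb (w + t • v) (by rw [hDr]; exact hlt)
      rw [map_add, ← Complex.coe_smul, map_smul, smul_eq_mul, Complex.add_re,
        Complex.re_ofReal_mul] at h5
      nlinarith [mul_pos ht.1 hcon])
    linarith
  obtain ⟨e₀, he₀⟩ := exists_clm_pos hdr
  have hpos : ∀ e, 0 ≤ fderiv ℝ r w e → 0 ≤ (b e).re := by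
    intro e he
    have hlim : Tendsto (fun ε : ℝ => (b (e + (ε : ℂ) • e₀)).re) (𝓝[>] 0) (𝓝 (b e).re) := by
      have : Tendsto (fun ε : ℝ => (b (e + (ε : ℂ) • e₀)).re) (𝓝 0)
          (𝓝 (b (e + ((0 : ℝ) : ℂ) • e₀)).re) := Continuous.tendsto (by fun_prop) 0
      rw [Complex.ofReal_zero, zero_smul, add_zero] at this
      exact this.mono_left nhdsWithin_le_nhds
    refine ge_of_tendsto hlim ?_
    filter_upwards [self_mem_nhdsWithin] with ε hε
    have hε : 0 < ε := hε
    have := hneg (-(e + (ε : ℂ) • e₀)) (by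
      rw [map_neg, map_add, clm_real_smul, he₀]; linarith)
    rw [map_neg, Complex.neg_re] at this
    linarith
  obtain ⟨κ, hκ0, hκ⟩ := exists_re_eq_mul hdr hpos
  refine ⟨κ, hκ0.lt_of_ne ?_, hκ⟩
  rintro rfl
  refine hb0 (ContinuousLinearMap.ext fun e => ?_)
  have h1 := hκ e
  have h2 := hκ (Complex.I • e)
  rw [zero_mul] at h1 h2
  rw [map_smul, smul_eq_mul, Complex.I_mul_re, neg_eq_zero] at h2
  exact Complex.ext h1 h2

theorem clm_ext_re {b b' : E →L[ℂ] ℂ} (h : ∀ e, (b e).re = (b' e).re) : b = b' := by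
  ext e
  have h2 := h (Complex.I • e)
  rw [map_smul, map_smul, smul_eq_mul, smul_eq_mul, Complex.I_mul_re, Complex.I_mul_re,
    neg_inj] at h2
  exact Complex.ext (h e) h2

/-- Every support is a positive multiple of the differential of r after taking real parts; the unit
norm fixes the multiple. -/
theorem uniqueUnitSupport_of_contDiff (hr : ContDiff ℝ 2 r) (hDr : D = {z | r z < 0})
    (hdr : ∀ w ∈ frontier D, fderiv ℝ r w ≠ 0) : UniqueUnitSupport D := by
  intro w hw b b' hb1 hb1' hb hb'
  obtain ⟨κ, hκ, h⟩ := exists_re_eq_mul_fderiv hr hDr hw (hdr w hw)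
    (norm_ne_zero_iff.1 (by rw [hb1]; exact one_ne_zero)) hb
  obtain ⟨κ', hκ', h'⟩ := exists_re_eq_mul_fderiv hr hDr hw (hdr w hw)
    (norm_ne_zero_iff.1 (by rw [hb1']; exact one_ne_zero)) hb'
  have h1 : (κ' : ℂ) • b = (κ : ℂ) • b' := by
    refine clm_ext_re fun e => ?_
    rw [_root_.smul_apply, _root_.smul_apply, smul_eq_mul, smul_eq_mul, Complex.re_ofReal_mul,
      Complex.re_ofReal_mul, h, h']
    ring
  have h2 : κ' = κ := by
    have := congrArg norm h1
    rwa [norm_smul, norm_smul, hb1, hb1', mul_one, mul_one, Complex.norm_real, Complex.norm_real,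
      Real.norm_of_nonneg hκ.le, Real.norm_of_nonneg hκ'.le] at this
  rw [h2] at h1
  exact smul_right_injective _ (by exact_mod_cast hκ.ne' : (κ : ℂ) ≠ 0) h1

/-- A second contact point would put an open boundary segment in the supporting hyperplane. On it r
vanishes, so its second derivative at w along the segment cannot be positive, though v is tangent.
-/
theorem exposedBoundary_of_contDiff (hDc : Convex ℝ D) (hr : ContDiff ℝ 2 r)
    (hDr : D = {z | r z < 0}) (hdr : ∀ w ∈ frontier D, fderiv ℝ r w ≠ 0 ∧
      ∀ v : E, v ≠ 0 → fderiv ℝ r w v = 0 → 0 < fderiv ℝ (fderiv ℝ r) w v v) :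
    ExposedBoundary D := by
  intro w hw w' hw' b hb0 hb heq
  have hD : IsOpen D := by rw [hDr]; exact isOpen_lt hr.continuous continuous_const
  have hrw := eq_zero_of_mem_frontier_sublevel hr.continuous hDr hw
  obtain ⟨κ, hκ, h⟩ := exists_re_eq_mul_fderiv hr hDr hw (hdr w hw).1 hb0 hb
  by_contra hne
  set v := w' - w with hv
  have hv0 : v ≠ 0 := sub_ne_zero.2 hne
  have hbv : (b v).re = 0 := by rw [hv, map_sub, Complex.sub_re, heq, sub_self]
  have hrv : fderiv ℝ r w v = 0 := by
    have := h v
    rw [hbv, eq_comm, mul_eq_zero] at this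
    exact this.resolve_left hκ.ne'
  have hseg : ∀ t ∈ Ioo (0 : ℝ) 1, r (w + t • v) = 0 := by
    intro t ht
    refine eq_zero_of_mem_frontier_sublevel hr.continuous hDr ?_
    rw [hD.frontier_eq]
    refine ⟨hDc.closure.add_smul_sub_mem (frontier_subset_closure hw) hw' ⟨ht.1.le, ht.2.le⟩,
      fun hmem => ?_⟩
    have h1 := re_lt_of_supporting hD hb0 hb hmem
    rw [map_add, ← Complex.coe_smul, map_smul, smul_eq_mul, Complex.add_re, Complex.re_ofReal_mul,
      hbv, mul_zero, add_zero] at h1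
    exact lt_irrefl _ h1
  have hline : ∀ t : ℝ, HasDerivAt (fun t : ℝ => w + t • v) v t := fun t => by
    simpa using ((hasDerivAt_id t).smul_const v).const_add w
  have hd0 : ∀ t ∈ Ioo (0 : ℝ) 1, fderiv ℝ r (w + t • v) v = 0 := by
    intro t ht
    have h1 : HasDerivAt (fun t : ℝ => r (w + t • v)) (fderiv ℝ r (w + t • v) v) t :=
      ((hr.differentiable (by norm_num)) _).hasFDerivAt.comp_hasDerivAt t (hline t)
    have h2 : (fun t : ℝ => r (w + t • v)) =ᶠ[𝓝 t] fun _ => 0 := by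
      filter_upwards [isOpen_Ioo.mem_nhds ht] with s hs
      exact hseg s hs
    exact h1.unique ((hasDerivAt_const t (0 : ℝ)).congr_of_eventuallyEq h2)
  have h2 : HasDerivAt (fun t : ℝ => -fderiv ℝ r (w + t • v) v)
      (-fderiv ℝ (fderiv ℝ r) w v v) 0 := by
    have h3 : HasFDerivAt (fderiv ℝ r) (fderiv ℝ (fderiv ℝ r) w) (w + (0 : ℝ) • v) := by
      rw [zero_smul, add_zero]
      exact ((hr.fderiv_right (m := 1) (by norm_num)).differentiable (by norm_num) w).hasFDerivAt
    have h4 : HasDerivAt (fun t : ℝ => fderiv ℝ r (w + t • v)) (fderiv ℝ (fderiv ℝ r) w v) 0 :=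
      h3.comp_hasDerivAt (0 : ℝ) (hline 0)
    have h5 : HasDerivAt (fun t : ℝ => fderiv ℝ r (w + t • v) v)
        (fderiv ℝ (fderiv ℝ r) w v v) 0 :=
      (ContinuousLinearMap.apply ℝ ℝ v).hasFDerivAt.comp_hasDerivAt (0 : ℝ) h4
    exact h5.neg
  have h5 := nonneg_of_hasDerivAt_of_nonneg h2 (by simp [hrv])
    (fun t ht => by rw [hd0 t ht, neg_zero])
  have h6 := (hdr w hw).2 v hv0 hrv
  linarith

end StrongConvexity

/-! ### Lempert left inverses and supporting hyperplanes -/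

section LempertLeftInverses

variable {n : ℕ} {D : Set (EuclideanSpace ℂ (Fin n))} {f : ℂ → EuclideanSpace ℂ (Fin n)}

theorem IsGeodesicLeftInverse.isDualPair {G : EuclideanSpace ℂ (Fin n) → ℂ}
    (hG : IsGeodesicLeftInverse D f G) (hD : IsOpen D) (hDc : Convex ℝ D)
    (hf : DifferentiableOn ℂ f (ball 0 1)) (hfm : MapsTo f (ball 0 1) D) :
    IsDualPair D f (fun l => fderiv ℂ G (f l)) :=
  isDualPair_of_leftInverse hD hDc hf hfm hG.holo hG.mapsTo hG.left_inv

/-- Two complex functionals that take the value one at the same vector are equal if the kernel of the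
first is contained in the kernel of the second. -/
theorem clm_eq_of_ker_le {E : Type*} [NormedAddCommGroup E] [NormedSpace ℂ E] {b b' : E →L[ℂ] ℂ}
    {v : E} (hb : b v = 1) (hb' : b' v = 1) (h : ∀ e, b e = 0 → b' e = 0) : b = b' := by
  ext e
  have := h (e - b e • v) (by rw [map_sub, map_smul, hb, smul_eq_mul, mul_one, sub_self])
  rw [map_sub, map_smul, hb', smul_eq_mul, mul_one, sub_eq_zero] at this
  exact this.symm

/-- Each point lies on the hyperplane that is tangent to its fibre at the point of the geodesic. -/
theorem IsLempertLeftInverse.fderiv_apply_eq_zero {H : EuclideanSpace ℂ (Fin n) → ℂ}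
    (hH : IsLempertLeftInverse D f H) (hD : IsOpen D) (hfm : MapsTo f (ball 0 1) D)
    {z : EuclideanSpace ℂ (Fin n)} (hz : z ∈ D) : fderiv ℂ H (f (H z)) (z - f (H z)) = 0 := by
  have hl := hH.mapsTo hz
  set l := H z with hlz
  obtain ⟨a, c, -, heq⟩ := hH.fibre_eq l hl
  have hz' : a z = c := (heq.subset ⟨hz, hlz.symm⟩).1
  have hf' : a (f l) = c := (heq.subset ⟨hfm hl, hH.left_inv l hl⟩).1
  set e := z - f l with he
  have hae : a e = 0 := by rw [he, map_sub, hz', hf', sub_self]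
  have hline : HasDerivAt (fun t : ℂ => f l + t • e) e 0 := by
    simpa using ((hasDerivAt_id (0 : ℂ)).smul_const e).const_add (f l)
  have hd : HasFDerivAt H (fderiv ℂ H (f l)) (f l + (0 : ℂ) • e) := by
    rw [zero_smul, add_zero]
    exact (hH.holo.differentiableAt (hD.mem_nhds (hfm hl))).hasFDerivAt
  have h1 : HasDerivAt (fun t : ℂ => H (f l + t • e)) (fderiv ℂ H (f l) e) 0 :=
    hd.comp_hasDerivAt (0 : ℂ) hline
  -- The fibre hyperplane contains f l and z, so H is constant on the complex line joining them near
  -- f l.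
  have h2 : (fun t : ℂ => H (f l + t • e)) =ᶠ[𝓝 0] fun _ => l := by
    have hc : Tendsto (fun t : ℂ => f l + t • e) (𝓝 0) (𝓝 (f l)) := by
      simpa using hline.continuousAt.tendsto
    filter_upwards [hc.eventually (hD.mem_nhds (hfm hl))] with t ht
    exact (heq.superset ⟨show a (f l + t • e) = c by
      rw [map_add, map_smul, hae, smul_zero, add_zero, hf'], ht⟩).2
  exact h1.unique ((hasDerivAt_const (0 : ℂ) l).congr_of_eventuallyEq h2)

theorem IsDualPair.isLempertLeftInverse {h : ℂ → EuclideanSpace ℂ (Fin n) →L[ℂ] ℂ}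
    (hp : IsDualPair D f h) (hD : IsOpen D) (hDb : Bornology.IsBounded D)
    {H : EuclideanSpace ℂ (Fin n) → ℂ} (hHm : MapsTo H D (ball 0 1))
    (hH : ∀ z ∈ D, h (H z) (z - f (H z)) = 0) (hHd : DifferentiableOn ℂ H D)
    (hHf : ∀ l ∈ ball (0 : ℂ) 1, H (f l) = l) : IsLempertLeftInverse D f H where
  holo := hHd
  mapsTo := hHm
  left_inv := hHf
  fibre_eq l hl := by
    refine ⟨h l, h l (f l), hp.dual_ne_zero hl, Set.ext fun z => ⟨?_, ?_⟩⟩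
    · rintro ⟨hz, rfl⟩
      refine ⟨?_, hz⟩
      have := hH z hz
      rwa [map_sub, sub_eq_zero] at this
    · rintro ⟨hzl, hz⟩
      have hzl : h l z = h l (f l) := hzl
      exact ⟨hz, (hp.existsUnique_zero hD hDb hz).unique ⟨hHm hz, hH z hz⟩
        ⟨hl, by rw [map_sub, hzl, sub_self]⟩⟩

/-- A left inverse `H` of `f` yields a supporting half-space of the Kobayashi ball with centre `f 0`
at each point of `f`. -/
theorem IsGeodesicLeftInverse.re_le_of_mem_kobayashiBall {H : EuclideanSpace ℂ (Fin n) → ℂ}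
    (hH : IsGeodesicLeftInverse D f H) (hD : IsOpen D) (hDb : Bornology.IsBounded D)
    (hDc : Convex ℝ D) (hf : DifferentiableOn ℂ f (ball 0 1)) (hfm : MapsTo f (ball 0 1) D) {l : ℂ}
    (hl : l ∈ ball (0 : ℂ) 1) (hl0 : l ≠ 0) {z : EuclideanSpace ℂ (Fin n)}
    (hz : z ∈ kobayashiBall D (f 0) ‖l‖) :
    (conj l * fderiv ℂ H (f l) (z - f l)).re ≤ 0 := by
  have hln : 0 < ‖l‖ := norm_pos_iff.2 hl0
  -- The disc m ↦ ψ(τm/l) starts at f 0 and reaches z at m = l. Its convex combinations with f are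
  -- discs in D, so Schwarz bounds |H(f l + t(z - f l))| by |l|, with equality at t = 0.
  obtain ⟨ψ, τ, hτ0, hτl, hτ1, hψ, hψm, hψ0, hψτ⟩ :=
    exists_disc_of_mem_kobayashiBall hD hDb hDc (hfm (by simp)) hln hz
  have hmap : MapsTo (fun m : ℂ => (τ / l) * m) (ball 0 1) (ball 0 1) := by
    intro m hm
    rw [mem_ball_zero_iff] at hm ⊢
    rw [norm_mul, norm_div, Complex.norm_real, Real.norm_of_nonneg hτ0]
    have h1 : τ / ‖l‖ ≤ 1 := (div_le_one hln).2 hτl.le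
    calc τ / ‖l‖ * ‖m‖ ≤ 1 * ‖m‖ := by gcongr
      _ < 1 := by rwa [one_mul]
  have hline : HasDerivAt (fun t : ℂ => f l + t • (z - f l)) (z - f l) 0 := by
    simpa using ((hasDerivAt_id (0 : ℂ)).smul_const (z - f l)).const_add (f l)
  have hd : HasFDerivAt H (fderiv ℂ H (f l)) (f l + (0 : ℂ) • (z - f l)) := by
    rw [zero_smul, add_zero]
    exact (hH.holo.differentiableAt (hD.mem_nhds (hfm hl))).hasFDerivAt
  have hc : HasDerivAt (fun t : ℂ => H (f l + t • (z - f l))) (fderiv ℂ H (f l) (z - f l))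
      ((0 : ℝ) : ℂ) := by
    rw [Complex.ofReal_zero]
    exact hd.comp_hasDerivAt (0 : ℂ) hline
  have h1 : HasDerivAt (fun t : ℝ => H (f l + (t : ℂ) • (z - f l)))
      (fderiv ℂ H (f l) (z - f l)) 0 := hc.comp_ofReal
  have h2 := nonneg_of_hasDerivAt_of_nonneg (h1.norm_sq.const_sub (‖l‖ ^ 2))
    (by simp [hH.left_inv l hl]) (fun t ht => by
      have hg : DifferentiableOn ℂ (fun m => f m + (t : ℂ) • (ψ ((τ / l) * m) - f m)) (ball 0 1) :=
        hf.add (((hψ.comp (by fun_prop) hmap).sub hf).const_smul (t : ℂ))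
      have hgm : MapsTo (fun m => f m + (t : ℂ) • (ψ ((τ / l) * m) - f m)) (ball 0 1) D := fun m hm => by
        beta_reduce
        rw [Complex.coe_smul]
        exact hDc.add_smul_sub_mem (hfm hm) (hψm (hmap hm)) ⟨ht.1.le, ht.2.le⟩
      have h3 := Complex.norm_le_norm_of_mapsTo_ball (R := 1)
        (f := fun m => H (f m + (t : ℂ) • (ψ ((τ / l) * m) - f m))) (hH.holo.comp hg hgm)
        (fun m hm => ball_subset_closedBall (hH.mapsTo (hgm hm)))
        (by simp [hψ0, hH.left_inv 0 (by simp)]) (mem_ball_zero_iff.1 hl)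
      beta_reduce at h3
      rw [div_mul_cancel₀ _ hl0, hψτ] at h3
      have h4 := norm_nonneg (H (f l + (t : ℂ) • (z - f l)))
      nlinarith)
  rw [Complex.ofReal_zero, zero_smul, add_zero, hH.left_inv l hl, Complex.inner, mul_comm _ (conj l)] at h2
  linarith

theorem mem_frontier_kobayashiBall {H : EuclideanSpace ℂ (Fin n) → ℂ}
    (hH : IsGeodesicLeftInverse D f H) (hD : IsOpen D)
    (hDc : Convex ℝ D) (hf : DifferentiableOn ℂ f (ball 0 1)) (hfm : MapsTo f (ball 0 1) D) {l : ℂ}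
    (hl : l ∈ ball (0 : ℂ) 1) (hl0 : l ≠ 0) :
    f l ∈ frontier (kobayashiBall D (f 0) ‖l‖) := by
  have hln : 0 < ‖l‖ := norm_pos_iff.2 hl0
  have hl1 := mem_ball_zero_iff.1 hl
  refine ⟨?_, fun hint => ?_⟩
  · have hc : Tendsto (fun t : ℝ => f (t * l)) (𝓝[<] 1) (𝓝 (f l)) := by
      have h1 : Tendsto (fun t : ℝ => (t : ℂ) * l) (𝓝 1) (𝓝 (((1 : ℝ) : ℂ) * l)) :=
        Continuous.tendsto (by fun_prop) _
      rw [Complex.ofReal_one, one_mul] at h1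
      exact (hf.continuousOn.continuousAt (isOpen_ball.mem_nhds hl)).tendsto.comp
        (h1.mono_left nhdsWithin_le_nhds)
    refine mem_closure_of_tendsto hc ?_
    filter_upwards [Ioo_mem_nhdsLT (zero_lt_one (α := ℝ))] with t ht
    have h2 : ‖(t : ℂ) * l‖ < ‖l‖ := by
      rw [norm_mul, Complex.norm_real, Real.norm_of_nonneg ht.1.le]
      exact mul_lt_of_lt_one_left hln ht.2
    exact mem_kobayashiBall_of_disc hf hfm (mem_ball_zero_iff.2 (h2.trans hl1)) h2
  · have := norm_lt_of_mem_kobayashiBall hD hDc hH.holo hH.mapsTo (hfm (by simp))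
      (hH.left_inv 0 (by simp)) (interior_subset hint)
    rw [hH.left_inv l hl] at this
    exact lt_irrefl _ this

/-- Equal hyperplanes give equal kernels of Re(conj m · H'), hence of the complex functionals on
testing e and ie; both are 1 on f'. -/
theorem fderiv_eq_of_uniqueSupportingHyperplanes (hU : UniqueSupportingHyperplanes D (f 0))
    {H₁ H₂ : EuclideanSpace ℂ (Fin n) → ℂ} (hH₁ : IsGeodesicLeftInverse D f H₁)
    (hH₂ : IsGeodesicLeftInverse D f H₂) (hD : IsOpen D) (hDb : Bornology.IsBounded D)
    (hDc : Convex ℝ D) (hf : DifferentiableOn ℂ f (ball 0 1)) (hfm : MapsTo f (ball 0 1) D) {l : ℂ}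
    (hl : l ∈ ball (0 : ℂ) 1) : fderiv ℂ H₁ (f l) = fderiv ℂ H₂ (f l) := by
  have hp₁ := hH₁.isDualPair hD hDc hf hfm
  have hp₂ := hH₂.isDualPair hD hDc hf hfm
  have key : ∀ m ∈ ball (0 : ℂ) 1, m ≠ 0 → fderiv ℂ H₁ (f m) = fderiv ℂ H₂ (f m) := by
    intro m hm hm0
    have hcm : conj m ≠ 0 := (map_ne_zero _).2 hm0
    let a : (EuclideanSpace ℂ (Fin n) →L[ℂ] ℂ) → EuclideanSpace ℂ (Fin n) →L[ℝ] ℝ := fun b =>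
      Complex.reCLM.comp ((conj m • b).restrictScalars ℝ)
    have ha : ∀ b e, a b e = (conj m * b e).re := fun _ _ => rfl
    have hsupp : ∀ H : EuclideanSpace ℂ (Fin n) → ℂ, IsGeodesicLeftInverse D f H →
        IsSupportingHyperplane (kobayashiBall D (f 0) ‖m‖) (f m)
          {z | a (fderiv ℂ H (f m)) z = a (fderiv ℂ H (f m)) (f m)} := by
      intro H hH
      refine ⟨a (fderiv ℂ H (f m)), fun h0 => ?_, rfl, fun z hz => ?_⟩
      · have h1 := DFunLike.congr_fun h0 ((conj m)⁻¹ • deriv f m)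
        rw [ha, map_smul, (hH.isDualPair hD hDc hf hfm).apply_deriv m hm, smul_eq_mul, mul_one,
          mul_inv_cancel₀ hcm] at h1
        simp at h1
      · have h1 := hH.re_le_of_mem_kobayashiBall hD hDb hDc hf hfm hm hm0 hz
        rw [← ha, map_sub] at h1
        linarith
    have heq := hU ‖m‖ (norm_pos_iff.2 hm0) (mem_ball_zero_iff.1 hm) (f m)
      (mem_frontier_kobayashiBall hH₁ hD hDc hf hfm hm hm0) _ _ (hsupp H₁ hH₁) (hsupp H₂ hH₂)
    have hker : ∀ e, a (fderiv ℂ H₁ (f m)) e = 0 → a (fderiv ℂ H₂ (f m)) e = 0 := by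
      intro e he
      have h1 : f m + e ∈ {z | a (fderiv ℂ H₁ (f m)) z = a (fderiv ℂ H₁ (f m)) (f m)} := by
        rw [mem_ofPred_eq, map_add, he, add_zero]
      rw [heq, mem_ofPred_eq, map_add] at h1
      linarith
    refine clm_eq_of_ker_le (hp₁.apply_deriv m hm) (hp₂.apply_deriv m hm) fun e he => ?_
    have h1 := hker e (by rw [ha, he, mul_zero, Complex.zero_re])
    have h2 := hker (Complex.I • e) (by rw [ha, map_smul, he, smul_zero, mul_zero, Complex.zero_re])
    rw [ha] at h1 h2
    rw [map_smul, smul_eq_mul, mul_left_comm, Complex.I_mul_re, neg_eq_zero] at h2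
    have h3 : conj m * fderiv ℂ H₂ (f m) e = 0 := Complex.ext h1 h2
    exact (mul_eq_zero.1 h3).resolve_left hcm
  -- There is no ball of radius 0, so the centre is handled by continuity of the dual families.
  by_cases hl0 : l = 0
  · have hc₁ := (hp₁.holo_dual.continuousOn.continuousAt (isOpen_ball.mem_nhds hl)).tendsto
    have hc₂ := (hp₂.holo_dual.continuousOn.continuousAt (isOpen_ball.mem_nhds hl)).tendsto
    refine tendsto_nhds_unique (hc₁.mono_left nhdsWithin_le_nhds : Tendsto _ (𝓝[≠] l) _)
      ((hc₂.mono_left nhdsWithin_le_nhds).congr' ?_)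
    filter_upwards [self_mem_nhdsWithin, mem_nhdsWithin_of_mem_nhds (isOpen_ball.mem_nhds hl)]
      with m hm hmb
    exact (key m hmb (by rw [← hl0]; exact hm)).symm
  · exact key l hl hl0

/-- Both supporting functionals are maximised at R by the same disc φ. The resulting dual families
along φ coincide, and their common value at R recovers each functional up to a positive factor. -/
theorem uniqueSupportingHyperplanes_of_smooth (hD : IsOpen D) (hDb : Bornology.IsBounded D)
    (hDc : Convex ℝ D) (hS : UniqueUnitSupport D) (hC : ExposedBoundary D)
    {p : EuclideanSpace ℂ (Fin n)} (hp : p ∈ D) : UniqueSupportingHyperplanes D p := by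
  rintro R hR hR1 q hq S T ⟨a, ha0, rfl, ha⟩ ⟨b, hb0, rfl, hb⟩
  obtain ⟨φ, hφ, hφm, hφ0, hφR⟩ := exists_disc_of_mem_frontier hD hDb hDc hp hR hR1 hq
  have hRb : (R : ℂ) ∈ ball (0 : ℂ) 1 := by
    rw [mem_ball_zero_iff, Complex.norm_real, Real.norm_of_nonneg hR.le]; exact hR1
  have hdual : ∀ a : EuclideanSpace ℂ (Fin n) →L[ℝ] ℝ, a ≠ 0 →
      (∀ z ∈ kobayashiBall D p R, a z ≤ a q) →
      ∃ (h : ℂ → EuclideanSpace ℂ (Fin n) →L[ℂ] ℂ) (κ : ℝ), 0 < κ ∧ IsDualPair D φ h ∧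
        ∀ e, (h R e).re = κ * a e := fun a ha0 ha =>
    exists_isDualPair hD hDc ha0 hR hR1 hφ hφm fun ρ ψ hρ hψ hψm hψ0 => by
      rw [hφR]
      exact apply_disc_le_of_supporting hR hR1 ha (hψ.mono (ball_subset_ball hρ.le))
        (fun l hl => hψm l (ball_subset_closedBall hl)) (by rw [hψ0, hφ0])
  obtain ⟨h, κ, hκ, hdp, hh⟩ := hdual a ha0 ha
  obtain ⟨h', κ', hκ', hdp', hh'⟩ := hdual b hb0 hb
  have heq := hdp.eqOn hdp' hD hDb hDc hS hC hRb
  have hab : ∀ e, κ * a e = κ' * b e := fun e => by rw [← hh, ← hh', heq]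
  ext z
  have h1 := hab z
  have h2 := hab q
  rw [mem_ofPred_eq, mem_ofPred_eq]
  constructor
  · intro hz
    rw [hz, h2] at h1
    exact (mul_left_cancel₀ hκ'.ne' h1).symm
  · intro hz
    rw [hz, ← h2] at h1
    exact mul_left_cancel₀ hκ.ne' h1

end LempertLeftInverses

/-- For a vector `v`, the complex number `fderiv ℂ G p v` is `∑ⱼ (∂G/∂zⱼ)(p) vⱼ = v • G′(p)`. -/
theorem theorem2p1 {n : ℕ} (D : Set (EuclideanSpace ℂ (Fin n)))
    (hD : IsDomainIn D) (hDb : Bornology.IsBounded D) (hDc : Convex ℝ D)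
    (f : ℂ → EuclideanSpace ℂ (Fin n)) (hf : IsComplexGeodesic D f)
    (G : EuclideanSpace ℂ (Fin n) → ℂ) (hG : IsGeodesicLeftInverse D f G) :
    (∀ z ∈ D, ∃! lam : ℂ, lam ∈ ball (0 : ℂ) 1 ∧ fderiv ℂ G (f lam) (z - f lam) = 0) ∧
    (∃ H : EuclideanSpace ℂ (Fin n) → ℂ,
      (∀ z ∈ D, H z ∈ ball (0 : ℂ) 1 ∧ fderiv ℂ G (f (H z)) (z - f (H z)) = 0) ∧
      DifferentiableOn ℂ H D ∧
      IsLempertLeftInverse D f H ∧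
      (∀ lam ∈ ball (0 : ℂ) 1, fderiv ℂ H (f lam) = fderiv ℂ G (f lam)) ∧
      (IsLempertLeftInverse D f G → EqOn H G D)) ∧
    (UniqueSupportingHyperplanes D (f 0) →
      ∀ H₁ H₂ : EuclideanSpace ℂ (Fin n) → ℂ,
        IsLempertLeftInverse D f H₁ → IsLempertLeftInverse D f H₂ → EqOn H₁ H₂ D) ∧
    (IsStronglyConvexDomain D → UniqueSupportingHyperplanes D (f 0)) := by
  have hp := hG.isDualPair hD.1 hDc hf.holo hf.mapsTo
  refine ⟨fun z hz => hp.existsUnique_zero hD.1 hDb hz, ?_, ?_, ?_⟩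
  · obtain ⟨H, hHm, hH, hHd, hHf, hHdf⟩ := hp.exists_leftInverse hD.1 hDb
    refine ⟨H, fun z hz => ⟨hHm hz, hH z hz⟩, hHd,
      hp.isLempertLeftInverse hD.1 hDb hHm hH hHd hHf, hHdf, fun hGL z hz => ?_⟩
    exact (hp.existsUnique_zero hD.1 hDb hz).unique ⟨hHm hz, hH z hz⟩
      ⟨hG.mapsTo hz, hGL.fderiv_apply_eq_zero hD.1 hf.mapsTo hz⟩
  · intro hU H₁ H₂ hH₁ hH₂ z hz
    have hp₂ := hH₂.toIsGeodesicLeftInverse.isDualPair hD.1 hDc hf.holo hf.mapsTo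
    -- Both H₁ z and H₂ z solve the equation of the dual family of H₂, since the two differentials
    -- agree along f.
    refine (hp₂.existsUnique_zero hD.1 hDb hz).unique ⟨hH₁.mapsTo hz, ?_⟩
      ⟨hH₂.mapsTo hz, hH₂.fderiv_apply_eq_zero hD.1 hf.mapsTo hz⟩
    beta_reduce
    rw [← fderiv_eq_of_uniqueSupportingHyperplanes hU hH₁.toIsGeodesicLeftInverse
      hH₂.toIsGeodesicLeftInverse hD.1 hDb hDc hf.holo hf.mapsTo (hH₁.mapsTo hz)]
    exact hH₁.fderiv_apply_eq_zero hD.1 hf.mapsTo hz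
  · rintro ⟨-, -, r, hr, hDr, hdr⟩
    exact uniqueSupportingHyperplanes_of_smooth hD.1 hDb hDc
      (uniqueUnitSupport_of_contDiff hr hDr fun w hw => (hdr w hw).1)
      (exposedBoundary_of_contDiff hDc hr hDr hdr) (hf.mapsTo (by simp))
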